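/- Let $k\ge 1$ and let $Q$ be a smooth (Hausdorff, second countable) $n$-dimensional manifold. Let $T^rQ$ be the bundle of $r$-jets at $0$ of smooth curves in $Q$, with natural coordinates $(q^i_0,\dots,q^i_r)$ and projections $\rho^s_r:T^sQ\to T^rQ$. For $r<s$ let $j:T^sQ\to T(T^rQ)$ send the jet of a curve $c$ to the velocity at $0$ of the lift of $c$ to $T^rQ$. Let $L\in C^\infty(T^kQ\times\mathbb R)$, with $z$ the coordinate on $\mathbb R$, be a regular Lagrangian: the Hessian matrix $\big(\partial^2L/\partial q^i_k\,\partial q^j_k\big)$ is nonsingular at every point of $T^kQ\times\mathbb R$. Legendre map. For a $1$-form $\xi$ on $T^rQ\times\mathbb R$, $r\ge k$, let $D_L\xi=\mathcal L_\Gamma\xi-\frac{\partial L}{\partial z}\,\xi$, a $1$-form on $T^{r+1}Q\times\mathbb R$, where $\xi$ is pulled back to $T^{r+1}Q\times\mathbb R$ and $\Gamma$ is any vector field of the form $\sum_{\alpha=0}^{r} q^i_{\alpha+1}\frac{\partial}{\partial q^i_\alpha}+X^i\frac{\partial}{\partial q^i_{r+1}}+L\frac{\partial}{\partial z}$. Let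 $\mathcal J_\beta$ be the $\beta$-th vertical endomorphism of $T(T^kQ\times\mathbb R)$, that is $\mathcal J_\beta\frac{\partial}{\partial q^i_\alpha}=\frac{(\alpha+\beta)!}{\alpha!}\frac{\partial}{\partial q^i_{\alpha+\beta}}$ if $\alpha+\beta\le k$, and $\mathcal J_\beta$ is $0$ on the other coordinate vector fields. The Cartan form is $$\theta_L=\sum_{\beta=1}^k(-1)^{\beta-1}\frac1{\beta!}\,D_L^{\beta-1}\big(dL\circ\mathcal J_\beta\big)$$ on $T^{2k-1}Q\times\mathbb R$, and $\mathrm{Leg}:T^{2k-1}Q\times\mathbb R\to T^*(T^{k-1}Q)\times\mathbb R$ maps $x=(p,z)$ to $(\xi,z)$, where $\xi$ is the covector at $\rho^{2k-1}_{k-1}(p)$ such that $(\theta_L)_x(u)=\langle\xi,T(\rho^{2k-1}_{k-1}\circ \mathrm{pr}_1)(u)\rangle$ for all $u\in T_x(T^{2k-1}Q\times\mathbb R)$. Unified bundle. Let $\mathcal W=T^{2k-1}Q\times_{T^{k-1}Q}T^*(T^{k-1}Q)\times\mathbb R$, with points $w=(p,\xi,z)$. Let $\eta_{\mathcal W}$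 be the pull-back to $\mathcal W$ of the canonical contact form $dz-\theta_{k-1}$ of $T^*(T^{k-1}Q)\times\mathbb R$, where $\theta_{k-1}$ is the tautological $1$-form. Let $\mathcal H(p,\xi,z)=\langle\xi,j(p)\rangle-L(\rho^{2k-1}_k(p),z)$ with $j:T^{2k-1}Q\to T(T^{k-1}Q)$, and let $\mathcal R=\partial/\partial z$. Let $\mathcal W_1=\{(p,\xi,z)\in\mathcal W:(\xi,z)=\mathrm{Leg}(p,z)\}$ be the graph of $\mathrm{Leg}$. Then there is exactly one smooth vector field $X_{\mathcal H}$ on $\mathcal W$ along $\mathcal W_1$ (that is, a smooth section of $T\mathcal W|_{\mathcal W_1}$) that is tangent to $\mathcal W_1$ and satisfies, at every point of $\mathcal W_1$, $$\iota_{X_{\mathcal H}}d\eta_{\mathcal W}=d\mathcal H-\mathcal R(\mathcal H)\,\eta_{\mathcal W},\qquad \iota_{X_{\mathcal H}}\eta_{\mathcal W}=-\mathcal H .$$ Moreover $X_{\mathcal H}$ is a semispray of type $1$ (a holonomic vector field) in $\mathcal W$: for each of its integral curves $\sigma$, the projection of $\sigma$ to $T^{2k-1}Q$ is the canonical lift of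 the projection of $\sigma$ to $Q$. -/

import Mathlib

open Set Filter Topology Bundle
open scoped Manifold ContDiff Matrix Nat

set_option linter.unusedSectionVars false

namespace HOContact

noncomputable section

section Calculus

variable {E F : Type*} [NormedAddCommGroup E] [NormedSpace ℝ E]
  [NormedAddCommGroup F] [NormedSpace ℝ F]

/-- The derivatives at `0` up to order `k` of `ψ ∘ f` only depend on those of `f`. -/
theorem iteratedDeriv_comp_congr {ψ : E → F} {f g : ℝ → E} {k : ℕ}
    (hψ : ContDiffAt ℝ ∞ ψ (f 0)) (hf : ContDiffAt ℝ ∞ f 0) (hg : ContDiffAt ℝ ∞ g 0)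
    (h : ∀ j ≤ k, iteratedDeriv j f 0 = iteratedDeriv j g 0) :
    ∀ j ≤ k, iteratedDeriv j (ψ ∘ f) 0 = iteratedDeriv j (ψ ∘ g) 0 := by
  intro j hj
  have h0 : f 0 = g 0 := by simpa using h 0 (Nat.zero_le _)
  have hle : ((j : ℕ) : WithTop ℕ∞) ≤ ∞ := by exact_mod_cast le_top
  have key : ∀ i ≤ k, iteratedFDeriv ℝ i f 0 = iteratedFDeriv ℝ i g 0 := by
    intro i hi
    rw [iteratedFDeriv_eq_equiv_comp, iteratedFDeriv_eq_equiv_comp]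
    simp only [Function.comp_apply, h i hi]
  rw [iteratedDeriv_eq_iteratedFDeriv, iteratedDeriv_eq_iteratedFDeriv,
    iteratedFDeriv_comp hψ hf hle, iteratedFDeriv_comp (h0 ▸ hψ) hg hle]
  congr 1
  simp only [FormalMultilinearSeries.taylorComp, h0]
  refine Finset.sum_congr rfl fun c _ => ?_
  simp only [FormalMultilinearSeries.compAlongOrderedFinpartition]
  congr 1
  funext i
  exact key _ ((c.partSize_le i).trans hj)

/-- The iterated partial derivatives in `t` of a smooth function of `(y, t)` are smooth. -/
theorem contDiffOn_iteratedDeriv_slice {Y : Type*} [NormedAddCommGroup Y] [NormedSpace ℝ Y]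
    {U : Set (Y × ℝ)} (hU : IsOpen U) (i : ℕ) :
    ∀ {G : Y × ℝ → F}, ContDiffOn ℝ ∞ G U →
      ContDiffOn ℝ ∞ (fun p : Y × ℝ => iteratedDeriv i (fun t => G (p.1, t)) p.2) U := by
  induction i with
  | zero => intro G hG; simpa using hG
  | succ i ih =>
    intro G hG
    have h1 : ContDiffOn ℝ ∞ (fun p : Y × ℝ => fderiv ℝ G p (0, 1)) U :=
      (hG.fderiv_of_isOpen hU (m := ∞) (by simp)).clm_apply contDiffOn_const
    refine (ih h1).congr ?_
    rintro ⟨y, t⟩ hp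
    simp only [iteratedDeriv_succ']
    refine Filter.EventuallyEq.iteratedDeriv_eq (n := i) ?_
    have hc : ContinuousAt (fun s : ℝ => (y, s)) t := by fun_prop
    filter_upwards [hc.preimage_mem_nhds (hU.mem_nhds hp)] with s hs
    have hd : HasFDerivAt G (fderiv ℝ G (y, s)) (y, s) :=
      ((hG.contDiffAt (hU.mem_nhds hs)).differentiableAt (by simp)).hasFDerivAt
    have hl : HasDerivAt (fun s : ℝ => (y, s)) ((0 : Y), (1 : ℝ)) s :=
      (hasDerivAt_const s y).prodMk (hasDerivAt_id s)
    exact (hd.comp_hasDerivAt s hl).deriv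

/-- The polynomial curve whose derivatives at `0` up to order `k` are `y 0, …, y k`. -/
def taylorCurve {k : ℕ} (y : Fin (k + 1) → E) (t : ℝ) : E :=
  ∑ j : Fin (k + 1), (t ^ (j : ℕ) / ((j : ℕ)! : ℝ)) • y j

theorem contDiff_taylorCurve {k : ℕ} :
    ContDiff ℝ ∞ (fun p : (Fin (k + 1) → E) × ℝ => taylorCurve p.1 p.2) := by
  unfold taylorCurve
  fun_prop

theorem contDiff_taylorCurve' {k : ℕ} (y : Fin (k + 1) → E) :
    ContDiff ℝ ∞ (taylorCurve y) := by
  unfold taylorCurve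
  fun_prop

theorem taylorCurve_zero {k : ℕ} (y : Fin (k + 1) → E) : taylorCurve y 0 = y 0 := by
  simp [taylorCurve, Fin.sum_univ_succ]

theorem iteratedDeriv_taylorCurve {k : ℕ} (y : Fin (k + 1) → E) (i : Fin (k + 1)) :
    iteratedDeriv i (taylorCurve y) 0 = y i := by
  have h : taylorCurve y = fun t : ℝ =>
      ∑ j : Fin (k + 1), (fun t : ℝ => (t ^ (j : ℕ) / ((j : ℕ)! : ℝ)) • y j) t := rfl
  rw [h, iteratedDeriv_fun_sum (fun j _ => by fun_prop)]
  have key : ∀ j : Fin (k + 1), iteratedDeriv i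
      (fun t : ℝ => (t ^ (j : ℕ) / ((j : ℕ)! : ℝ)) • y j) 0 = if i = j then y i else 0 := by
    intro j
    have h1 : (fun t : ℝ => (t ^ (j : ℕ) / ((j : ℕ)! : ℝ)) • y j)
        = fun t : ℝ => (t ^ (j : ℕ)) • ((((j : ℕ)! : ℝ))⁻¹ • y j) := by
      funext t; rw [smul_smul, div_eq_mul_inv]
    rw [h1, iteratedDeriv_smul_const (by fun_prop), iteratedDeriv_fun_pow_zero]
    by_cases hij : i = j
    · subst hij
      have : ((i : ℕ)! : ℝ) ≠ 0 := by positivity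
      simp [smul_smul, this]
    · have : (i : ℕ) ≠ (j : ℕ) := fun h => hij (Fin.ext h)
      simp [hij, this]
  simp [key]

end Calculus

section Jets

variable (E : Type*) [NormedAddCommGroup E] [NormedSpace ℝ E]
  (Q : Type*) [TopologicalSpace Q] [ChartedSpace E Q]

/-- A curve in `Q` is smooth near `0`. -/
def SmoothNearZero (c : ℝ → Q) : Prop :=
  ∀ᶠ t in 𝓝 (0 : ℝ), ContMDiffAt 𝓘(ℝ, ℝ) 𝓘(ℝ, E) ∞ c t

/-- Curves in `Q`, smooth near `0` (their values far from `0` are irrelevant). -/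
abbrev GermCurve : Type _ := {c : ℝ → Q // SmoothNearZero E Q c}

/-- Equality of `k`-jets at `0`: same value at `0` and, in every chart of the atlas around that
value, same derivatives at `0` up to order `k`. -/
def jetSetoid (k : ℕ) : Setoid (GermCurve E Q) where
  r c c' := c.1 0 = c'.1 0 ∧ ∀ e ∈ atlas E Q, c.1 0 ∈ e.source →
    ∀ j ≤ k, iteratedDeriv j (e ∘ c.1) 0 = iteratedDeriv j (e ∘ c'.1) 0
  iseqv :=
    { refl := fun _ => ⟨rfl, fun _ _ _ _ _ => rfl⟩
      symm := fun h => ⟨h.1.symm, fun e he hs j hj => (h.2 e he (h.1 ▸ hs) j hj).symm⟩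
      trans := fun h h' => ⟨h.1.trans h'.1, fun e he hs j hj =>
        (h.2 e he hs j hj).trans (h'.2 e he (h.1 ▸ hs) j hj)⟩ }

/-- The `k`-th order tangent bundle `T^k Q`, as the set of `k`-jets at `0` of curves in `Q`. -/
def Jet (k : ℕ) : Type _ := Quotient (jetSetoid E Q k)

variable {E Q}

/-- The `k`-jet at `0` of a curve that is smooth near `0`. -/
def Jet.mk (k : ℕ) (c : GermCurve E Q) : Jet E Q k := Quotient.mk (jetSetoid E Q k) c

theorem Jet.mk_eq_iff {k : ℕ} {c c' : GermCurve E Q} :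
    Jet.mk k c = Jet.mk k c' ↔ c.1 0 = c'.1 0 ∧ ∀ e ∈ atlas E Q, c.1 0 ∈ e.source →
      ∀ j ≤ k, iteratedDeriv j (e ∘ c.1) 0 = iteratedDeriv j (e ∘ c'.1) 0 :=
  Quotient.eq (r := jetSetoid E Q k)

/-- A curve representing a jet. -/
def Jet.rep {k : ℕ} (p : Jet E Q k) : GermCurve E Q := Quotient.out p

theorem Jet.mk_rep {k : ℕ} (p : Jet E Q k) : Jet.mk k p.rep = p := Quotient.out_eq p

/-- The base point `ρ^k_0 (p)` in `Q` of a jet. -/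
def Jet.base {k : ℕ} (p : Jet E Q k) : Q := p.rep.1 0

theorem Jet.base_mk {k : ℕ} (c : GermCurve E Q) : (Jet.mk k c).base = c.1 0 :=
  (Jet.mk_eq_iff.1 (Jet.mk_rep (Jet.mk k c))).1

theorem smoothNearZero_const (x : Q) : SmoothNearZero E Q (fun _ => x) :=
  Eventually.of_forall fun _ => contMDiffAt_const

open Classical in
/-- The `k`-jet at `0` of a curve `c`; if `c` is not smooth near `0`, the jet of a constant. -/
def jetOf (E : Type*) [NormedAddCommGroup E] [NormedSpace ℝ E]
    {Q : Type*} [TopologicalSpace Q] [ChartedSpace E Q] (k : ℕ) (c : ℝ → Q) : Jet E Q k :=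
  if h : SmoothNearZero E Q c then Jet.mk k ⟨c, h⟩
  else Jet.mk k ⟨fun _ => c 0, smoothNearZero_const (c 0)⟩

theorem base_jetOf (k : ℕ) (c : ℝ → Q) : (jetOf E k c).base = c 0 := by
  unfold jetOf
  split_ifs <;> exact Jet.base_mk _

theorem jetOf_rep {k : ℕ} (p : Jet E Q k) : jetOf E k p.rep.1 = p := by
  unfold jetOf
  rw [dif_pos p.rep.2]
  exact p.mk_rep

/-- The canonical lift `c̄^k` to `T^k Q` of a curve `c` in `Q`: its value at `t` is the `k`-jet at
`0` of `s ↦ c (s + t)`. -/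
def prolong (E : Type*) [NormedAddCommGroup E] [NormedSpace ℝ E]
    {Q : Type*} [TopologicalSpace Q] [ChartedSpace E Q] (k : ℕ) (c : ℝ → Q) (t : ℝ) : Jet E Q k :=
  jetOf E k (fun s => c (s + t))

/-- The projection `ρ^s_r : T^s Q → T^r Q`. -/
def jetProj {r s : ℕ} (h : r ≤ s) : Jet E Q s → Jet E Q r :=
  Quotient.map' (s₁ := jetSetoid E Q s) (s₂ := jetSetoid E Q r) id
    fun _ _ hc => ⟨hc.1, fun e he hs j hj => hc.2 e he hs j (hj.trans h)⟩

theorem jetProj_mk {r s : ℕ} (h : r ≤ s) (c : GermCurve E Q) :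
    jetProj h (Jet.mk s c) = Jet.mk r c := rfl

theorem base_jetProj {r s : ℕ} (h : r ≤ s) (p : Jet E Q s) : (jetProj h p).base = p.base := by
  rw [← p.mk_rep, jetProj_mk, Jet.base_mk, Jet.base_mk]

/-- The natural coordinates `(q_0, …, q_k)` of a jet in a chart `e` of `Q`: the derivatives at `0`
of the local expression of a representing curve. -/
def jetCoord (e : OpenPartialHomeomorph Q E) {k : ℕ} (p : Jet E Q k) : Fin (k + 1) → E :=
  fun i => iteratedDeriv i (e ∘ p.rep.1) 0

theorem jetCoord_mk {e : OpenPartialHomeomorph Q E} (he : e ∈ atlas E Q) {k : ℕ}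
    (c : GermCurve E Q) (hc : c.1 0 ∈ e.source) (i : Fin (k + 1)) :
    jetCoord e (Jet.mk k c) i = iteratedDeriv i (e ∘ c.1) 0 := by
  have h := Jet.mk_eq_iff.1 (Jet.mk_rep (Jet.mk k c)).symm
  exact (h.2 e he hc i (Nat.lt_succ_iff.1 i.2)).symm

theorem jetCoord_zero (e : OpenPartialHomeomorph Q E) {k : ℕ} (p : Jet E Q k) :
    jetCoord e p 0 = e p.base := by
  simp [jetCoord, Jet.base]

/-- The jet with given natural coordinates in a chart `e` of `Q`. -/
def jetOfCoord (e : OpenPartialHomeomorph Q E) {k : ℕ} (y : Fin (k + 1) → E) : Jet E Q k :=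
  jetOf E k (e.symm ∘ taylorCurve y)

theorem base_jetOfCoord (e : OpenPartialHomeomorph Q E) {k : ℕ} (y : Fin (k + 1) → E) :
    (jetOfCoord e y).base = e.symm (y 0) := by
  simp [jetOfCoord, base_jetOf, taylorCurve_zero]

variable [IsManifold 𝓘(ℝ, E) ∞ Q]

theorem contMDiffAt_chart_comp {e : OpenPartialHomeomorph Q E} (he : e ∈ atlas E Q)
    (c : GermCurve E Q) (hc : c.1 0 ∈ e.source) : ContDiffAt ℝ ∞ (e ∘ c.1) 0 := by
  rw [← contMDiffAt_iff_contDiffAt]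
  exact (contMDiffAt_of_mem_maximalAtlas
    (IsManifold.subset_maximalAtlas he) hc).comp 0 c.2.self_of_nhds

theorem contDiffOn_transition {e e' : OpenPartialHomeomorph Q E} (he : e ∈ atlas E Q)
    (he' : e' ∈ atlas E Q) :
    ContDiffOn ℝ ∞ (e' ∘ e.symm) (e.target ∩ e.symm ⁻¹' e'.source) := by
  rw [← contMDiffOn_iff_contDiffOn]
  exact (contMDiffOn_of_mem_maximalAtlas (IsManifold.subset_maximalAtlas he')).comp'
    (contMDiffOn_symm_of_mem_maximalAtlas (IsManifold.subset_maximalAtlas he))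

theorem isOpen_transition (e e' : OpenPartialHomeomorph Q E) :
    IsOpen (e.target ∩ e.symm ⁻¹' e'.source) :=
  e.isOpen_inter_preimage_symm e'.open_source

/-- Jets are determined by their natural coordinates in one chart. -/
theorem Jet.mk_eq_of_coord {e : OpenPartialHomeomorph Q E} (he : e ∈ atlas E Q) {k : ℕ}
    {c c' : GermCurve E Q} (hc : c.1 0 ∈ e.source) (h0 : c.1 0 = c'.1 0)
    (h : ∀ j ≤ k, iteratedDeriv j (e ∘ c.1) 0 = iteratedDeriv j (e ∘ c'.1) 0) :
    Jet.mk k c = Jet.mk k c' := by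
  refine Jet.mk_eq_iff.2 ⟨h0, fun e' he' hs j hj => ?_⟩
  have hc' : c'.1 0 ∈ e.source := h0 ▸ hc
  have hmem : e (c.1 0) ∈ e.target ∩ e.symm ⁻¹' e'.source :=
    ⟨e.map_source hc, by simpa [e.left_inv hc] using hs⟩
  have hψ : ContDiffAt ℝ ∞ (e' ∘ e.symm) ((e ∘ c.1) 0) :=
    (contDiffOn_transition he he').contDiffAt ((isOpen_transition e e').mem_nhds hmem)
  have key := iteratedDeriv_comp_congr hψ (contMDiffAt_chart_comp he c hc)
    (contMDiffAt_chart_comp he c' hc') h j hj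
  have aux : ∀ d : GermCurve E Q, d.1 0 ∈ e.source →
      (e' ∘ e.symm) ∘ (e ∘ d.1) =ᶠ[𝓝 0] e' ∘ d.1 := by
    intro d hd
    filter_upwards [d.2.self_of_nhds.continuousAt.preimage_mem_nhds
      (e.open_source.mem_nhds hd)] with t ht
    simp [e.left_inv ht]
  rw [(aux c hc).iteratedDeriv_eq, (aux c' hc').iteratedDeriv_eq] at key
  exact key

theorem smoothNearZero_taylor {e : OpenPartialHomeomorph Q E} (he : e ∈ atlas E Q) {k : ℕ}
    {y : Fin (k + 1) → E} (hy : y 0 ∈ e.target) :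
    SmoothNearZero E Q (e.symm ∘ taylorCurve y) := by
  have hcont : ContinuousAt (taylorCurve y) 0 := (contDiff_taylorCurve' y).continuous.continuousAt
  have hmem : e.target ∈ 𝓝 (taylorCurve y 0) := by
    rw [taylorCurve_zero]; exact e.open_target.mem_nhds hy
  filter_upwards [hcont.preimage_mem_nhds hmem] with t ht
  exact (contMDiffOn_symm_of_mem_maximalAtlas (IsManifold.subset_maximalAtlas he)).contMDiffAt
    (e.open_target.mem_nhds ht) |>.comp t (contDiff_taylorCurve' y).contMDiff.contMDiffAt

theorem jetCoord_jetOfCoord {e e' : OpenPartialHomeomorph Q E} (he : e ∈ atlas E Q)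
    (he' : e' ∈ atlas E Q) {k : ℕ} {y : Fin (k + 1) → E} (hy : y 0 ∈ e.target)
    (hy' : e.symm (y 0) ∈ e'.source) (i : Fin (k + 1)) :
    jetCoord e' (jetOfCoord e y) i = iteratedDeriv i ((e' ∘ e.symm) ∘ taylorCurve y) 0 := by
  rw [jetOfCoord, jetOf, dif_pos (smoothNearZero_taylor he hy), jetCoord_mk he']
  · rfl
  · simpa [taylorCurve_zero] using hy'

/-- The natural chart of `T^k Q` induced by a chart of `Q`. -/
def jetChart (k : ℕ) (e : OpenPartialHomeomorph Q E) (he : e ∈ atlas E Q) :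
    PartialEquiv (Jet E Q k) (Fin (k + 1) → E) where
  toFun := jetCoord e
  invFun := jetOfCoord e
  source := {p | p.base ∈ e.source}
  target := {y | y 0 ∈ e.target}
  map_source' := fun p hp => by
    simpa [jetCoord_zero] using e.map_source hp
  map_target' := fun y hy => by
    simpa [base_jetOfCoord] using e.map_target hy
  left_inv' := fun p hp => by
    have hp' : p.rep.1 0 ∈ e.source := hp
    have h0 : jetCoord e p 0 ∈ e.target := by
      rw [jetCoord_zero]; exact e.map_source hp
    rw [jetOfCoord, jetOf, dif_pos (smoothNearZero_taylor he h0)]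
    conv_rhs => rw [← p.mk_rep]
    have hb : (e.symm ∘ taylorCurve (jetCoord e p)) 0 = p.rep.1 0 := by
      rw [Function.comp_apply, taylorCurve_zero, jetCoord_zero]
      exact e.left_inv hp
    refine Jet.mk_eq_of_coord he
      (by change (e.symm ∘ taylorCurve (jetCoord e p)) 0 ∈ _; rw [hb]; exact hp') hb fun j hj => ?_
    have hev : e ∘ (e.symm ∘ taylorCurve (jetCoord e p)) =ᶠ[𝓝 0] taylorCurve (jetCoord e p) := by
      have hcont : ContinuousAt (taylorCurve (jetCoord e p)) 0 :=
        (contDiff_taylorCurve' _).continuous.continuousAt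
      filter_upwards [hcont.preimage_mem_nhds
        (by rw [taylorCurve_zero]; exact e.open_target.mem_nhds h0)] with t ht
      exact e.right_inv ht
    rw [hev.iteratedDeriv_eq]
    exact iteratedDeriv_taylorCurve (jetCoord e p) ⟨j, Nat.lt_succ_iff.2 hj⟩
  right_inv' := fun y hy => by
    funext i
    rw [jetCoord_jetOfCoord he he hy (e.map_target hy)]
    have hev : (e ∘ e.symm) ∘ taylorCurve y =ᶠ[𝓝 0] taylorCurve y := by
      have hcont : ContinuousAt (taylorCurve y) 0 :=
        (contDiff_taylorCurve' _).continuous.continuousAt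
      filter_upwards [hcont.preimage_mem_nhds
        (by rw [taylorCurve_zero]; exact e.open_target.mem_nhds hy)] with t ht
      exact e.right_inv ht
    rw [hev.iteratedDeriv_eq, iteratedDeriv_taylorCurve]

theorem jetChart_trans_source (k : ℕ) {e e' : OpenPartialHomeomorph Q E} (he : e ∈ atlas E Q)
    (he' : e' ∈ atlas E Q) : ((jetChart k e he).symm.trans (jetChart k e' he')).source =
      {y | y 0 ∈ e.target ∩ e.symm ⁻¹' e'.source} := by
  ext y
  simp [jetChart, PartialEquiv.trans_source, base_jetOfCoord]

/-- The changes of natural coordinates are smooth. -/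
theorem contDiffOn_jetChart_trans (k : ℕ) {e e' : OpenPartialHomeomorph Q E}
    (he : e ∈ atlas E Q) (he' : e' ∈ atlas E Q) :
    ContDiffOn ℝ ∞ ((jetChart k e he).symm.trans (jetChart k e' he'))
      ((jetChart k e he).symm.trans (jetChart k e' he')).source := by
  rw [jetChart_trans_source, contDiffOn_pi]
  intro i
  set V := e.target ∩ e.symm ⁻¹' e'.source with hV
  let U : Set ((Fin (k + 1) → E) × ℝ) := (fun p => taylorCurve p.1 p.2) ⁻¹' V
  have hU : IsOpen U := (isOpen_transition e e').preimage contDiff_taylorCurve.continuous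
  have hG : ContDiffOn ℝ ∞
      (fun p : (Fin (k + 1) → E) × ℝ => (e' ∘ e.symm) (taylorCurve p.1 p.2)) U :=
    (contDiffOn_transition he he').comp contDiff_taylorCurve.contDiffOn fun _ hp => hp
  have h1 := contDiffOn_iteratedDeriv_slice hU i hG
  have h2 : ContDiffOn ℝ ∞ (fun y : Fin (k + 1) → E => (y, (0 : ℝ))) {y | y 0 ∈ V} := by
    fun_prop
  refine (h1.comp h2 fun y hy => ?_).congr fun y hy => ?_
  · change taylorCurve y 0 ∈ V
    rw [taylorCurve_zero]; exact hy
  · exact jetCoord_jetOfCoord he he' hy.1 hy.2 i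

/-- The natural charts form an atlas of `T^k Q`. -/
def jetCore (E : Type*) [NormedAddCommGroup E] [NormedSpace ℝ E]
    (Q : Type*) [TopologicalSpace Q] [ChartedSpace E Q] [IsManifold 𝓘(ℝ, E) ∞ Q] (k : ℕ) :
    ChartedSpaceCore (Fin (k + 1) → E) (Jet E Q k) where
  atlas := {f | ∃ (e : OpenPartialHomeomorph Q E) (he : e ∈ atlas E Q), f = jetChart k e he}
  chartAt := fun p => jetChart k (chartAt E p.base) (chart_mem_atlas E p.base)
  mem_chart_source := fun p => mem_chart_source E p.base
  chart_mem_atlas := fun p => ⟨_, _, rfl⟩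
  open_source := by
    rintro _ _ ⟨e, he, rfl⟩ ⟨e', he', rfl⟩
    rw [jetChart_trans_source]
    exact (isOpen_transition e e').preimage (continuous_apply 0)
  continuousOn_toFun := by
    rintro _ _ ⟨e, he, rfl⟩ ⟨e', he', rfl⟩
    exact (contDiffOn_jetChart_trans k he he').continuousOn

instance instTopologicalSpaceJet (k : ℕ) : TopologicalSpace (Jet E Q k) :=
  (jetCore E Q k).toTopologicalSpace

instance instChartedSpaceJet (k : ℕ) : ChartedSpace (Fin (k + 1) → E) (Jet E Q k) :=
  (jetCore E Q k).toChartedSpace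

theorem mem_atlas_jet {k : ℕ} {f : OpenPartialHomeomorph (Jet E Q k) (Fin (k + 1) → E)} :
    f ∈ atlas (Fin (k + 1) → E) (Jet E Q k) ↔
      ∃ (e : OpenPartialHomeomorph Q E) (he : e ∈ atlas E Q), f.toPartialEquiv = jetChart k e he := by
  change f ∈ (⋃ (e) (he), _) ↔ _
  simp only [mem_iUnion, mem_singleton_iff]
  constructor
  · rintro ⟨_, ⟨e, he, rfl⟩, rfl⟩
    exact ⟨e, he, rfl⟩
  · rintro ⟨e, he, h⟩
    exact ⟨_, ⟨e, he, rfl⟩, OpenPartialHomeomorph.toPartialEquiv_injective h⟩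

theorem chartAt_jet {k : ℕ} (p : Jet E Q k) :
    (chartAt (Fin (k + 1) → E) p).toPartialEquiv =
      jetChart k (chartAt E p.base) (chart_mem_atlas E p.base) := rfl

instance instIsManifoldJet (k : ℕ) : IsManifold 𝓘(ℝ, Fin (k + 1) → E) ∞ (Jet E Q k) := by
  refine isManifold_of_contDiffOn _ _ _ fun f f' hf hf' => ?_
  obtain ⟨e, he, h⟩ := mem_atlas_jet.1 hf
  obtain ⟨e', he', h'⟩ := mem_atlas_jet.1 hf'
  have key := contDiffOn_jetChart_trans k he he'
  rw [← h, ← h'] at key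
  simpa using key

theorem jetCoord_jetProj {e : OpenPartialHomeomorph Q E} (he : e ∈ atlas E Q) {r s : ℕ}
    (h : r ≤ s) (p : Jet E Q s) (hp : p.base ∈ e.source) (i : Fin (r + 1)) :
    jetCoord e (jetProj h p) i = jetCoord e p (Fin.castLE (Nat.succ_le_succ h) i) := by
  have hp' : p.rep.1 0 ∈ e.source := hp
  conv_lhs => rw [← p.mk_rep, jetProj_mk, jetCoord_mk he _ hp']
  rfl

theorem contMDiff_jetProj {r s : ℕ} (h : r ≤ s) :
    ContMDiff 𝓘(ℝ, Fin (s + 1) → E) 𝓘(ℝ, Fin (r + 1) → E) ∞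
      (jetProj h : Jet E Q s → Jet E Q r) := by
  intro p
  set e := chartAt E (jetProj h p).base with he_def
  have he : e ∈ atlas E Q := chart_mem_atlas E _
  have hpe : p.base ∈ e.source := by
    rw [← base_jetProj h p]; exact mem_chart_source E _
  let g := chartAt (Fin (r + 1) → E) (jetProj h p)
  let f := (jetCore E Q s).openPartialHomeomorph (jetChart s e he) ⟨e, he, rfl⟩
  have hf : f ∈ atlas (Fin (s + 1) → E) (Jet E Q s) := mem_atlas_jet.2 ⟨e, he, rfl⟩
  have hpf : p ∈ f.source := hpe
  let res : (Fin (s + 1) → E) → (Fin (r + 1) → E) :=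
    fun y i => y (Fin.castLE (Nat.succ_le_succ h) i)
  have hres : ∀ q ∈ f.source, g (jetProj h q) = res (f q) := fun q hq =>
    funext fun i => jetCoord_jetProj he h q hq i
  have hsrc : ∀ q ∈ f.source, jetProj h q ∈ g.source := fun q hq => by
    change (jetProj h q).base ∈ e.source
    rw [base_jetProj]; exact hq
  have h1 : ContMDiffAt 𝓘(ℝ, Fin (s + 1) → E) 𝓘(ℝ, Fin (s + 1) → E) ∞ f p :=
    contMDiffAt_of_mem_maximalAtlas (IsManifold.subset_maximalAtlas hf) hpf
  have h2 : ContMDiffAt 𝓘(ℝ, Fin (s + 1) → E) 𝓘(ℝ, Fin (r + 1) → E) ∞ res (f p) :=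
    (contDiff_pi.2 fun i => contDiff_apply ℝ E _ : ContDiff ℝ ∞ res).contMDiff.contMDiffAt
  have h3 : ContMDiffAt 𝓘(ℝ, Fin (r + 1) → E) 𝓘(ℝ, Fin (r + 1) → E) ∞ g.symm (res (f p)) := by
    rw [← hres p hpf]
    exact contMDiffOn_chart_symm.contMDiffAt
      (g.open_target.mem_nhds (g.map_source (hsrc p hpf)))
  refine ((h3.comp (f p) h2).comp p h1).congr_of_eventuallyEq ?_
  filter_upwards [f.open_source.mem_nhds hpf] with q hq
  change jetProj h q = g.symm (res (f q))
  rw [← hres q hq, g.left_inv (hsrc q hq)]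

/-- The projection `ρ^s_r` as a smooth map. -/
def jetProjMap {r s : ℕ} (h : r ≤ s) : C^∞⟮𝓘(ℝ, Fin (s + 1) → E), Jet E Q s;
    𝓘(ℝ, Fin (r + 1) → E), Jet E Q r⟯ :=
  ⟨jetProj h, contMDiff_jetProj h⟩

end Jets

section Forms

variable {V : Type*} [NormedAddCommGroup V] [NormedSpace ℝ V]
  {H : Type*} [TopologicalSpace H] (I : ModelWithCorners ℝ V H)
  (M : Type*) [TopologicalSpace M] [ChartedSpace H M]

/-- Differential `1`-forms on a manifold (smoothness is not part of the definition). -/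
abbrev OneForm : Type _ := ∀ x : M, TangentSpace I x →L[ℝ] ℝ

variable {I M}

/-- The differential of a function, as a `1`-form. -/
def dFun (f : M → ℝ) : OneForm I M := fun x => mfderiv I 𝓘(ℝ, ℝ) f x

/-- The local expression of a `1`-form `ζ` in the preferred chart at `x`: the pull-back of `ζ` by
the inverse of that chart. -/
def formLocalRep (ζ : OneForm I M) (x : M) : V → (V →L[ℝ] ℝ) := fun y =>
  (ζ ((extChartAt I x).symm y)).comp
    (mfderivWithin 𝓘(ℝ, V) I (extChartAt I x).symm (range I) y)

/-- The contraction `ι_u dζ` of the exterior derivative of a `1`-form `ζ` with a tangent vector `u`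
at `x`, that is `v ↦ dζ (u, v)`, computed in the preferred chart at `x`:
if `A` is the derivative of the local expression of `ζ`, then `dζ (u, v) = A u v - A v u`. -/
def contrD (ζ : OneForm I M) (x : M) (u : TangentSpace I x) :
    TangentSpace I x →L[ℝ] ℝ :=
  let D : TangentSpace I x →L[ℝ] V := mfderiv I 𝓘(ℝ, V) (extChartAt I x) x
  let A : V →L[ℝ] V →L[ℝ] ℝ :=
    fderivWithin ℝ (formLocalRep ζ x) (range I) (extChartAt I x x)
  (A (D u)).comp D - (A.flip (D u)).comp D

/-- The pull-back of a `1`-form by a map. -/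
def pullForm {V' : Type*} [NormedAddCommGroup V'] [NormedSpace ℝ V']
    {H' : Type*} [TopologicalSpace H'] {I' : ModelWithCorners ℝ V' H'}
    {M' : Type*} [TopologicalSpace M'] [ChartedSpace H' M']
    (f : M' → M) (ζ : OneForm I M) : OneForm I' M' :=
  fun x => (ζ (f x)).comp (mfderiv I' I f x)

end Forms

section Extended

variable (E : Type*) [NormedAddCommGroup E] [NormedSpace ℝ E]
  (Q : Type*) [TopologicalSpace Q] [ChartedSpace E Q]

/-- The extended higher-order tangent bundle `T^r Q × ℝ`. -/
abbrev Ext (r : ℕ) : Type _ := Jet E Q r × ℝ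

/-- The model with corners (without boundary) of `T^r Q × ℝ`. -/
abbrev IExt (r : ℕ) : ModelWithCorners ℝ ((Fin (r + 1) → E) × ℝ) (ModelProd (Fin (r + 1) → E) ℝ) :=
  (𝓘(ℝ, Fin (r + 1) → E)).prod 𝓘(ℝ, ℝ)

variable {E Q}

/-- The projection `τ^s_r : T^s Q × ℝ → T^r Q × ℝ`. -/
def extProj {r s : ℕ} (h : r ≤ s) : Ext E Q s → Ext E Q r := Prod.map (jetProj h) id

variable [IsManifold 𝓘(ℝ, E) ∞ Q]

theorem prolong_rep_zero {r s : ℕ} (h : r ≤ s) (p : Jet E Q s) :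
    prolong E r p.rep.1 0 = jetProj h p := by
  conv_rhs => rw [← p.mk_rep, jetProj_mk]
  simp only [prolong, add_zero]
  unfold jetOf
  rw [dif_pos p.rep.2]

/-- For `r < s`, the canonical injection `T^s Q → T(T^r Q)`: the jet `p` of a curve `c` is sent to
the velocity at `0` of the lift of `c` to `T^r Q`. That lift passes through `ρ^s_r (p)` at `0`, so
that this is a tangent vector at `ρ^s_r (p)`. -/
def jetVelocity {r s : ℕ} (h : r ≤ s) (p : Jet E Q s) :
    TangentSpace 𝓘(ℝ, Fin (r + 1) → E) (jetProj h p) :=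
  (mfderiv 𝓘(ℝ, ℝ) 𝓘(ℝ, Fin (r + 1) → E) (prolong E r p.rep.1) 0 (1 : ℝ) : Fin (r + 1) → E)

/-- In natural coordinates, `(v_0, …, v_k) ↦ (w_0, …, w_k)` with `w_α = 0` for `α < β` and
`w_α = α! / (α - β)! • v_(α - β)` for `β ≤ α`. -/
def vertShift (k β : ℕ) : (Fin (k + 1) → E) →L[ℝ] (Fin (k + 1) → E) :=
  ContinuousLinearMap.pi fun α =>
    ((α : ℕ).descFactorial β : ℝ) •
      (ContinuousLinearMap.proj ⟨(α : ℕ) - β, lt_of_le_of_lt (Nat.sub_le _ _) α.2⟩ :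
        (Fin (k + 1) → E) →L[ℝ] E)

/-- The `β`-th vertical endomorphism of `T(T^k Q × ℝ)`. A tangent vector at `x` is given by its
components in the preferred chart at `x`, which is a natural chart. -/
def vertEndo {k : ℕ} (β : ℕ) (x : Ext E Q k) :
    TangentSpace (IExt E k) x →L[ℝ] TangentSpace (IExt E k) x :=
  ((vertShift (E := E) k β).prodMap (0 : ℝ →L[ℝ] ℝ) :
    ((Fin (k + 1) → E) × ℝ) →L[ℝ] ((Fin (k + 1) → E) × ℝ))

variable {k : ℕ} (L : Ext E Q k → ℝ)

/-- The derivative `∂L/∂z` at a point of `T^k Q × ℝ`. -/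
def dzLag (x : Ext E Q k) : ℝ := deriv (fun t => L (x.1, t)) x.2

/-- The vector `Tτ (Γ x)` at `τ (x)`, where `τ : T^(r+1) Q × ℝ → T^r Q × ℝ` and `Γ` is any
semispray of type `1` with `dz (Γ) = L`; it only depends on `x`. -/
def totalVec {r : ℕ} (h : k ≤ r) (x : Ext E Q (r + 1)) :
    TangentSpace (IExt E r) (extProj (Nat.le_succ r) x) :=
  ((jetVelocity (Nat.le_succ r) x.1, L (extProj (h.trans (Nat.le_succ r)) x)) :
    (Fin (r + 1) → E) × ℝ)

/-- The Lagrangian total derivative `D_L ξ = Lie_Γ (τ^* ξ) - ∂L/∂z τ^* ξ` of a `1`-form `ξ` on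
`T^r Q × ℝ`, with values in the `1`-forms on `T^(r+1) Q × ℝ`, where `Γ` is any semispray of type
`1` with `dz (Γ) = L`. The Lie derivative is written with Cartan's formula
`Lie_Γ (τ^* ξ) = ι_Γ (τ^* dξ) + d (ι_Γ (τ^* ξ))`. -/
def lagTotalDeriv {r : ℕ} (h : k ≤ r) (ξ : OneForm (IExt E r) (Ext E Q r)) :
    OneForm (IExt E (r + 1)) (Ext E Q (r + 1)) := fun x =>
  (contrD ξ (extProj (Nat.le_succ r) x) (totalVec L h x)).comp
      (mfderiv (IExt E (r + 1)) (IExt E r) (extProj (Nat.le_succ r)) x)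
    + dFun (I := IExt E (r + 1)) (fun y : Ext E Q (r + 1) =>
        ξ (extProj (Nat.le_succ r) y) (totalVec L h y)) x
    - dzLag L (extProj (h.trans (Nat.le_succ r)) x) •
        pullForm (I' := IExt E (r + 1)) (extProj (Nat.le_succ r)) ξ x

/-- The iterates `D_L^m ξ`, for a `1`-form `ξ` on `T^k Q × ℝ`. -/
def lagTotalDerivIter (ξ : OneForm (IExt E k) (Ext E Q k)) :
    ∀ m : ℕ, OneForm (IExt E (k + m)) (Ext E Q (k + m))
  | 0 => ξ
  | m + 1 => lagTotalDeriv L (Nat.le_add_right k m) (lagTotalDerivIter ξ m)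

/-- The `1`-form `i (J_β) dL` on `T^k Q × ℝ`. -/
def vertDiffLag (β : ℕ) : OneForm (IExt E k) (Ext E Q k) := fun x =>
  (dFun (I := IExt E k) L x).comp (vertEndo β x)

/-- The Cartan Lagrangian form
`θ_L = ∑_{β = 1}^k (-1)^(β - 1) (1 / β!) D_L^(β - 1) i (J_β) dL` on `T^(2k-1) Q × ℝ`
(the sum is indexed by `b = β - 1`). -/
def cartanForm : OneForm (IExt E (2 * k - 1)) (Ext E Q (2 * k - 1)) := fun x =>
  ∑ b : Fin k, ((-1 : ℝ) ^ (b : ℕ) / (((b : ℕ) + 1)! : ℝ)) •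
    pullForm (I' := IExt E (2 * k - 1))
      (extProj (by have := b.2; omega : k + (b : ℕ) ≤ 2 * k - 1))
      (lagTotalDerivIter L (vertDiffLag L ((b : ℕ) + 1)) b) x

end Extended

section Unified

variable (E : Type*) [NormedAddCommGroup E] [NormedSpace ℝ E]
  (Q : Type*) [TopologicalSpace Q] [ChartedSpace E Q] [IsManifold 𝓘(ℝ, E) ∞ Q]

/-- The cotangent space of `T^r Q` at `p`. -/
abbrev CotJet (r : ℕ) (p : Jet E Q r) : Type _ :=
  TangentSpace 𝓘(ℝ, Fin (r + 1) → E) p →L[ℝ] Bundle.Trivial (Jet E Q r) ℝ p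

/-- The cotangent bundle `T^*(T^r Q)`. -/
abbrev CotBundle (r : ℕ) : Type _ := TotalSpace ((Fin (r + 1) → E) →L[ℝ] ℝ) (CotJet E Q r)

/-- The model with corners of `T^*(T^r Q) × ℝ`. -/
abbrev ICotExt (r : ℕ) :=
  ((𝓘(ℝ, Fin (r + 1) → E)).prod 𝓘(ℝ, (Fin (r + 1) → E) →L[ℝ] ℝ)).prod 𝓘(ℝ, ℝ)

variable {E Q}

/-- The canonical contact form `η = dz - θ` of `T^*(T^r Q) × ℝ`, where `θ` is the pull-back of the
tautological form of `T^*(T^r Q)`: its value at a covector `ξ` is `ξ ∘ Tπ`. -/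
def canonicalContactForm (r : ℕ) : OneForm (ICotExt E r) (CotBundle E Q r × ℝ) := fun y =>
  dFun (I := ICotExt E r) (fun y : CotBundle E Q r × ℝ => y.2) y
    - ContinuousLinearMap.comp (y.1.2 : TangentSpace 𝓘(ℝ, Fin (r + 1) → E) y.1.1 →L[ℝ] ℝ)
        (mfderiv (ICotExt E r) 𝓘(ℝ, Fin (r + 1) → E)
          (fun y : CotBundle E Q r × ℝ => y.1.1) y)

variable (E Q) in
/-- The fibres `T^*_(ρ p) (T^(k-1) Q)`, `p ∈ T^(2k-1) Q`, of the pull-back bundle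
`T^(2k-1) Q ×_(T^(k-1) Q) T^*(T^(k-1) Q)`. -/
abbrev UnifiedFib (k : ℕ) : Jet E Q (2 * k - 1) → Type _ :=
  (jetProjMap (E := E) (Q := Q) (by omega : k - 1 ≤ 2 * k - 1)) *ᵖ (CotJet E Q (k - 1))

variable (E Q) in
/-- The higher-order extended unified bundle
`W = T^(2k-1) Q ×_(T^(k-1) Q) T^*(T^(k-1) Q) × ℝ`. -/
abbrev Unified (k : ℕ) : Type _ :=
  TotalSpace ((Fin (k - 1 + 1) → E) →L[ℝ] ℝ) (UnifiedFib E Q k) × ℝ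

variable (E) in
/-- The model with corners (without boundary) of `W`. -/
abbrev IUnified (k : ℕ) :=
  ((𝓘(ℝ, Fin (2 * k - 1 + 1) → E)).prod 𝓘(ℝ, (Fin (k - 1 + 1) → E) →L[ℝ] ℝ)).prod 𝓘(ℝ, ℝ)

variable {k : ℕ}

/-- The projection `ϱ_1 : W → T^(2k-1) Q × ℝ`. -/
def rhoOne (w : Unified E Q k) : Ext E Q (2 * k - 1) := (w.1.1, w.2)

/-- The projection of `W` onto `T^(k-1) Q`. -/
def projBase (w : Unified E Q k) : Jet E Q (k - 1) :=
  jetProj (by omega : k - 1 ≤ 2 * k - 1) w.1.1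

/-- The covector component of a point of `W`. -/
def momentum (w : Unified E Q k) :
    TangentSpace 𝓘(ℝ, Fin (k - 1 + 1) → E) (projBase w) →L[ℝ] ℝ := w.1.2

/-- The projection `ϱ_2 : W → T^*(T^(k-1) Q) × ℝ`. -/
def rhoTwo (w : Unified E Q k) : CotBundle E Q (k - 1) × ℝ :=
  (⟨projBase w, momentum w⟩, w.2)

/-- The coupling function `C (p, ξ, z) = ⟨ξ, j_k (p)⟩`. -/
def coupling (w : Unified E Q k) : ℝ :=
  momentum w (jetVelocity (by omega : k - 1 ≤ 2 * k - 1) w.1.1)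

/-- The canonical precontact form `η_W = ϱ_2^* η_(k-1)`. -/
def precontactForm : OneForm (IUnified E k) (Unified E Q k) :=
  pullForm (I := ICotExt E (k - 1)) rhoTwo (canonicalContactForm (k - 1))

/-- The vector `∂/∂z` at a point of `W`: the velocity of `t ↦ (p, ξ, t)` at `t = z`. It is the
representative of the Reeb vector fields of `η_W` that is used in the dynamical equations. -/
def reebVec (w : Unified E Q k) : TangentSpace (IUnified E k) w :=
  mfderiv 𝓘(ℝ, ℝ) (IUnified E k) (fun t : ℝ => ((w.1, t) : Unified E Q k)) w.2 (1 : ℝ)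

variable (L : Ext E Q k → ℝ)

/-- The Hamiltonian function `H = C - ϱ_1^* L` on `W`. -/
def hamiltonian (w : Unified E Q k) : ℝ :=
  coupling w - L (extProj (by omega : k ≤ 2 * k - 1) (rhoOne w))

/-- The unified contact dynamical equations at `w`, for a tangent vector `X` at `w`:
`ι_X dη_W = dH - R(H) η_W` and `ι_X η_W = - H`, with `R = ∂/∂z`. -/
def SolvesAt (w : Unified E Q k) (X : TangentSpace (IUnified E k) w) : Prop :=
  contrD precontactForm w X =
      dFun (I := IUnified E k) (hamiltonian L) w
        - (dFun (I := IUnified E k) (hamiltonian L) w (reebVec w)) • precontactForm w ∧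
    precontactForm w X = - hamiltonian L w

/-- The covector component of the Legendre map at `x = (p, z)`: the covector `ξ` at `ρ (p)`, where
`ρ : T^(2k-1) Q → T^(k-1) Q`, such that `θ_L (u) = ⟨ξ, T(ρ ∘ pr) u⟩` for all tangent vectors `u` at
`x`, with `pr : T^(2k-1) Q × ℝ → T^(2k-1) Q`. -/
def legendreCovector (x : Ext E Q (2 * k - 1)) :
    TangentSpace 𝓘(ℝ, Fin (k - 1 + 1) → E)
      (jetProj (by omega : k - 1 ≤ 2 * k - 1) x.1) →L[ℝ] ℝ :=
  Classical.epsilon fun ξ => ∀ u : TangentSpace (IExt E (2 * k - 1)) x,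
    cartanForm L x u = ξ (mfderiv (IExt E (2 * k - 1)) 𝓘(ℝ, Fin (k - 1 + 1) → E)
      (fun y : Ext E Q (2 * k - 1) => jetProj (by omega : k - 1 ≤ 2 * k - 1) y.1) x u)

/-- The generalized Legendre map `Leg : T^(2k-1) Q × ℝ → T^*(T^(k-1) Q) × ℝ`. -/
def legendre (x : Ext E Q (2 * k - 1)) : CotBundle E Q (k - 1) × ℝ :=
  (⟨jetProj (by omega : k - 1 ≤ 2 * k - 1) x.1, legendreCovector L x⟩, x.2)

/-- The map `T^(2k-1) Q × ℝ → W` whose components are the identity and the Legendre map. -/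
def graphMap (x : Ext E Q (2 * k - 1)) : Unified E Q k := (⟨x.1, legendreCovector L x⟩, x.2)

theorem rhoOne_graphMap (x : Ext E Q (2 * k - 1)) : rhoOne (graphMap L x) = x := rfl

theorem rhoTwo_graphMap (x : Ext E Q (2 * k - 1)) : rhoTwo (graphMap L x) = legendre L x := rfl

/-- The submanifold `W_1 = graph (Leg)` of `W`. -/
def graphLegendre : Set (Unified E Q k) := {w | rhoTwo w = legendre L (rhoOne w)}

theorem graphMap_mem (x : Ext E Q (2 * k - 1)) : graphMap L x ∈ graphLegendre L := rfl

/-- The (not necessarily smooth) vector fields on `W` defined along `W_1`. -/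
abbrev FieldAlong : Type _ :=
  ∀ w : graphLegendre L, TangentSpace (IUnified E k) (w : Unified E Q k)

variable {L}

/-- Smoothness of a vector field along `W_1`, where `W_1` is parametrized by `graphMap`. -/
def IsSmoothAlong (X : FieldAlong L) : Prop :=
  ContMDiff (IExt E (2 * k - 1)) (IUnified E k).tangent ∞
    fun x : Ext E Q (2 * k - 1) =>
      (⟨graphMap L x, X ⟨graphMap L x, graphMap_mem L x⟩⟩ :
        TangentBundle (IUnified E k) (Unified E Q k))

/-- `X` is tangent to `W_1`. -/
def IsTangentAlong (X : FieldAlong L) : Prop :=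
  ∀ x : Ext E Q (2 * k - 1), ∃ u : TangentSpace (IExt E (2 * k - 1)) x,
    X ⟨graphMap L x, graphMap_mem L x⟩ =
      mfderiv (IExt E (2 * k - 1)) (IUnified E k) (graphMap L) x u

/-- `σ : J → W` is an integral curve of `X`, where `J` is an open set of times
(the values of `σ` outside `J` are irrelevant). -/
def IsIntegralCurveAlong (X : FieldAlong L) (σ : ℝ → Unified E Q k) (J : Set ℝ) : Prop :=
  ContMDiffOn 𝓘(ℝ, ℝ) (IUnified E k) ∞ σ J ∧
    ∀ t ∈ J, ∃ h : σ t ∈ graphLegendre L,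
      mfderiv 𝓘(ℝ, ℝ) (IUnified E k) σ t (1 : ℝ) = X ⟨σ t, h⟩

/-- A curve in `W` is holonomic if its projection to `T^(2k-1) Q` is the canonical lift of its
projection to `Q`. -/
def IsHolonomicCurve (σ : ℝ → Unified E Q k) (J : Set ℝ) : Prop :=
  ContMDiffOn 𝓘(ℝ, ℝ) 𝓘(ℝ, E) ∞ (fun t => (rhoOne (σ t)).1.base) J ∧
    ∀ t ∈ J, (rhoOne (σ t)).1 = prolong E (2 * k - 1) (fun s => (rhoOne (σ s)).1.base) t

/-- `X` is a semispray of type `1` (a holonomic vector field): its integral curves are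
holonomic. -/
def IsHolonomicAlong (X : FieldAlong L) : Prop :=
  ∀ (σ : ℝ → Unified E Q k) (J : Set ℝ), IsOpen J → IsIntegralCurveAlong X σ J →
    IsHolonomicCurve σ J

end Unified

section Regular

variable {n : ℕ} {Q : Type*} [TopologicalSpace Q] [ChartedSpace (EuclideanSpace ℝ (Fin n)) Q]

/-- The Hessian matrix `(∂²L / ∂q_k^i ∂q_k^j)` at a point `x` of `T^k Q × ℝ`, in the natural
coordinates induced by a chart `e` of `Q`. -/
def hessian {k : ℕ} (L : Ext (EuclideanSpace ℝ (Fin n)) Q k → ℝ)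
    (e : OpenPartialHomeomorph Q (EuclideanSpace ℝ (Fin n)))
    (x : Ext (EuclideanSpace ℝ (Fin n)) Q k) : Matrix (Fin n) (Fin n) ℝ :=
  let v : Fin n → (Fin (k + 1) → EuclideanSpace ℝ (Fin n)) × ℝ := fun i =>
    (Pi.single (Fin.last k) (EuclideanSpace.single i 1), 0)
  let f : (Fin (k + 1) → EuclideanSpace ℝ (Fin n)) × ℝ → ℝ := fun y =>
    L (jetOfCoord e y.1, y.2)
  Matrix.of fun i j =>
    fderiv ℝ (fun y => fderiv ℝ f y (v i)) (jetCoord e x.1, x.2) (v j)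

/-- `L` is regular: its Hessian matrix with respect to the coordinates `q_k` is everywhere
nonsingular, in all natural charts. -/
def IsRegularLagrangian {k : ℕ} (L : Ext (EuclideanSpace ℝ (Fin n)) Q k → ℝ) : Prop :=
  ∀ e ∈ atlas (EuclideanSpace ℝ (Fin n)) Q, ∀ x : Ext (EuclideanSpace ℝ (Fin n)) Q k,
    x.1.base ∈ e.source → (hessian L e x).det ≠ 0

end Regular

end

end HOContact

/-! In natural coordinates `(q_0, …, q_(2k-1), p, z)` of `W`, the contact form is `dz - ∑ p^a dq_a`
and `H = ∑ p^a q_(a+1) - L`, with `a < k`. Comparing coefficients (`contactEquations_iff`), the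
equations become `q̇_a = q_(a+1)` and `ṗ^a = ∂L/∂q_a + ∂L/∂z p^a - p^(a-1)` for `a < k`, `ż = L`,
and the constraint `p^(k-1) = ∂L/∂q_k`. They say nothing about `q̇_k, …, q̇_(2k-1)`: tangency to the
graph of the Legendre map has to determine these.

For this the Cartan form is needed explicitly. A form `∑ g_a dq_a` is encoded by the sequence `g`;
then `D_L` acts as "differentiate termwise, plus right shift", and `J_b` as a left shift with
factorial weights. A purely algebraic identity on sequences (`sum_seqTotal_pow_seqVert_succ`, an
induction on the support through Pascal's rule) shows that the alternating sum defining `θ_L` is `∑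
p^a dq_a` with the Jacobi–Ostrogradsky momenta, which satisfy `p^a = ∂L/∂q_(a+1) - D_L p^(a+1)` and
`p^(k-1) = ∂L/∂q_k`. In particular the constraint holds on `W_1`.

Write a tangent vector of `T^(2k-1) Q × ℝ` as the total derivative, truncated by `q_(2k) = 0`, plus
a correction `w`. By the recursion, its image in `W_1` solves the equations if and only if `w_j = 0`
for `j < k`, `w` has no `z`-component, `∂_w p^a = 0` for `0 < a < k`, and `∂_w p^0` is the truncated
Euler–Lagrange expression. Since `p^(k-1-i)` depends on no `q_j` with `j > k + i`, and its
derivative in `q_(k+i)` is `(-1)^i` times the Hessian (`fderiv_momenta`), this system is triangular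
with invertible diagonal. It forces `w_j = 0` for `j < 2k - 1` and fixes `w_(2k-1)`
(`modelSolution_iff`). So the solution exists, is unique, depends smoothly on the point, and
satisfies `q̇_j = q_(j+1)` for all `j < 2k - 1`, which is holonomy.

The rest of the proof transfers the intrinsic definitions to coordinates. The main points are that
exterior derivatives commute with pull-backs (`contrD_eq_of_pull`) and that vertical endomorphisms
have the same expression in every natural chart (`vderiv_vertEndo`). -/

namespace HOContact

noncomputable section

/-! ### Algebra of total derivatives and vertical shifts on coefficient sequences -/

section Sequences

variable {M : Type*} [AddCommGroup M] [Module ℝ M]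

/-- The right shift of a sequence. -/
def seqShift : (ℕ → M) →ₗ[ℝ] (ℕ → M) where
  toFun g a := Nat.casesOn a 0 g
  map_add' g h := by funext a; cases a <;> simp
  map_smul' c g := by funext a; cases a <;> simp

/-- The left shift of a sequence. -/
def seqTail : (ℕ → M) →ₗ[ℝ] (ℕ → M) where
  toFun g a := g (a + 1)
  map_add' _ _ := rfl
  map_smul' _ _ := rfl

/-- The sum of the termwise application of an operator and of the right shift. -/
def seqTotal (D : M →ₗ[ℝ] M) : (ℕ → M) →ₗ[ℝ] (ℕ → M) :=
  LinearMap.pi (fun a => D ∘ₗ LinearMap.proj a) + seqShift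

/-- The sequence of the `(a + b choose b) ℓ (a + b)`. -/
def seqVert (b : ℕ) : (ℕ → M) →ₗ[ℝ] (ℕ → M) where
  toFun g a := ((a + b).choose b : ℝ) • g (a + b)
  map_add' _ _ := by funext a; simp
  map_smul' c g := by funext a; simp [smul_comm c]

@[simp] theorem seqShift_zero (g : ℕ → M) : seqShift g 0 = 0 := rfl
@[simp] theorem seqShift_succ (g : ℕ → M) (a : ℕ) : seqShift g (a + 1) = g a := rfl
@[simp] theorem seqTail_apply (g : ℕ → M) (a : ℕ) : seqTail g a = g (a + 1) := rfl
theorem seqTotal_apply (D : M →ₗ[ℝ] M) (g : ℕ → M) (a : ℕ) :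
    seqTotal D g a = D (g a) + seqShift g a := rfl
theorem seqVert_apply (b : ℕ) (g : ℕ → M) (a : ℕ) :
    seqVert b g a = ((a + b).choose b : ℝ) • g (a + b) := rfl

theorem seqTotal_seqShift (D : M →ₗ[ℝ] M) (g : ℕ → M) :
    seqTotal D (seqShift g) = seqShift (seqTotal D g) := by
  funext a
  rcases a with _ | a
  · simp [seqTotal_apply]
  · rcases a with _ | a <;> simp [seqTotal_apply]

theorem seqTotal_pow_seqShift (D : M →ₗ[ℝ] M) (m : ℕ) (g : ℕ → M) :
    (seqTotal D ^ m) (seqShift g) = seqShift ((seqTotal D ^ m) g) := by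
  induction m with
  | zero => simp
  | succ m ih => rw [pow_succ', Module.End.mul_apply, ih, seqTotal_seqShift, Module.End.mul_apply]

theorem seqVert_zero (g : ℕ → M) : seqVert 0 g = g := by
  funext a; simp [seqVert_apply]

/-- Pascal's rule. It expresses the operators on `g` through those on `seqTail g`, whose support is
shorter, and so drives the induction below. -/
theorem seqVert_succ (b : ℕ) (g : ℕ → M) :
    seqVert (b + 1) g = seqShift (seqVert (b + 1) (seqTail g)) + seqVert b (seqTail g) := by
  funext a
  rcases a with _ | a
  · simp [seqVert_apply]
  · have h1 : a + 1 + (b + 1) = a + (b + 1) + 1 := by ring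
    have h2 : a + 1 + b = a + (b + 1) := by ring
    have h3 : (a + 1 + (b + 1)).choose (b + 1) =
        (a + (b + 1)).choose (b + 1) + (a + 1 + b).choose b := by
      rw [h1, Nat.choose_succ_succ, h2, add_comm]
    simp only [Pi.add_apply, seqShift_succ, seqVert_apply, seqTail_apply, h3, Nat.cast_add,
      add_smul]
    simp only [h1, h2]

theorem seqVert_eq_zero {K b : ℕ} {g : ℕ → M} (hg : ∀ a, K ≤ a → g a = 0) {a : ℕ}
    (hb : K ≤ a + b) : seqVert b g a = 0 := by
  simp [seqVert_apply, hg _ hb]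

theorem seqTotal_pow_eq_zero (D : M →ₗ[ℝ] M) {K : ℕ} {g : ℕ → M} (hg : ∀ a, K ≤ a → g a = 0)
    (m : ℕ) : ∀ a, K + m ≤ a → (seqTotal D ^ m) g a = 0 := by
  induction m with
  | zero => simpa using hg
  | succ m ih =>
    intro a ha
    obtain ⟨a, rfl⟩ : ∃ c, a = c + 1 := ⟨a - 1, by omega⟩
    rw [pow_succ', Module.End.mul_apply, seqTotal_apply, seqShift_succ, ih _ (by omega),
      ih _ (by omega)]
    simp

/-- Algebraic core of the Jacobi–Ostrogradsky recursion: in positive degree the alternating sum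
telescopes, leaving only `-D` of the analogous sum for `seqTail g`, again in positive degree.
Induction on the support bound `K` applies because the total derivative commutes with the right
shift. -/
theorem sum_seqTotal_pow_seqVert_succ (D : M →ₗ[ℝ] M) (K : ℕ) : ∀ {g : ℕ → M} {N : ℕ},
    (∀ a, K ≤ a → g a = 0) → K ≤ N → ∀ a,
      (∑ b ∈ Finset.range N, (-1 : ℝ) ^ b • (seqTotal D ^ b) (seqVert b g)) (a + 1) = 0 := by
  induction K with
  | zero =>
    intro g N hg _ a
    have : g = 0 := funext fun a => hg a (Nat.zero_le a)
    simp [this]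
  | succ K ih =>
    intro g N hg hN a
    obtain ⟨N, rfl⟩ : ∃ c, N = c + 1 := ⟨N - 1, by omega⟩
    have hg' : ∀ a, K ≤ a → seqTail g a = 0 := fun a ha => hg _ (by omega)
    set q : ℕ → M := ∑ b ∈ Finset.range N, (-1 : ℝ) ^ b • (seqTotal D ^ b) (seqVert b (seqTail g))
      with hq
    -- The tail is supported below `K ≤ N`, so its sums with `N` and with `N + 1` terms agree. This
    -- is what lets the two halves of Pascal's rule, whose indices differ by one, recombine into the
    -- same `q`.
    have h0 : seqVert N (seqTail g) = 0 := funext fun a => seqVert_eq_zero hg' (by omega)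
    have hq' : q = ∑ b ∈ Finset.range (N + 1),
        (-1 : ℝ) ^ b • (seqTotal D ^ b) (seqVert b (seqTail g)) := by
      rw [Finset.sum_range_succ, h0]; simp [hq]
    have h1 : ∑ b ∈ Finset.range N, (-1 : ℝ) ^ (b + 1) •
        (seqTotal D ^ (b + 1)) (seqVert (b + 1) (seqTail g)) = q - seqTail g := by
      rw [hq', Finset.sum_range_succ']
      simp [seqVert_zero]
    have key : ∑ b ∈ Finset.range (N + 1), (-1 : ℝ) ^ b • (seqTotal D ^ b) (seqVert b g) =
        g + seqShift (q - seqTail g) - seqTotal D q := by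
      rw [Finset.sum_range_succ', ← h1, hq, map_sum, map_sum]
      simp only [seqVert_succ _ g, map_add, smul_add, Finset.sum_add_distrib, pow_zero, one_smul,
        seqVert_zero, seqTotal_pow_seqShift, map_smul]
      have h2 : ∀ b (f : ℕ → M), (-1 : ℝ) ^ (b + 1) • (seqTotal D ^ (b + 1)) f =
          - ((-1 : ℝ) ^ b • seqTotal D ((seqTotal D ^ b) f)) := by
        intro b f
        rw [pow_succ', pow_succ', Module.End.mul_apply, neg_one_mul, neg_smul]
      simp only [h2 _ (seqVert _ (seqTail g)), Finset.sum_neg_distrib, Module.End.one_apply]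
      abel
    -- At index `a + 1` the terms `g (a + 1)` and `q a` cancel in pairs, leaving `-D (q (a + 1))`,
    -- which is zero by induction.
    rw [key]
    have hqa := ih (g := seqTail g) (N := N) hg' (by omega) a
    simp only [Pi.sub_apply, Pi.add_apply, seqShift_succ, seqTotal_apply, seqTail_apply]
    rw [← hq] at hqa
    rw [hqa]
    simp

/-- The sequence of momenta `∑_{b < k} (-1)^b T^b J_(b+1) ℓ`, where `T` is the total derivative. -/
def seqMomenta (D : M →ₗ[ℝ] M) (k : ℕ) (g : ℕ → M) : ℕ → M :=
  ∑ b ∈ Finset.range k, (-1 : ℝ) ^ b • (seqTotal D ^ b) (seqVert (b + 1) g)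

/-- Splitting off the term `b = 0` writes the alternating sum as `g - T p`, where `T` is `seqTotal
D` and `p` the sequence of momenta. Its vanishing in positive degree is the recursion. -/
theorem seqMomenta_recurrence (D : M →ₗ[ℝ] M) {k : ℕ} {g : ℕ → M} (hg : ∀ a, k < a → g a = 0)
    (a : ℕ) : D (seqMomenta D k g (a + 1)) + seqMomenta D k g a = g (a + 1) := by
  have h := sum_seqTotal_pow_seqVert_succ D (k + 1) (g := g) (N := k + 1)
    (fun a ha => hg a ha) le_rfl a
  have h1 : ∑ b ∈ Finset.range (k + 1), (-1 : ℝ) ^ b • (seqTotal D ^ b) (seqVert b g) =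
      g - seqTotal D (seqMomenta D k g) := by
    rw [Finset.sum_range_succ', seqMomenta, map_sum]
    simp only [pow_succ', neg_one_mul, neg_smul, map_smul, Module.End.mul_apply,
      Finset.sum_neg_distrib, pow_zero, one_smul, seqVert_zero, Module.End.one_apply]
    abel
  rw [h1] at h
  simp only [Pi.sub_apply, seqTotal_apply, seqShift_succ] at h
  exact (sub_eq_zero.1 h).symm

/-- Count of supports: `seqVert b` lowers the top index by `b`, and each total derivative raises it
by one. -/
theorem seqTotal_pow_seqVert_eq_zero (D : M →ₗ[ℝ] M) {k : ℕ} {g : ℕ → M}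
    (hg : ∀ a, k < a → g a = 0) {b m : ℕ} {a : ℕ} (hb : b ≤ k) (ha : k + m < a + b) :
    (seqTotal D ^ m) (seqVert b g) a = 0 :=
  seqTotal_pow_eq_zero D (K := k + 1 - b)
    (fun a ha => seqVert_eq_zero (K := k + 1) (fun a ha => hg a ha) (by omega)) m a (by omega)

theorem seqMomenta_eq_zero (D : M →ₗ[ℝ] M) {k : ℕ} {g : ℕ → M} (hg : ∀ a, k < a → g a = 0)
    {a : ℕ} (ha : k ≤ a) : seqMomenta D k g a = 0 := by
  rw [seqMomenta, Finset.sum_apply]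
  refine Finset.sum_eq_zero fun b hb => ?_
  rw [Pi.smul_apply, seqTotal_pow_seqVert_eq_zero D hg (Finset.mem_range.1 hb) (by omega), smul_zero]

end Sequences

/-! ### Calculus on the coordinate space: total derivative, momenta, leading derivatives -/

section Model

variable (E : Type*) [NormedAddCommGroup E] [NormedSpace ℝ E]

/-- The model space of `T^s Q × ℝ`. -/
abbrev JetModel (s : ℕ) : Type _ := (Fin (s + 1) → E) × ℝ

/-- The coordinate `q_j` of the model space, zero if `j > s`. -/
def modelCoord (s j : ℕ) : JetModel E s →L[ℝ] E :=
  if h : j < s + 1 then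
    (ContinuousLinearMap.proj ⟨j, h⟩ : (Fin (s + 1) → E) →L[ℝ] E).comp
      (ContinuousLinearMap.fst ℝ (Fin (s + 1) → E) ℝ)
  else 0

/-- The inclusion of the `q_j`-axis in the model space, zero if `j > s`. -/
def modelInj (s j : ℕ) : E →L[ℝ] JetModel E s :=
  if h : j < s + 1 then
    (ContinuousLinearMap.inl ℝ (Fin (s + 1) → E) ℝ).comp
      (ContinuousLinearMap.single ℝ (fun _ : Fin (s + 1) => E) ⟨j, h⟩)
  else 0

/-- The local expression of the projection `T^s Q × ℝ → T^r Q × ℝ`. -/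
def modelProj {r s : ℕ} (h : r ≤ s) : JetModel E s →L[ℝ] JetModel E r :=
  (ContinuousLinearMap.pi fun i : Fin (r + 1) =>
    (ContinuousLinearMap.proj (Fin.castLE (Nat.succ_le_succ h) i) :
      (Fin (s + 1) → E) →L[ℝ] E)).prodMap (ContinuousLinearMap.id ℝ ℝ)

/-- The truncated shift `(q_0, …, q_s, z) ↦ (q_1, …, q_s, 0)`. -/
def modelShift (s : ℕ) : JetModel E s →L[ℝ] (Fin (s + 1) → E) :=
  ContinuousLinearMap.pi fun j => modelCoord E s ((j : ℕ) + 1)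

variable {E}

theorem modelCoord_of_lt {s j : ℕ} (h : j < s + 1) (y : JetModel E s) :
    modelCoord E s j y = y.1 ⟨j, h⟩ := by
  simp [modelCoord, h]

theorem modelCoord_of_le {s j : ℕ} (h : s < j) (y : JetModel E s) :
    modelCoord E s j y = 0 := by
  have : ¬ j < s + 1 := by omega
  simp [modelCoord, this]

theorem modelCoord_fin {s : ℕ} (i : Fin (s + 1)) (y : JetModel E s) :
    modelCoord E s i y = y.1 i := modelCoord_of_lt i.2 y

theorem modelInj_of_lt {s j : ℕ} (h : j < s + 1) (v : E) :
    modelInj E s j v = (Pi.single ⟨j, h⟩ v, 0) := by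
  simp [modelInj, h]

theorem modelInj_of_le {s j : ℕ} (h : s < j) : modelInj E s j = 0 := by
  have : ¬ j < s + 1 := by omega
  simp [modelInj, this]

theorem modelInj_snd (s j : ℕ) (v : E) : (modelInj E s j v).2 = 0 := by
  rcases lt_or_ge j (s + 1) with h | h
  · simp [modelInj_of_lt h]
  · simp [modelInj_of_le h]

theorem modelCoord_modelInj {s i j : ℕ} (h : j < s + 1) (v : E) :
    modelCoord E s i (modelInj E s j v) = if i = j then v else 0 := by
  rcases lt_or_ge i (s + 1) with hi | hi
  · rw [modelCoord_of_lt hi, modelInj_of_lt h]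
    by_cases hij : i = j
    · subst hij; simp
    · simp [hij]
  · rw [modelCoord_of_le hi, if_neg (by omega)]

theorem modelProj_fst {r s : ℕ} (h : r ≤ s) (y : JetModel E s) (i : Fin (r + 1)) :
    (modelProj E h y).1 i = y.1 (Fin.castLE (Nat.succ_le_succ h) i) := rfl

@[simp] theorem modelProj_snd {r s : ℕ} (h : r ≤ s) (y : JetModel E s) :
    (modelProj E h y).2 = y.2 := rfl

theorem modelCoord_modelProj {r s j : ℕ} (h : r ≤ s) (hj : j ≤ r) (y : JetModel E s) :
    modelCoord E r j (modelProj E h y) = modelCoord E s j y := by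
  rw [modelCoord_of_lt (by omega), modelCoord_of_lt (by omega), modelProj_fst]
  rfl

theorem model_ext {s : ℕ} {y y' : JetModel E s}
    (h : ∀ j ≤ s, modelCoord E s j y = modelCoord E s j y') (h2 : y.2 = y'.2) : y = y' := by
  refine Prod.ext (funext fun j => ?_) h2
  rw [← modelCoord_fin, ← modelCoord_fin, h j (Nat.lt_succ_iff.1 j.2)]

/-- The set of the points of the model space with `q_0` in a given set. -/
def modelDom (O : Set E) (s : ℕ) : Set (JetModel E s) := {y | y.1 0 ∈ O}

theorem isOpen_modelDom {O : Set E} (hO : IsOpen O) (s : ℕ) : IsOpen (modelDom O s) :=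
  hO.preimage ((continuous_apply 0).comp continuous_fst)

theorem modelProj_mem {O : Set E} {r s : ℕ} (h : r ≤ s) {y : JetModel E s}
    (hy : y ∈ modelDom O s) : modelProj E h y ∈ modelDom O r := hy

variable {k : ℕ}

/-- The local expression `q_(α+1) ∂/∂q_α + L ∂/∂z` of a total derivative, with `q_(s+1) = 0`. -/
def modelField (l : JetModel E k → ℝ) {s : ℕ} (h : k ≤ s) (y : JetModel E s) : JetModel E s :=
  (modelShift E s y, l (modelProj E h y))

theorem modelCoord_modelField (l : JetModel E k → ℝ) {s : ℕ} (h : k ≤ s) (y : JetModel E s)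
    (j : ℕ) : modelCoord E s j (modelField l h y) = modelCoord E s (j + 1) y := by
  rcases lt_or_ge j (s + 1) with hj | hj
  · rw [modelCoord_of_lt hj]; rfl
  · rw [modelCoord_of_le hj, modelCoord_of_le (by omega)]

/-- The truncation `q_(s+1) = 0` is invisible after projecting to a lower order `r < s`, where only
the coordinates up to `q_(r+1)` enter. All orders can therefore be treated on one space of order
`s`. -/
theorem modelProj_modelField (l : JetModel E k → ℝ) {r s : ℕ} (h : k ≤ r) (h' : r < s)
    (y : JetModel E s) : modelProj E h'.le (modelField l (h.trans h'.le) y) =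
      modelProj E (Nat.le_succ r) (modelField l (h.trans (Nat.le_succ r))
        (modelProj E (Nat.succ_le_of_lt h') y)) := by
  refine model_ext (fun j hj => ?_) rfl
  rw [modelCoord_modelProj _ hj, modelCoord_modelField, modelCoord_modelProj _ hj,
    modelCoord_modelField, modelCoord_modelProj _ (by omega)]

/-- The derivative in `z`. -/
def modelDz (l : JetModel E k → ℝ) (y : JetModel E k) : ℝ := fderiv ℝ l y (0, 1)

section Smooth

variable {l : JetModel E k → ℝ} {O : Set E}

theorem contDiffOn_modelField (hl : ContDiffOn ℝ ∞ l (modelDom O k)) {s : ℕ} (h : k ≤ s) :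
    ContDiffOn ℝ ∞ (modelField l h) (modelDom O s) :=
  (modelShift E s).contDiff.contDiffOn.prodMk
    (hl.comp (modelProj E h).contDiff.contDiffOn fun _ hy => hy)

theorem fderiv_modelField (hO : IsOpen O) (hl : ContDiffOn ℝ ∞ l (modelDom O k)) {s : ℕ}
    (h : k ≤ s) {y : JetModel E s} (hy : y ∈ modelDom O s) (w : JetModel E s) :
    fderiv ℝ (modelField l h) y w =
      (modelShift E s w, fderiv ℝ l (modelProj E h y) (modelProj E h w)) := by
  have h1 : HasFDerivAt l (fderiv ℝ l (modelProj E h y)) (modelProj E h y) :=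
    ((hl.contDiffAt ((isOpen_modelDom hO k).mem_nhds (modelProj_mem h hy))).differentiableAt
      (by simp)).hasFDerivAt
  have h2 := (modelShift E s).hasFDerivAt (x := y) |>.prodMk
    (h1.comp y (modelProj E h).hasFDerivAt)
  have h3 : HasFDerivAt (modelField l h) _ y := h2
  rw [h3.fderiv]; rfl

theorem contDiffOn_fderiv (hO : IsOpen O) {s : ℕ} {F : Type*} [NormedAddCommGroup F]
    [NormedSpace ℝ F] {f : JetModel E s → F} (hf : ContDiffOn ℝ ∞ f (modelDom O s)) :
    ContDiffOn ℝ ∞ (fderiv ℝ f) (modelDom O s) :=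
  hf.fderiv_of_isOpen (isOpen_modelDom hO s) (by simp)

theorem contDiffOn_modelDz (hO : IsOpen O) (hl : ContDiffOn ℝ ∞ l (modelDom O k)) :
    ContDiffOn ℝ ∞ (modelDz l) (modelDom O k) :=
  (contDiffOn_fderiv hO hl).clm_apply contDiffOn_const

variable {F : Type*} [NormedAddCommGroup F] [NormedSpace ℝ F]

variable (O F) in
/-- The functions with values in `F` that are smooth on `modelDom O s` and vanish
elsewhere. -/
def CoeffModule (s : ℕ) : Submodule ℝ (JetModel E s → F) where
  carrier := {f | ContDiffOn ℝ ∞ f (modelDom O s) ∧ ∀ y ∉ modelDom O s, f y = 0}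
  add_mem' := fun hf hg => ⟨hf.1.add hg.1, fun y hy => by simp [hf.2 y hy, hg.2 y hy]⟩
  zero_mem' := ⟨contDiffOn_const, fun _ _ => rfl⟩
  smul_mem' := fun c f hf => ⟨contDiffOn_const.smul hf.1, fun y hy => by simp [hf.2 y hy]⟩

/-- The restriction of a smooth function to `modelDom O s`, extended by zero. -/
def coeffOf {s : ℕ} (f : JetModel E s → F) (hf : ContDiffOn ℝ ∞ f (modelDom O s)) :
    CoeffModule O F s :=
  ⟨indicator (modelDom O s) f, hf.congr fun _ hy => indicator_of_mem hy f,
    fun _ hy => indicator_of_notMem hy f⟩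

theorem coeffOf_apply {s : ℕ} {f : JetModel E s → F}
    (hf : ContDiffOn ℝ ∞ f (modelDom O s)) {y : JetModel E s} (hy : y ∈ modelDom O s) :
    (coeffOf f hf).1 y = f y := indicator_of_mem hy f

/-- Purpose of the extension by zero: elements are determined by their values on the chart domain,
so the total derivative is a genuine linear endomorphism to which the algebra of sequences applies.
-/
theorem coeff_ext {s : ℕ} {f g : CoeffModule O F s} (h : ∀ y ∈ modelDom O s, f.1 y = g.1 y) :
    f = g := by
  refine Subtype.ext (funext fun y => ?_)
  by_cases hy : y ∈ modelDom O s
  · exact h y hy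
  · rw [f.2.2 y hy, g.2.2 y hy]

theorem coeff_differentiableAt (hO : IsOpen O) {s : ℕ} (f : CoeffModule O F s) {y : JetModel E s}
    (hy : y ∈ modelDom O s) : DifferentiableAt ℝ f.1 y :=
  (f.2.1.contDiffAt ((isOpen_modelDom hO s).mem_nhds hy)).differentiableAt (by simp)

theorem contDiffOn_totalD (hO : IsOpen O) (hl : ContDiffOn ℝ ∞ l (modelDom O k)) {s : ℕ}
    (h : k ≤ s) (f : CoeffModule O F s) :
    ContDiffOn ℝ ∞ (fun y => fderiv ℝ f.1 y (modelField l h y) -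
      modelDz l (modelProj E h y) • f.1 y) (modelDom O s) :=
  ((contDiffOn_fderiv hO f.2.1).clm_apply (contDiffOn_modelField hl h)).sub
    (((contDiffOn_modelDz hO hl).comp (modelProj E h).contDiff.contDiffOn fun _ hy => hy).smul
      f.2.1)

/-- The total derivative `F ↦ D F - ∂L/∂z F`. -/
def totalD (hO : IsOpen O) (hl : ContDiffOn ℝ ∞ l (modelDom O k)) {s : ℕ} (h : k ≤ s) :
    CoeffModule O F s →ₗ[ℝ] CoeffModule O F s where
  toFun f := coeffOf _ (contDiffOn_totalD hO hl h f)
  map_add' f g := coeff_ext fun y hy => by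
    have h1 := coeffOf_apply (contDiffOn_totalD hO hl h f) hy
    have h2 := coeffOf_apply (contDiffOn_totalD hO hl h g) hy
    refine (coeffOf_apply (contDiffOn_totalD hO hl h (f + g)) hy).trans ?_
    refine Eq.trans ?_ (congrArg₂ (· + ·) h1 h2).symm
    rw [Submodule.coe_add, fderiv_add (coeff_differentiableAt hO f hy)
      (coeff_differentiableAt hO g hy), add_apply, Pi.add_apply, smul_add]
    abel
  map_smul' c f := coeff_ext fun y hy => by
    have h1 := coeffOf_apply (contDiffOn_totalD hO hl h f) hy
    refine (coeffOf_apply (contDiffOn_totalD hO hl h (c • f)) hy).trans ?_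
    refine Eq.trans ?_ (congrArg (c • ·) h1).symm
    rw [Submodule.coe_smul, fderiv_const_smul (coeff_differentiableAt hO f hy),
      smul_apply, Pi.smul_apply, smul_sub, smul_comm c]

theorem totalD_apply (hO : IsOpen O) (hl : ContDiffOn ℝ ∞ l (modelDom O k)) {s : ℕ} (h : k ≤ s)
    (f : CoeffModule O F s) {y : JetModel E s} (hy : y ∈ modelDom O s) :
    (totalD hO hl h f).1 y = fderiv ℝ f.1 y (modelField l h y) -
      modelDz l (modelProj E h y) • f.1 y := coeffOf_apply (contDiffOn_totalD hO hl h f) hy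

theorem fderiv_comp_modelProj (hO : IsOpen O) {r s : ℕ} (h : r ≤ s) {f : JetModel E r → F}
    (hf : ContDiffOn ℝ ∞ f (modelDom O r)) {y : JetModel E s} (hy : y ∈ modelDom O s)
    (w : JetModel E s) :
    fderiv ℝ (fun y => f (modelProj E h y)) y w =
      fderiv ℝ f (modelProj E h y) (modelProj E h w) := by
  have h1 : HasFDerivAt f (fderiv ℝ f (modelProj E h y)) (modelProj E h y) :=
    ((hf.contDiffAt ((isOpen_modelDom hO r).mem_nhds (modelProj_mem h hy))).differentiableAt
      (by simp)).hasFDerivAt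
  have h2 : HasFDerivAt (fun y => f (modelProj E h y)) _ y :=
    h1.comp y (modelProj E h).hasFDerivAt
  rw [h2.fderiv]; rfl

theorem coeff_fderiv_congr (hO : IsOpen O) {s : ℕ} {f : CoeffModule O F s}
    {g : JetModel E s → F} (h : ∀ y ∈ modelDom O s, f.1 y = g y) {y : JetModel E s}
    (hy : y ∈ modelDom O s) : fderiv ℝ f.1 y = fderiv ℝ g y := by
  refine Filter.EventuallyEq.fderiv_eq ?_
  filter_upwards [(isOpen_modelDom hO s).mem_nhds hy] with z hz using h z hz

/-- The commutation rule `[∂/∂q_(j+1), D] = ∂/∂q_j`, for a direction `w` in which neither `L` nor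
`f` varies; the terms with `∂L/∂z` and with `∂f` along `w` then drop out. -/
theorem fderiv_totalD (hO : IsOpen O) (hl : ContDiffOn ℝ ∞ l (modelDom O k)) {s : ℕ}
    (h : k ≤ s) (f : CoeffModule O F s) {w : JetModel E s} (hw : modelProj E h w = 0)
    (hf : ∀ y ∈ modelDom O s, fderiv ℝ f.1 y w = 0) {y : JetModel E s}
    (hy : y ∈ modelDom O s) :
    fderiv ℝ (totalD hO hl h f).1 y w = fderiv ℝ f.1 y (modelShift E s w, 0) := by
  have hmem := (isOpen_modelDom hO s).mem_nhds hy
  have hfa : ContDiffAt ℝ ∞ f.1 y := f.2.1.contDiffAt hmem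
  have hf' : HasFDerivAt (fderiv ℝ f.1) (fderiv ℝ (fderiv ℝ f.1) y) y :=
    (((contDiffOn_fderiv hO f.2.1).contDiffAt hmem).differentiableAt (by simp)).hasFDerivAt
  have hΓ : HasFDerivAt (modelField l h) (fderiv ℝ (modelField l h) y) y :=
    (((contDiffOn_modelField hl h).contDiffAt hmem).differentiableAt (by simp)).hasFDerivAt
  have hz : HasFDerivAt (fun y => modelDz l (modelProj E h y))
      (fderiv ℝ (fun y => modelDz l (modelProj E h y)) y) y :=
    ((((contDiffOn_modelDz hO hl).comp (modelProj E h).contDiff.contDiffOn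
      fun _ hy => hy).contDiffAt hmem).differentiableAt (by simp)).hasFDerivAt
  have hD := (hf'.clm_apply hΓ).sub (hz.smul (coeff_differentiableAt hO f hy).hasFDerivAt)
  rw [coeff_fderiv_congr hO (fun y hy => totalD_apply hO hl h f hy) hy]
  have hD' : HasFDerivAt (fun y => fderiv ℝ f.1 y (modelField l h y) -
      modelDz l (modelProj E h y) • f.1 y) _ y := hD
  rw [hD'.fderiv]
  -- By symmetry this is the derivative along the field of `z ↦ ∂_w f (z)`, which vanishes
  -- identically near `y`.
  have hsymm : fderiv ℝ (fderiv ℝ f.1) y w (modelField l h y) = 0 := by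
    have hs : IsSymmSndFDerivAt ℝ f.1 y := hfa.isSymmSndFDerivAt (by
      rw [minSmoothness_of_isRCLikeNormedField]; exact WithTop.coe_le_coe.2 (le_top : (2 : ℕ∞) ≤ ⊤))
    rw [hs.eq w (modelField l h y)]
    have h0 : fderiv ℝ (fun y => fderiv ℝ f.1 y w) y = 0 := by
      have : (fun y => fderiv ℝ f.1 y w) =ᶠ[𝓝 y] fun _ => 0 := by
        filter_upwards [hmem] with z hz using hf z hz
      rw [this.fderiv_eq]; simp
    have h1 := (hf'.clm_apply (hasFDerivAt_const w y)).fderiv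
    rw [h0] at h1
    have h2 := congrArg (fun A => A (modelField l h y)) h1
    simpa using h2.symm
  have hz0 : fderiv ℝ (fun y => modelDz l (modelProj E h y)) y w = 0 := by
    rw [fderiv_comp_modelProj hO h (contDiffOn_modelDz hO hl) hy, hw, map_zero]
  simp [hsymm, hz0, hf y hy, fderiv_modelField hO hl h hy, hw]

/-- The partial derivative `∂L/∂q_a`. -/
def partialLag (l : JetModel E k → ℝ) (a : ℕ) (y : JetModel E k) : E →L[ℝ] ℝ :=
  (fderiv ℝ l y).comp (modelInj E k a)

theorem contDiffOn_partialLag (hO : IsOpen O) (hl : ContDiffOn ℝ ∞ l (modelDom O k)) (a : ℕ) :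
    ContDiffOn ℝ ∞ (partialLag l a) (modelDom O k) :=
  (contDiffOn_fderiv hO hl).clm_comp contDiffOn_const

/-- The sequence of the partial derivatives of `L`, as functions on the model of `T^s Q × ℝ`. -/
def lagGrad (hO : IsOpen O) (hl : ContDiffOn ℝ ∞ l (modelDom O k)) {s : ℕ} (h : k ≤ s) (a : ℕ) :
    CoeffModule O (E →L[ℝ] ℝ) s :=
  coeffOf (fun y => partialLag l a (modelProj E h y))
    ((contDiffOn_partialLag hO hl a).comp (modelProj E h).contDiff.contDiffOn fun _ hy => hy)

theorem lagGrad_apply (hO : IsOpen O) (hl : ContDiffOn ℝ ∞ l (modelDom O k)) {s : ℕ} (h : k ≤ s)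
    (a : ℕ) {y : JetModel E s} (hy : y ∈ modelDom O s) :
    (lagGrad hO hl h a).1 y = partialLag l a (modelProj E h y) := coeffOf_apply _ hy

theorem lagGrad_eq_zero (hO : IsOpen O) (hl : ContDiffOn ℝ ∞ l (modelDom O k)) {s : ℕ}
    (h : k ≤ s) {a : ℕ} (ha : k < a) : lagGrad hO hl h a = 0 :=
  coeff_ext fun y hy => by
    rw [lagGrad_apply _ _ _ _ hy, partialLag, modelInj_of_le ha]
    ext; simp

/-- The Jacobi–Ostrogradsky momenta. -/
def momenta (hO : IsOpen O) (hl : ContDiffOn ℝ ∞ l (modelDom O k)) {s : ℕ} (h : k ≤ s) :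
    ℕ → CoeffModule O (E →L[ℝ] ℝ) s :=
  seqMomenta (totalD hO hl h) k (lagGrad hO hl h)

theorem momenta_eq_zero (hO : IsOpen O) (hl : ContDiffOn ℝ ∞ l (modelDom O k)) {s : ℕ}
    (h : k ≤ s) {a : ℕ} (ha : k ≤ a) : momenta hO hl h a = 0 :=
  seqMomenta_eq_zero _ (fun _ hb => lagGrad_eq_zero hO hl h hb) ha

theorem momenta_eq (hO : IsOpen O) (hl : ContDiffOn ℝ ∞ l (modelDom O k)) {s : ℕ}
    (h : k ≤ s) (a : ℕ) : momenta hO hl h a =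
      lagGrad hO hl h (a + 1) - totalD hO hl h (momenta hO hl h (a + 1)) := by
  have := seqMomenta_recurrence (totalD hO hl h) (g := lagGrad hO hl h)
    (fun _ hb => lagGrad_eq_zero hO hl h hb) a
  exact eq_sub_of_add_eq' this

/-- The start of the recursion; on the graph of the Legendre map it is also the constraint contained
in the unified equations. -/
theorem momenta_top (hO : IsOpen O) (hl : ContDiffOn ℝ ∞ l (modelDom O k)) {s : ℕ}
    (h : k ≤ s) (hk : 1 ≤ k) : momenta hO hl h (k - 1) = lagGrad hO hl h k := by
  have h1 := momenta_eq hO hl h (k - 1)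
  rw [show k - 1 + 1 = k by omega, momenta_eq_zero hO hl h le_rfl, LinearMap.map_zero] at h1
  refine h1.trans (Subtype.ext ?_)
  exact sub_zero (lagGrad hO hl h k).1

/-- The Hessian of `L` in the variable `q_k`. -/
def lagHess (l : JetModel E k → ℝ) (y : JetModel E k) : E →L[ℝ] E →L[ℝ] ℝ :=
  (fderiv ℝ (partialLag l k) y).comp (modelInj E k k)

theorem fderiv_lagGrad (hO : IsOpen O) (hl : ContDiffOn ℝ ∞ l (modelDom O k)) {s : ℕ}
    (h : k ≤ s) (a : ℕ) {y : JetModel E s} (hy : y ∈ modelDom O s) (w : JetModel E s) :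
    fderiv ℝ (lagGrad hO hl h a).1 y w =
      fderiv ℝ (partialLag l a) (modelProj E h y) (modelProj E h w) := by
  rw [coeff_fderiv_congr hO (fun y hy => lagGrad_apply hO hl h a hy) hy,
    fderiv_comp_modelProj hO h (contDiffOn_partialLag hO hl a) hy]

/-- Leading term of the momenta. Each step of `p^a = ∂L/∂q_(a+1) - D_L p^(a+1)` raises the highest
variable by one and, by the commutation rule, carries over its coefficient with the opposite sign.
Directions with `w_j = 0` for `j < k + i` isolate this coefficient. -/
theorem fderiv_momenta (hO : IsOpen O) (hl : ContDiffOn ℝ ∞ l (modelDom O k)) {s : ℕ}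
    (h : k ≤ s) {i : ℕ} : i < k → k + i ≤ s → ∀ {w : JetModel E s},
      (∀ j < k + i, modelCoord E s j w = 0) → w.2 = 0 → ∀ {y : JetModel E s},
      y ∈ modelDom O s → fderiv ℝ (momenta hO hl h (k - 1 - i)).1 y w =
        (-1 : ℝ) ^ i • lagHess l (modelProj E h y) (modelCoord E s (k + i) w) := by
  induction i with
  | zero =>
    intro hk hs w hw hw2 y hy
    rw [Nat.sub_zero, momenta_top hO hl h hk, fderiv_lagGrad hO hl h k hy, lagHess, pow_zero, one_smul,
      ContinuousLinearMap.comp_apply]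
    congr 1
    refine model_ext (fun j hj => ?_) (by simp [modelInj_snd, hw2])
    rw [modelCoord_modelProj h hj, modelCoord_modelInj (by omega)]
    split_ifs with hjk
    · rw [hjk, add_zero]
    · exact hw j (by omega)
  | succ i ih =>
    intro hk hs w hw hw2 y hy
    -- Now `w` vanishes up to index `k`, so `L` and its partial derivatives do not vary along `w`.
    have hw0 : modelProj E h w = 0 := by
      refine model_ext (fun j hj => ?_) (by simp [hw2])
      rw [modelCoord_modelProj h hj, hw j (by omega), map_zero]
    -- The induction hypothesis with `w_(k+i) = 0`: the previous momentum is constant along `w`, as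
    -- the commutation rule requires.
    have hP : ∀ y ∈ modelDom O s, fderiv ℝ (momenta hO hl h (k - 1 - i)).1 y w = 0 := by
      intro y hy
      rw [ih (by omega) (by omega) (fun j hj => hw j (by omega)) hw2 hy, hw _ (by omega)]
      simp
    rw [momenta_eq, show k - 1 - (i + 1) + 1 = k - 1 - i by omega, Submodule.coe_sub,
      fderiv_sub (coeff_differentiableAt hO _ hy) (coeff_differentiableAt hO _ hy),
      sub_apply, fderiv_lagGrad hO hl h _ hy, hw0, map_zero, zero_sub,
      fderiv_totalD hO hl h _ hw0 hP hy]
    have hsh : ∀ j, modelCoord E s j (modelShift E s w, 0) = modelCoord E s (j + 1) w := by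
      intro j
      rcases lt_or_ge j (s + 1) with hj | hj
      · rw [modelCoord_of_lt hj]; rfl
      · rw [modelCoord_of_le hj, modelCoord_of_le (by omega)]
    rw [ih (by omega) (by omega) (fun j hj => by rw [hsh, hw _ (by omega)]) rfl hy, hsh, pow_succ,
      mul_neg_one, add_assoc]
    exact (neg_smul _ _).symm

end Smooth

end Model

/-! ### The triangular linear system and its unique solution -/

section Solution

variable {E : Type*} [NormedAddCommGroup E] [NormedSpace ℝ E] {k : ℕ}
  {l : JetModel E k → ℝ} {O : Set E}

/-- The value of the Euler–Lagrange expression `∂L/∂q_0 - D_L p^0`. -/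
def eulerLagrange (hO : IsOpen O) (hl : ContDiffOn ℝ ∞ l (modelDom O k)) {s : ℕ} (h : k ≤ s) :
    CoeffModule O (E →L[ℝ] ℝ) s :=
  lagGrad hO hl h 0 - totalD hO hl h (momenta hO hl h 0)

/-- The local expression of the contact Lagrangian vector field. -/
def modelSolution (hO : IsOpen O) (hl : ContDiffOn ℝ ∞ l (modelDom O k)) {s : ℕ} (h : k ≤ s)
    (y : JetModel E s) : JetModel E s :=
  modelField l h y + modelInj E s s ((-1 : ℝ) ^ (k - 1) •
    (lagHess l (modelProj E h y)).inverse ((eulerLagrange hO hl h).1 y))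

theorem contDiffOn_lagHess (hO : IsOpen O) (hl : ContDiffOn ℝ ∞ l (modelDom O k)) :
    ContDiffOn ℝ ∞ (lagHess l) (modelDom O k) :=
  (contDiffOn_fderiv hO (contDiffOn_partialLag hO hl k)).clm_comp contDiffOn_const

-- Inversion of operators is smooth at invertible ones; completeness of `E` is needed for this.
set_option synthInstance.maxHeartbeats 200000 in
theorem contDiffOn_modelSolution [CompleteSpace E] (hO : IsOpen O)
    (hl : ContDiffOn ℝ ∞ l (modelDom O k))
    (hreg : ∀ y ∈ modelDom O k, (lagHess l y).IsInvertible) {s : ℕ} (h : k ≤ s) :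
    ContDiffOn ℝ ∞ (modelSolution hO hl h) (modelDom O s) := by
  have h1 : ContDiffOn ℝ ∞ (fun y => (lagHess l (modelProj E h y)).inverse) (modelDom O s) := by
    intro y hy
    obtain ⟨A, hA⟩ := hreg _ (modelProj_mem h hy)
    have h2 : ContDiffAt ℝ ∞ ContinuousLinearMap.inverse (lagHess l (modelProj E h y)) := by
      rw [← hA]; exact contDiffAt_map_inverse A
    have h3 : ContDiffWithinAt ℝ ∞ (fun y => lagHess l (modelProj E h y)) (modelDom O s) y :=
      ((contDiffOn_lagHess hO hl).comp (modelProj E h).contDiff.contDiffOn fun _ hy => hy) y hy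
    exact h2.comp_contDiffWithinAt y h3
  exact (contDiffOn_modelField hl h).add ((modelInj E s s).contDiff.comp_contDiffOn
    (contDiffOn_const.smul (h1.clm_apply (eulerLagrange hO hl h).2.1)))

theorem lagHess_injective {y : JetModel E k} (h : (lagHess l y).IsInvertible) {v : E}
    (hv : lagHess l y v = 0) : v = 0 := by
  obtain ⟨A, hA⟩ := h
  rw [← hA] at hv
  exact A.injective (hv.trans (map_zero A).symm)

theorem fderiv_momenta_succ (hO : IsOpen O) (hl : ContDiffOn ℝ ∞ l (modelDom O k)) {s : ℕ}
    (h : k ≤ s) (a : ℕ) {y : JetModel E s} (hy : y ∈ modelDom O s) :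
    fderiv ℝ (momenta hO hl h (a + 1)).1 y (modelField l h y) =
      (lagGrad hO hl h (a + 1)).1 y + modelDz l (modelProj E h y) • (momenta hO hl h (a + 1)).1 y
        - (momenta hO hl h a).1 y := by
  rw [momenta_eq hO hl h a, Submodule.coe_sub, Pi.sub_apply, totalD_apply hO hl h _ hy]
  abel

theorem fderiv_momenta_zero (hO : IsOpen O) (hl : ContDiffOn ℝ ∞ l (modelDom O k)) {s : ℕ}
    (h : k ≤ s) {y : JetModel E s} (hy : y ∈ modelDom O s) :
    fderiv ℝ (momenta hO hl h 0).1 y (modelField l h y) =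
      (lagGrad hO hl h 0).1 y + modelDz l (modelProj E h y) • (momenta hO hl h 0).1 y
        - (eulerLagrange hO hl h).1 y := by
  rw [eulerLagrange, Submodule.coe_sub, Pi.sub_apply, totalD_apply hO hl h _ hy]
  abel

/-- The three conditions are what the unified equations impose on a vector tangent to the graph. By
the recursion `modelField` satisfies all of them except the one for `p^0`, where the Euler–Lagrange
expression remains; the correction is found by solving a triangular system. -/
theorem modelSolution_iff (hk : 1 ≤ k) (hO : IsOpen O) (hl : ContDiffOn ℝ ∞ l (modelDom O k))
    (hreg : ∀ y ∈ modelDom O k, (lagHess l y).IsInvertible) {s : ℕ} (h : k ≤ s)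
    (hs : s + 1 = 2 * k) {y : JetModel E s} (hy : y ∈ modelDom O s) (u : JetModel E s) :
    ((∀ j < k, modelCoord E s j u = modelCoord E s (j + 1) y) ∧
      (∀ a < k, fderiv ℝ (momenta hO hl h a).1 y u = (lagGrad hO hl h a).1 y +
        modelDz l (modelProj E h y) • (momenta hO hl h a).1 y -
          (seqShift (momenta hO hl h) a).1 y) ∧
      u.2 = l (modelProj E h y)) ↔ u = modelSolution hO hl h y := by
  have hH := hreg _ (modelProj_mem h hy)
  obtain ⟨w, rfl⟩ : ∃ w, u = modelField l h y + w := ⟨u - modelField l h y, by abel⟩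
  have hc : ∀ j, modelCoord E s j (modelField l h y + w) = modelCoord E s (j + 1) y ↔
      modelCoord E s j w = 0 := fun j => by
    rw [map_add, modelCoord_modelField, add_eq_left]
  have h2 : (modelField l h y + w).2 = l (modelProj E h y) ↔ w.2 = 0 := by
    change l (modelProj E h y) + w.2 = _ ↔ _
    rw [add_eq_left]
  have hsucc : ∀ a, (fderiv ℝ (momenta hO hl h (a + 1)).1 y (modelField l h y + w) =
      (lagGrad hO hl h (a + 1)).1 y +
        modelDz l (modelProj E h y) • (momenta hO hl h (a + 1)).1 y -
          (seqShift (momenta hO hl h) (a + 1)).1 y) ↔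
      fderiv ℝ (momenta hO hl h (a + 1)).1 y w = 0 := fun a => by
    rw [seqShift_succ, map_add, fderiv_momenta_succ hO hl h a hy, add_eq_left]
  have hzero : (fderiv ℝ (momenta hO hl h 0).1 y (modelField l h y + w) =
      (lagGrad hO hl h 0).1 y +
        modelDz l (modelProj E h y) • (momenta hO hl h 0).1 y -
          (seqShift (momenta hO hl h) 0).1 y) ↔
      fderiv ℝ (momenta hO hl h 0).1 y w = (eulerLagrange hO hl h).1 y := by
    rw [seqShift_zero, map_add, fderiv_momenta_zero hO hl h hy, Submodule.coe_zero, Pi.zero_apply,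
      sub_zero, sub_add_eq_add_sub, add_sub_assoc, add_eq_left, sub_eq_zero]
  have hsol : modelField l h y + w = modelSolution hO hl h y ↔ w = modelInj E s s
      ((-1 : ℝ) ^ (k - 1) • (lagHess l (modelProj E h y)).inverse
        ((eulerLagrange hO hl h).1 y)) := by
    rw [modelSolution, add_right_inj]
  have hinv : ∀ ξ, lagHess l (modelProj E h y) ((lagHess l (modelProj E h y)).inverse ξ) = ξ :=
    fun ξ => by
      obtain ⟨A, hA⟩ := hH
      rw [← hA, ContinuousLinearMap.inverse_equiv]; simp
  have hone : ((-1 : ℝ) ^ (k - 1)) * ((-1 : ℝ) ^ (k - 1)) = 1 := by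
    rw [← mul_pow]; simp
  rw [hsol]
  simp only [hc, h2]
  constructor
  · rintro ⟨hw, hP, hw2⟩
    -- Climbing one coordinate at a time: once `w_j = 0` for `j < k + i`, the equation for
    -- `p^(k-1-i)` reads `± Hess w_(k+i) = 0`. The index of this momentum is positive in each case,
    -- so no Euler–Lagrange term appears.
    have hlow : ∀ i, i < k → ∀ j < k + i, modelCoord E s j w = 0 := by
      intro i
      induction i with
      | zero => intro _ j hj; exact hw j (by omega)
      | succ i ih =>
        intro hi j hj
        rcases lt_or_ge j (k + i) with hji | hji
        · exact ih (by omega) j hji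
        · obtain rfl : j = k + i := by omega
          obtain ⟨a, ha⟩ : ∃ a, k - 1 - i = a + 1 := ⟨k - 1 - i - 1, by omega⟩
          have h3 := (hsucc a).1 (hP (a + 1) (by omega))
          rw [← ha, fderiv_momenta hO hl h (by omega) (by omega) (ih (by omega)) hw2 hy] at h3
          refine lagHess_injective hH ?_
          simpa using h3
    have hk1 := hlow (k - 1) (by omega)
    have h3 := hzero.1 (hP 0 hk)
    -- The last equation, for `p^0`, contains only the top coordinate `w_(2k-1)`.
    have h4 := fderiv_momenta hO hl h (i := k - 1) (by omega) (by omega) hk1 hw2 hy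
    rw [show k - 1 - (k - 1) = 0 by omega, h3, show k + (k - 1) = s by omega] at h4
    have h5 : modelCoord E s s w = (-1 : ℝ) ^ (k - 1) •
        (lagHess l (modelProj E h y)).inverse ((eulerLagrange hO hl h).1 y) := by
      have h6 : lagHess l (modelProj E h y) (modelCoord E s s w - (-1 : ℝ) ^ (k - 1) •
          (lagHess l (modelProj E h y)).inverse ((eulerLagrange hO hl h).1 y)) = 0 := by
        rw [map_sub, map_smul, hinv, h4, smul_smul, hone, one_smul, sub_self]
      exact sub_eq_zero.1 (lagHess_injective hH h6)
    refine model_ext (fun j hj => ?_) (by rw [hw2, modelInj_snd])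
    rw [modelCoord_modelInj (by omega)]
    split_ifs with hjs
    · rw [hjs, h5]
    · exact hk1 j (by omega)
  · intro hw
    have hw2 : w.2 = 0 := by rw [hw, modelInj_snd]
    have hw1 : ∀ j < s, modelCoord E s j w = 0 := fun j hj => by
      rw [hw, modelCoord_modelInj (by omega), if_neg (by omega)]
    have hP : ∀ i < k, fderiv ℝ (momenta hO hl h (k - 1 - i)).1 y w =
        (-1 : ℝ) ^ i • lagHess l (modelProj E h y) (modelCoord E s (k + i) w) := fun i hi =>
      fderiv_momenta hO hl h hi (by omega) (fun j hj => hw1 j (by omega)) hw2 hy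
    refine ⟨fun j hj => hw1 j (by omega), fun a ha => ?_, hw2⟩
    rcases a with _ | a
    · rw [hzero]
      have h3 := hP (k - 1) (by omega)
      rw [show k - 1 - (k - 1) = 0 by omega, show k + (k - 1) = s by omega] at h3
      rw [h3, hw, modelCoord_modelInj (by omega), if_pos rfl, map_smul, hinv, smul_smul, hone,
        one_smul]
    · rw [hsucc]
      have h3 := hP (k - 1 - (a + 1)) (by omega)
      rw [show k - 1 - (k - 1 - (a + 1)) = a + 1 by omega, hw1 _ (by omega)] at h3
      rw [h3, map_zero, smul_zero]

theorem modelCoord_modelSolution (hO : IsOpen O) (hl : ContDiffOn ℝ ∞ l (modelDom O k))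
    {s : ℕ} (h : k ≤ s) (y : JetModel E s) {j : ℕ} (hj : j < s) :
    modelCoord E s j (modelSolution hO hl h y) = modelCoord E s (j + 1) y := by
  rw [modelSolution, map_add, modelCoord_modelField, modelCoord_modelInj (by omega),
    if_neg (by omega), add_zero]

end Solution

/-! ### The Cartan form in coordinates -/

section ModelForms

variable {E : Type*} [NormedAddCommGroup E] [NormedSpace ℝ E] {k : ℕ}
  {l : JetModel E k → ℝ} {O : Set E}

/-- The vector `Tτ (Γ y)`, where `τ` is the projection of `T^(r+1) Q × ℝ` onto `T^r Q × ℝ`. -/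
def modelTotalVec (l : JetModel E k → ℝ) {r : ℕ} (h : k ≤ r) (y : JetModel E (r + 1)) :
    JetModel E r :=
  modelProj E (Nat.le_succ r) (modelField l (h.trans (Nat.le_succ r)) y)

/-- The local expression of the Lagrangian total derivative of `1`-forms. -/
def modelTotal (l : JetModel E k → ℝ) {r : ℕ} (h : k ≤ r)
    (ρ : JetModel E r → JetModel E r →L[ℝ] ℝ) (y : JetModel E (r + 1)) :
    JetModel E (r + 1) →L[ℝ] ℝ :=
  (fderiv ℝ ρ (modelProj E (Nat.le_succ r) y) (modelTotalVec l h y)).comp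
      (modelProj E (Nat.le_succ r))
    + (ρ (modelProj E (Nat.le_succ r) y)).comp (fderiv ℝ (modelTotalVec l h) y)
    - modelDz l (modelProj E (h.trans (Nat.le_succ r)) y) •
        (ρ (modelProj E (Nat.le_succ r) y)).comp (modelProj E (Nat.le_succ r))

/-- The local expression of `D_L^m (i (J_b) dL)`. -/
def modelForm (l : JetModel E k → ℝ) (b : ℕ) :
    ∀ m : ℕ, JetModel E (k + m) → JetModel E (k + m) →L[ℝ] ℝ
  | 0 => fun y => (fderiv ℝ l y).comp ((vertShift (E := E) k b).prodMap (0 : ℝ →L[ℝ] ℝ))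
  | m + 1 => modelTotal l (Nat.le_add_right k m) (modelForm l b m)

theorem contDiffOn_modelTotalVec (hl : ContDiffOn ℝ ∞ l (modelDom O k)) {r : ℕ} (h : k ≤ r) :
    ContDiffOn ℝ ∞ (modelTotalVec l h) (modelDom O (r + 1)) :=
  (modelProj E (Nat.le_succ r)).contDiff.comp_contDiffOn (contDiffOn_modelField hl _)

theorem fderiv_modelTotalVec (hO : IsOpen O) (hl : ContDiffOn ℝ ∞ l (modelDom O k)) {r : ℕ}
    (h : k ≤ r) {y : JetModel E (r + 1)} (hy : y ∈ modelDom O (r + 1)) (v : JetModel E (r + 1)) :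
    fderiv ℝ (modelTotalVec l h) y v = modelProj E (Nat.le_succ r) (modelShift E (r + 1) v,
      fderiv ℝ l (modelProj E (h.trans (Nat.le_succ r)) y)
        (modelProj E (h.trans (Nat.le_succ r)) v)) := by
  have h1 : HasFDerivAt (modelField l (h.trans (Nat.le_succ r))) _ y :=
    (((contDiffOn_modelField hl _).contDiffAt
      ((isOpen_modelDom hO _).mem_nhds hy)).differentiableAt (by simp)).hasFDerivAt
  have h2 : HasFDerivAt (modelTotalVec l h) _ y :=
    (modelProj E (Nat.le_succ r)).hasFDerivAt.comp y h1
  rw [h2.fderiv, ContinuousLinearMap.comp_apply, fderiv_modelField hO hl _ hy]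

theorem contDiffOn_comp_modelProj {F : Type*} [NormedAddCommGroup F] [NormedSpace ℝ F] {r s : ℕ}
    (h : r ≤ s) {f : JetModel E r → F} (hf : ContDiffOn ℝ ∞ f (modelDom O r)) :
    ContDiffOn ℝ ∞ (fun y => f (modelProj E h y)) (modelDom O s) :=
  hf.comp (modelProj E h).contDiff.contDiffOn fun _ hy => hy

theorem contDiffOn_modelTotal (hO : IsOpen O) (hl : ContDiffOn ℝ ∞ l (modelDom O k)) {r : ℕ}
    (h : k ≤ r) {ρ : JetModel E r → JetModel E r →L[ℝ] ℝ}
    (hρ : ContDiffOn ℝ ∞ ρ (modelDom O r)) :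
    ContDiffOn ℝ ∞ (modelTotal l h ρ) (modelDom O (r + 1)) := by
  have h1 := contDiffOn_comp_modelProj (Nat.le_succ r) hρ
  have h2 := contDiffOn_comp_modelProj (Nat.le_succ r) (contDiffOn_fderiv hO hρ)
  have h3 := contDiffOn_modelTotalVec hl h
  exact (((h2.clm_apply h3).clm_comp contDiffOn_const).add
    (h1.clm_comp (contDiffOn_fderiv hO h3))).sub
    ((contDiffOn_comp_modelProj _ (contDiffOn_modelDz hO hl)).smul
      (h1.clm_comp contDiffOn_const))

/-- Cartan's formula against the direct formula for the Lie derivative: differentiating `ρ (Γ)` by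
the product rule produces the term that cancels `- ∂_v ρ (Γ)`. -/
theorem modelTotal_apply (hO : IsOpen O) (hl : ContDiffOn ℝ ∞ l (modelDom O k)) {r : ℕ}
    (h : k ≤ r) {ρ : JetModel E r → JetModel E r →L[ℝ] ℝ}
    (hρ : ContDiffOn ℝ ∞ ρ (modelDom O r)) {y : JetModel E (r + 1)}
    (hy : y ∈ modelDom O (r + 1)) (v : JetModel E (r + 1)) :
    modelTotal l h ρ y v =
      fderiv ℝ ρ (modelProj E (Nat.le_succ r) y) (modelTotalVec l h y)
          (modelProj E (Nat.le_succ r) v)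
        - fderiv ℝ ρ (modelProj E (Nat.le_succ r) y) (modelProj E (Nat.le_succ r) v)
          (modelTotalVec l h y)
        + fderiv ℝ (fun y => ρ (modelProj E (Nat.le_succ r) y) (modelTotalVec l h y)) y v
        - modelDz l (modelProj E (h.trans (Nat.le_succ r)) y) *
          ρ (modelProj E (Nat.le_succ r) y) (modelProj E (Nat.le_succ r) v) := by
  have hmem := (isOpen_modelDom hO (r + 1)).mem_nhds hy
  have h1 := (((contDiffOn_comp_modelProj (Nat.le_succ r) hρ).contDiffAt
    hmem).differentiableAt (by simp)).hasFDerivAt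
  have h2 := (((contDiffOn_modelTotalVec hl h).contDiffAt hmem).differentiableAt
    (by simp)).hasFDerivAt
  rw [(h1.clm_apply h2).fderiv]
  simp only [modelTotal, sub_apply, add_apply, smul_apply,
    ContinuousLinearMap.comp_apply, ContinuousLinearMap.flip_apply, smul_eq_mul,
    fderiv_comp_modelProj hO (Nat.le_succ r) hρ hy]
  ring

theorem contDiffOn_modelForm (hO : IsOpen O) (hl : ContDiffOn ℝ ∞ l (modelDom O k)) (b m : ℕ) :
    ContDiffOn ℝ ∞ (modelForm l b m) (modelDom O (k + m)) := by
  induction m with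
  | zero => exact (contDiffOn_fderiv hO hl).clm_comp contDiffOn_const
  | succ m ih => exact contDiffOn_modelTotal hO hl _ ih

theorem modelForm_zero_apply {b : ℕ} (hb : b ≤ k) (y v : JetModel E k) :
    modelForm l b 0 y v = ∑ a ∈ Finset.range (k + 1 - b),
      ((a + b).descFactorial b : ℝ) • partialLag l (a + b) y (modelCoord E k a v) := by
  have h1 : ((vertShift (E := E) k b).prodMap (0 : ℝ →L[ℝ] ℝ)) v =
      ∑ a ∈ Finset.range (k + 1 - b),
        modelInj E k (a + b) (((a + b).descFactorial b : ℝ) • modelCoord E k a v) := by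
    refine model_ext (fun j hj => ?_) (by simp [Prod.snd_sum, modelInj_snd])
    rw [modelCoord_of_lt (by omega), map_sum]
    have h2 : (((vertShift (E := E) k b).prodMap (0 : ℝ →L[ℝ] ℝ)) v).1 ⟨j, by omega⟩ =
        (j.descFactorial b : ℝ) • v.1 ⟨j - b, by omega⟩ := rfl
    rw [h2]
    rcases lt_or_ge j b with hjb | hjb
    · rw [Nat.descFactorial_of_lt hjb, Nat.cast_zero, zero_smul, Finset.sum_eq_zero]
      intro a ha
      rw [modelCoord_modelInj (by have := Finset.mem_range.1 ha; omega), if_neg (by omega)]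
    · rw [Finset.sum_eq_single (j - b)]
      · rw [modelCoord_modelInj (by omega), if_pos (by omega), modelCoord_of_lt (by omega),
          Nat.sub_add_cancel hjb]
      · intro a ha haj
        rw [modelCoord_modelInj (by have := Finset.mem_range.1 ha; omega), if_neg (by omega)]
      · intro h
        exact absurd (Finset.mem_range.2 (by omega)) h
  refine (congrArg (fderiv ℝ l y) h1).trans ?_
  rw [map_sum]
  refine Finset.sum_congr rfl fun a _ => ?_
  rw [map_smul, map_smul]
  rfl

/-- Dictionary between forms and sequences. Coefficients are pulled back to a common order `s`, so
that one operator `totalD` serves for all the iterates. In `D_L (g_a dq_a) = (D_L g_a) dq_a + g_a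
dq_(a+1)` the second summand is the right shift. -/
theorem modelForm_apply (hO : IsOpen O) (hl : ContDiffOn ℝ ∞ l (modelDom O k)) {b : ℕ}
    (hb1 : 1 ≤ b) (hb : b ≤ k) {s : ℕ} (hs : k ≤ s) {m : ℕ} : ∀ (h : k + m ≤ s)
    {y : JetModel E s}, y ∈ modelDom O s → ∀ v : JetModel E (k + m),
      modelForm l b m (modelProj E h y) v = ∑ a ∈ Finset.range (k + m),
        ((seqTotal (totalD hO hl hs) ^ m)
          ((b ! : ℝ) • seqVert b (lagGrad hO hl hs)) a).1 y (modelCoord E (k + m) a v) := by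
  have hsupp : ∀ m a, k + m < a + b → (seqTotal (totalD hO hl hs) ^ m)
      ((b ! : ℝ) • seqVert b (lagGrad hO hl hs)) a = 0 := by
    intro m a ha
    rw [map_smul, Pi.smul_apply, seqTotal_pow_seqVert_eq_zero _
      (fun a ha => lagGrad_eq_zero hO hl hs ha) hb ha, smul_zero]
  induction m with
  | zero =>
    intro h y hy v
    refine (modelForm_zero_apply hb _ _).trans ?_
    have h1 : ∀ a, ((b ! : ℝ) • seqVert b (lagGrad hO hl hs)) a =
        ((a + b).descFactorial b : ℝ) • lagGrad hO hl hs (a + b) := fun a => by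
      rw [Pi.smul_apply, seqVert_apply, smul_smul, Nat.descFactorial_eq_factorial_mul_choose,
        Nat.cast_mul]
    simp only [pow_zero, Module.End.one_apply, Nat.add_zero]
    rw [← Finset.sum_subset (Finset.range_mono (show k + 1 - b ≤ k by omega))]
    · refine Finset.sum_congr rfl fun a _ => ?_
      rw [h1, Submodule.coe_smul, Pi.smul_apply, smul_apply, lagGrad_apply hO hl hs _ hy]
    · intro a _ ha
      have := hsupp 0 a (by have := mt Finset.mem_range.2 ha; omega)
      simp only [pow_zero, Module.End.one_apply] at this
      rw [this]; rfl
  | succ m ih =>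
    intro h y hy v
    set G := (seqTotal (totalD hO hl hs) ^ m) ((b ! : ℝ) • seqVert b (lagGrad hO hl hs)) with hG
    have hG' : ∀ a, ((seqTotal (totalD hO hl hs) ^ (m + 1))
        ((b ! : ℝ) • seqVert b (lagGrad hO hl hs)) a) =
          totalD hO hl hs (G a) + seqShift G a := fun a => by
      rw [pow_succ', Module.End.mul_apply, seqTotal_apply]
    have hkm : k + m ≤ s := by omega
    have hρ := contDiffOn_modelForm hO hl b m
    have key1 : ∀ w v', fderiv ℝ (modelForm l b m) (modelProj E hkm y) (modelProj E hkm w) v' =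
        ∑ a ∈ Finset.range (k + m), fderiv ℝ (G a).1 y w (modelCoord E (k + m) a v') := by
      intro w v'
      rw [← fderiv_comp_modelProj hO hkm hρ hy]
      have h1 := (((contDiffOn_comp_modelProj hkm hρ).contDiffAt
        ((isOpen_modelDom hO s).mem_nhds hy)).differentiableAt (by simp)).hasFDerivAt
      have h2 := (h1.clm_apply (hasFDerivAt_const v' y)).fderiv
      have h3 : (fun y => modelForm l b m (modelProj E hkm y) v') =ᶠ[𝓝 y]
          fun y => ∑ a ∈ Finset.range (k + m), (G a).1 y (modelCoord E (k + m) a v') := by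
        filter_upwards [(isOpen_modelDom hO s).mem_nhds hy] with z hz using ih hkm hz v'
      have h4 : HasFDerivAt (fun y => ∑ a ∈ Finset.range (k + m),
          (G a).1 y (modelCoord E (k + m) a v')) (∑ a ∈ Finset.range (k + m),
            (fderiv ℝ (G a).1 y).flip (modelCoord E (k + m) a v')) y := by
        refine HasFDerivAt.fun_sum fun a _ => ?_
        simpa using (coeff_differentiableAt hO (G a) hy).hasFDerivAt.clm_apply
          (hasFDerivAt_const (modelCoord E (k + m) a v') y)
      rw [h3.fderiv_eq, h4.fderiv] at h2
      have h5 := congrArg (fun A => A w) h2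
      simpa [sum_apply] using h5.symm
    have hy' : modelProj E h y ∈ modelDom O (k + m + 1) := hy
    have e1 : modelTotalVec l (Nat.le_add_right k m) (modelProj E h y) =
        modelProj E hkm (modelField l hs y) :=
      (modelProj_modelField l (Nat.le_add_right k m) h y).symm
    have e2 : modelProj E (Nat.le_succ (k + m)) (modelProj E h y) = modelProj E hkm y := rfl
    have e3 : modelProj E ((Nat.le_add_right k m).trans (Nat.le_succ (k + m)))
      (modelProj E h y) = modelProj E hs y := rfl
    have e4 : ∀ a < k + m, modelCoord E (k + m) a (fderiv ℝ
        (modelTotalVec l (Nat.le_add_right k m)) (modelProj E h y) v) =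
          modelCoord E (k + m + 1) (a + 1) v := by
      intro a ha
      rw [fderiv_modelTotalVec hO hl _ hy', modelCoord_modelProj _ ha.le,
        modelCoord_of_lt (show a < k + m + 1 + 1 by omega)]
      rfl
    have expand : modelForm l b (m + 1) (modelProj E h y) v =
        fderiv ℝ (modelForm l b m) (modelProj E hkm y) (modelProj E hkm (modelField l hs y))
          (modelProj E (Nat.le_succ (k + m)) v)
        + modelForm l b m (modelProj E hkm y) (fderiv ℝ
          (modelTotalVec l (Nat.le_add_right k m)) (modelProj E h y) v)
        - modelDz l (modelProj E hs y) * modelForm l b m (modelProj E hkm y)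
          (modelProj E (Nat.le_succ (k + m)) v) := by
      rw [← e1]; rfl
    rw [expand, key1, ih hkm hy, ih hkm hy, Finset.mul_sum]
    have e5 : ∀ a < k + m, modelCoord E (k + m) a (modelProj E (Nat.le_succ (k + m)) v) =
        modelCoord E (k + m + 1) a v := fun a ha => modelCoord_modelProj _ ha.le v
    have lhs1 : ∑ a ∈ Finset.range (k + m), fderiv ℝ (G a).1 y (modelField l hs y)
          (modelCoord E (k + m) a (modelProj E (Nat.le_succ (k + m)) v)) -
        ∑ a ∈ Finset.range (k + m), modelDz l (modelProj E hs y) * (G a).1 y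
          (modelCoord E (k + m) a (modelProj E (Nat.le_succ (k + m)) v)) =
        ∑ a ∈ Finset.range (k + m + 1),
          (totalD hO hl hs (G a)).1 y (modelCoord E (k + m + 1) a v) := by
      -- The coefficient of the new top variable is zero before differentiation; this uses `1 ≤ b`.
      rw [Finset.sum_range_succ, show G (k + m) = 0 from hsupp m (k + m) (by omega),
        LinearMap.map_zero, ← Finset.sum_sub_distrib]
      refine Eq.trans (Finset.sum_congr rfl fun a ha => ?_) (add_zero _).symm
      rw [e5 a (Finset.mem_range.1 ha), totalD_apply hO hl hs _ hy]
      rfl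
    have lhs2 : ∑ a ∈ Finset.range (k + m), (G a).1 y (modelCoord E (k + m) a (fderiv ℝ
        (modelTotalVec l (Nat.le_add_right k m)) (modelProj E h y) v)) =
        ∑ a ∈ Finset.range (k + m + 1), (seqShift G a).1 y (modelCoord E (k + m + 1) a v) := by
      rw [Finset.sum_range_succ']
      refine Eq.trans (Finset.sum_congr rfl fun a ha => ?_) (add_zero _).symm
      rw [e4 a (Finset.mem_range.1 ha)]; rfl
    rw [add_sub_right_comm, lhs1, lhs2, ← Finset.sum_add_distrib]
    refine Finset.sum_congr rfl fun a _ => ?_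
    rw [hG']; rfl

/-- The local expression of the Cartan form. -/
theorem sum_modelForm (hO : IsOpen O) (hl : ContDiffOn ℝ ∞ l (modelDom O k)) {s : ℕ}
    (hs : k ≤ s) (h : ∀ b < k, k + b ≤ s) {y : JetModel E s} (hy : y ∈ modelDom O s)
    (v : JetModel E s) :
    ∑ b : Fin k, ((-1 : ℝ) ^ (b : ℕ) / (((b : ℕ) + 1)! : ℝ)) *
      modelForm l ((b : ℕ) + 1) b (modelProj E (h b b.2) y) (modelProj E (h b b.2) v) =
    ∑ a ∈ Finset.range k, (momenta hO hl hs a).1 y (modelCoord E s a v) := by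
  have h1 : ∀ b : Fin k, ((-1 : ℝ) ^ (b : ℕ) / (((b : ℕ) + 1)! : ℝ)) *
      modelForm l ((b : ℕ) + 1) b (modelProj E (h b b.2) y) (modelProj E (h b b.2) v) =
      ∑ a ∈ Finset.range k, (-1 : ℝ) ^ (b : ℕ) * ((seqTotal (totalD hO hl hs) ^ (b : ℕ))
        (seqVert ((b : ℕ) + 1) (lagGrad hO hl hs)) a).1 y (modelCoord E s a v) := by
    intro b
    have hb := b.2
    -- Only `dq_a` with `a < k` survive: `J_(b+1)` lowers the order by `b + 1`, and `D_L^b` raises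
    -- it by only `b`. The weight `1 / (b + 1)!` cancels the factorial coming from `J_(b+1)`.
    rw [modelForm_apply hO hl (by omega) (by omega) hs _ hy,
      ← Finset.sum_subset (Finset.range_mono (show k ≤ k + b by omega)), Finset.mul_sum]
    · refine Finset.sum_congr rfl fun a ha => ?_
      have ha := Finset.mem_range.1 ha
      rw [map_smul, Pi.smul_apply, Submodule.coe_smul, Pi.smul_apply, smul_apply,
        modelCoord_modelProj _ (by omega), smul_eq_mul, ← mul_assoc,
        div_mul_cancel₀ _ (by positivity)]
    · intro a _ ha
      have ha := mt Finset.mem_range.2 ha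
      rw [map_smul, Pi.smul_apply, seqTotal_pow_seqVert_eq_zero _
        (fun a ha => lagGrad_eq_zero hO hl hs ha) (by omega) (by omega), smul_zero]
      rfl
  rw [Finset.sum_congr rfl fun b _ => h1 b, Finset.sum_comm]
  refine Finset.sum_congr rfl fun a _ => ?_
  rw [Fin.sum_univ_eq_sum_range (fun b => (-1 : ℝ) ^ b * ((seqTotal (totalD hO hl hs) ^ b)
        (seqVert (b + 1) (lagGrad hO hl hs)) a).1 y (modelCoord E s a v)) k]
  have h2 : (momenta hO hl hs a).1 = ∑ b ∈ Finset.range k, (-1 : ℝ) ^ b •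
      ((seqTotal (totalD hO hl hs) ^ b) (seqVert (b + 1) (lagGrad hO hl hs)) a).1 := by
    rw [momenta, seqMomenta, Finset.sum_apply, Submodule.coe_sum]
    rfl
  rw [h2, Finset.sum_apply, sum_apply]
  rfl

end ModelForms

/-! ### Derivatives of vector-valued maps on manifolds; pull-back of exterior derivatives -/

section VectorValued

variable {V : Type*} [NormedAddCommGroup V] [NormedSpace ℝ V]
  {H : Type*} [TopologicalSpace H] {I : ModelWithCorners ℝ V H}
  {M : Type*} [TopologicalSpace M] [ChartedSpace H M]
  {V' : Type*} [NormedAddCommGroup V'] [NormedSpace ℝ V']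

/-- The derivative of a function with values in a normed space. -/
def vderiv (I : ModelWithCorners ℝ V H) (Φ : M → V') (x : M) : TangentSpace I x →L[ℝ] V' :=
  mfderiv I 𝓘(ℝ, V') Φ x

theorem vderiv_congr {Φ Ψ : M → V'} {x : M} (h : Φ =ᶠ[𝓝 x] Ψ) : vderiv I Φ x = vderiv I Ψ x := by
  unfold vderiv
  rw [h.mfderiv_eq]

theorem vderiv_comp {W : Type*} [NormedAddCommGroup W] [NormedSpace ℝ W]
    {Φ : M → V'} {g : V' → W} {x : M} (hg : DifferentiableAt ℝ g (Φ x))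
    (hΦ : MDifferentiableAt I 𝓘(ℝ, V') Φ x) (u : TangentSpace I x) :
    vderiv I (fun x => g (Φ x)) x u = fderiv ℝ g (Φ x) (vderiv I Φ x u) := by
  have h := mfderiv_comp x hg.mdifferentiableAt hΦ
  rw [mfderiv_eq_fderiv] at h
  exact congrArg (fun A => A u) h

theorem vderiv_comp_mfderiv {W : Type*} [NormedAddCommGroup W] [NormedSpace ℝ W]
    {K : Type*} [TopologicalSpace K] {J : ModelWithCorners ℝ W K} {N : Type*} [TopologicalSpace N]
    [ChartedSpace K N] {f : N → M} {Φ : M → V'} {x : N}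
    (hΦ : MDifferentiableAt I 𝓘(ℝ, V') Φ (f x)) (hf : MDifferentiableAt J I f x)
    (u : TangentSpace J x) :
    vderiv I Φ (f x) (mfderiv J I f x u) = vderiv J (fun x => Φ (f x)) x u :=
  congrArg (fun A => A u) (mfderiv_comp x hΦ hf).symm

theorem vderiv_prodMk {W : Type*} [NormedAddCommGroup W] [NormedSpace ℝ W]
    {Φ : M → V'} {Ψ : M → W} {x : M} (hΦ : MDifferentiableAt I 𝓘(ℝ, V') Φ x)
    (hΨ : MDifferentiableAt I 𝓘(ℝ, W) Ψ x) (u : TangentSpace I x) :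
    vderiv I (fun x => (Φ x, Ψ x)) x u = (vderiv I Φ x u, vderiv I Ψ x u) := by
  have h1 := vderiv_comp (I := I) (g := (Prod.fst : V' × W → V')) (by fun_prop)
    (hΦ.prodMk_space hΨ) u
  have h2 := vderiv_comp (I := I) (g := (Prod.snd : V' × W → W)) (by fun_prop)
    (hΦ.prodMk_space hΨ) u
  rw [fderiv_fst] at h1
  rw [fderiv_snd] at h2
  exact Prod.ext h1.symm h2.symm

/-- The contraction with the exterior derivative commutes with pull-backs. -/
theorem contrD_eq_of_pull [I.Boundaryless] [IsManifold I ∞ M] {Φ : M → V'}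
    {ρ : V' → V' →L[ℝ] ℝ} {ζ : OneForm I M} {x : M} (hΦ : ContMDiffAt I 𝓘(ℝ, V') ∞ Φ x)
    (hρ : DifferentiableAt ℝ ρ (Φ x))
    (h : ∀ᶠ x' in 𝓝 x, ∀ u, ζ x' u = ρ (Φ x') (vderiv I Φ x' u)) (u v : TangentSpace I x) :
    contrD ζ x u v = fderiv ℝ ρ (Φ x) (vderiv I Φ x u) (vderiv I Φ x v)
      - fderiv ℝ ρ (Φ x) (vderiv I Φ x v) (vderiv I Φ x u) := by
  have : IsManifold I 1 M := IsManifold.of_le (n := ∞) (by simp)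
  have hle : (2 : WithTop ℕ∞) ≤ ∞ := WithTop.coe_le_coe.2 (le_top : (2 : ℕ∞) ≤ ⊤)
  set χ := extChartAt I x with hχ
  set y₀ := χ x with hy₀
  have hxy : χ.symm y₀ = x := extChartAt_to_inv x
  set f : V → V' := fun y => Φ (χ.symm y) with hf
  have htar : χ.target ∈ 𝓝 y₀ := extChartAt_target_mem_nhds x
  have hsymm : ∀ y ∈ χ.target, ContMDiffAt 𝓘(ℝ, V) I ∞ χ.symm y := fun y hy =>
    (contMDiffOn_extChartAt_symm x).contMDiffAt
      ((isOpen_extChartAt_target x).mem_nhds hy)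
  have hf2 : ContDiffAt ℝ ∞ f y₀ := by
    rw [← contMDiffAt_iff_contDiffAt]
    refine ContMDiffAt.comp y₀ ?_ (hsymm y₀ (mem_extChartAt_target x))
    rw [hxy]; exact hΦ
  have hcont : Tendsto χ.symm (𝓝 y₀) (𝓝 x) := by
    have := (hsymm y₀ (mem_extChartAt_target x)).continuousAt
    rw [ContinuousAt, hxy] at this
    exact this
  have hΦev : ∀ᶠ x' in 𝓝 x, MDifferentiableAt I 𝓘(ℝ, V') Φ x' := by
    have h1 : ContMDiffAt I 𝓘(ℝ, V') 1 Φ x := hΦ.of_le (by simp)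
    filter_upwards [(contMDiffAt_iff_contMDiffAt_nhds (by simp)).1 h1] with x' hx'
    exact hx'.mdifferentiableAt (by simp)
  have hrep : formLocalRep ζ x =ᶠ[𝓝 y₀] fun y => (ρ (f y)).comp (fderiv ℝ f y) := by
    filter_upwards [htar, hcont.eventually h, hcont.eventually hΦev] with y hy hζ hd
    ext w
    simp only [formLocalRep, I.range_eq_univ, mfderivWithin_univ,
      ContinuousLinearMap.comp_apply]
    have h1 := vderiv_comp_mfderiv hd ((hsymm y hy).mdifferentiableAt (by simp)) w
    have h2 : vderiv 𝓘(ℝ, V) f y w = fderiv ℝ f y w := by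
      unfold vderiv; rw [mfderiv_eq_fderiv]; rfl
    rw [← h2]
    exact (hζ _).trans (congrArg (ρ (f y)) h1)
  have hfy : f y₀ = Φ x := by rw [hf, ← hxy]
  have hff : HasFDerivAt f (fderiv ℝ f y₀) y₀ := (hf2.differentiableAt (by simp)).hasFDerivAt
  have hf' : HasFDerivAt (fderiv ℝ f) (fderiv ℝ (fderiv ℝ f) y₀) y₀ :=
    ((hf2.fderiv_right (m := 1) (by rw [one_add_one_eq_two]; exact hle)).differentiableAt (by simp)).hasFDerivAt
  have hρ' : HasFDerivAt (fun y => ρ (f y)) ((fderiv ℝ ρ (f y₀)).comp (fderiv ℝ f y₀)) y₀ := by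
    rw [← hfy] at hρ
    exact hρ.hasFDerivAt.comp y₀ hff
  -- The extra term, with the second derivative of `f`, is symmetric in `a` and `b`, so it
  -- disappears under antisymmetrization.
  have hA : ∀ a b : V, fderivWithin ℝ (formLocalRep ζ x) (range I) y₀ a b =
      fderiv ℝ ρ (Φ x) (fderiv ℝ f y₀ a) (fderiv ℝ f y₀ b)
        + ρ (Φ x) (fderiv ℝ (fderiv ℝ f) y₀ a b) := by
    intro a b
    rw [I.range_eq_univ, fderivWithin_univ, hrep.fderiv_eq]
    have h1 := hρ'.clm_comp hf'
    rw [h1.fderiv, ← hfy, add_comm]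
    rfl
  have hsym : IsSymmSndFDerivAt ℝ f y₀ := hf2.isSymmSndFDerivAt (by
    rw [minSmoothness_of_isRCLikeNormedField]; exact hle)
  have hD : ∀ w : TangentSpace I x, vderiv I Φ x w = fderiv ℝ f y₀ (vderiv I χ x w) := by
    intro w
    have h1 : Φ =ᶠ[𝓝 x] fun x' => f (χ x') := by
      filter_upwards [extChartAt_source_mem_nhds (I := I) x] with x' hx'
      rw [hf]
      simp only [χ.left_inv hx']
    rw [vderiv_congr h1]
    have h2 : MDifferentiableAt I 𝓘(ℝ, V) χ x :=
      mdifferentiableAt_extChartAt (mem_chart_source H x)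
    exact vderiv_comp (Φ := χ) hff.differentiableAt h2 w
  have hmain : contrD ζ x u v =
      fderivWithin ℝ (formLocalRep ζ x) (range I) y₀ (vderiv I χ x u) (vderiv I χ x v) -
        fderivWithin ℝ (formLocalRep ζ x) (range I) y₀ (vderiv I χ x v) (vderiv I χ x u) := rfl
  rw [hmain, hA, hA, hD, hD, hsym.eq (vderiv I χ x u) (vderiv I χ x v)]
  ring

end VectorValued

/-! ### Invariance of the vertical shifts under changes of chart -/

section VerticalShift

variable {E F : Type*} [NormedAddCommGroup E] [NormedSpace ℝ E]
  [NormedAddCommGroup F] [NormedSpace ℝ F]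

/-- Iterated derivatives in `t` commute with derivatives in a parameter. -/
theorem fderiv_iteratedDeriv_slice {Y : Type*} [NormedAddCommGroup Y] [NormedSpace ℝ Y]
    {U : Set (Y × ℝ)} (hU : IsOpen U) (i : ℕ) (v : Y) :
    ∀ {G : Y × ℝ → F}, ContDiffOn ℝ ∞ G U → ∀ p ∈ U,
      fderiv ℝ (fun p : Y × ℝ => iteratedDeriv i (fun t => G (p.1, t)) p.2) p (v, 0) =
        iteratedDeriv i (fun t => fderiv ℝ G (p.1, t) (v, 0)) p.2 := by
  have hslice : ∀ {G : Y × ℝ → F}, ContDiffOn ℝ ∞ G U → ∀ p ∈ U,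
      deriv (fun t => G (p.1, t)) p.2 = fderiv ℝ G p (0, 1) := by
    rintro G hG ⟨y, t⟩ hp
    have hd : HasFDerivAt G (fderiv ℝ G (y, t)) (y, t) :=
      ((hG.contDiffAt (hU.mem_nhds hp)).differentiableAt (by simp)).hasFDerivAt
    have hl : HasDerivAt (fun s : ℝ => (y, s)) ((0 : Y), (1 : ℝ)) t :=
      (hasDerivAt_const t y).prodMk (hasDerivAt_id t)
    exact (hd.comp_hasDerivAt t hl).deriv
  have hnear : ∀ p ∈ U, ∀ᶠ s in 𝓝 p.2, (p.1, s) ∈ U := fun p hp =>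
    (show ContinuousAt (fun s : ℝ => (p.1, s)) p.2 by fun_prop).preimage_mem_nhds
      (hU.mem_nhds hp)
  induction i with
  | zero => intro G hG p hp; simp
  | succ i ih =>
    intro G hG p hp
    have hG' : ContDiffOn ℝ ∞ (fderiv ℝ G) U := hG.fderiv_of_isOpen hU (by simp)
    have h1 : ∀ w, ContDiffOn ℝ ∞ (fun p : Y × ℝ => fderiv ℝ G p w) U :=
      fun w => hG'.clm_apply contDiffOn_const
    have h2 : (fun p : Y × ℝ => iteratedDeriv (i + 1) (fun t => G (p.1, t)) p.2) =ᶠ[𝓝 p]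
        fun p => iteratedDeriv i (fun t => fderiv ℝ G (p.1, t) (0, 1)) p.2 := by
      filter_upwards [hU.mem_nhds hp] with q hq
      rw [iteratedDeriv_succ']
      refine Filter.EventuallyEq.iteratedDeriv_eq (n := i) ?_
      filter_upwards [hnear q hq] with s hs using hslice hG (q.1, s) hs
    -- Equality of the mixed partial derivatives, which moves one `t`-derivative past the parameter
    -- direction.
    have hcomm : ∀ q ∈ U, fderiv ℝ (fun p => fderiv ℝ G p (0, 1)) q (v, 0) =
        fderiv ℝ (fun p => fderiv ℝ G p (v, 0)) q (0, 1) := by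
      intro q hq
      have h3 : HasFDerivAt (fderiv ℝ G) (fderiv ℝ (fderiv ℝ G) q) q :=
        ((hG'.contDiffAt (hU.mem_nhds hq)).differentiableAt (by simp)).hasFDerivAt
      have hs : IsSymmSndFDerivAt ℝ G q :=
        (hG.contDiffAt (hU.mem_nhds hq)).isSymmSndFDerivAt (by
          rw [minSmoothness_of_isRCLikeNormedField]
          exact WithTop.coe_le_coe.2 (le_top : (2 : ℕ∞) ≤ ⊤))
      have h4 : ∀ w, fderiv ℝ (fun p => fderiv ℝ G p w) q =
          (fderiv ℝ (fderiv ℝ G) q).flip w := fun w => by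
        simpa using (h3.clm_apply (hasFDerivAt_const w q)).fderiv
      rw [h4, h4, ContinuousLinearMap.flip_apply, ContinuousLinearMap.flip_apply, hs.eq]
    rw [h2.fderiv_eq, ih (h1 _) p hp, iteratedDeriv_succ']
    refine Filter.EventuallyEq.iteratedDeriv_eq (n := i) ?_
    filter_upwards [hnear p hp] with s hs
    rw [hcomm _ hs]
    exact (hslice (h1 _) (p.1, s) hs).symm

theorem contDiffOn_iteratedDeriv {f : ℝ → F} {U : Set ℝ} (hU : IsOpen U)
    (hf : ContDiffOn ℝ ∞ f U) (i : ℕ) : ContDiffOn ℝ ∞ (iteratedDeriv i f) U := by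
  induction i with
  | zero => simpa using hf
  | succ i ih => rw [iteratedDeriv_succ]; exact ih.deriv_of_isOpen hU (by simp)

theorem hasDerivAt_iteratedDeriv {f : ℝ → F} {U : Set ℝ} (hU : IsOpen U)
    (hf : ContDiffOn ℝ ∞ f U) (i : ℕ) {t : ℝ} (ht : t ∈ U) :
    HasDerivAt (iteratedDeriv i f) (iteratedDeriv (i + 1) f t) t := by
  rw [iteratedDeriv_succ]
  exact (((contDiffOn_iteratedDeriv hU hf i).contDiffAt (hU.mem_nhds ht)).differentiableAt
    (by simp)).hasDerivAt

theorem iteratedDeriv_id_smul {f : ℝ → F} {U : Set ℝ} (hU : IsOpen U)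
    (hf : ContDiffOn ℝ ∞ f U) (i : ℕ) :
    ∀ t ∈ U, iteratedDeriv i (fun t => t • f t) t =
      t • iteratedDeriv i f t + (i : ℝ) • iteratedDeriv (i - 1) f t := by
  induction i with
  | zero => simp
  | succ i ih =>
    intro t ht
    have hd := fun j => hasDerivAt_iteratedDeriv hU hf j ht
    have h1 : HasDerivAt (fun t => t • iteratedDeriv i f t + (i : ℝ) • iteratedDeriv (i - 1) f t)
        ((t • iteratedDeriv (i + 1) f t + (1 : ℝ) • iteratedDeriv i f t) +
          (i : ℝ) • iteratedDeriv (i - 1 + 1) f t) t :=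
      ((hasDerivAt_id t).smul (hd i)).add ((hd (i - 1)).const_smul (i : ℝ))
    have h2 : iteratedDeriv i (fun t => t • f t) =ᶠ[𝓝 t]
        fun t => t • iteratedDeriv i f t + (i : ℝ) • iteratedDeriv (i - 1) f t := by
      filter_upwards [hU.mem_nhds ht] with s hs using ih s hs
    rw [iteratedDeriv_succ, h2.deriv_eq, h1.deriv]
    rcases i with _ | i
    · simp
    · simp only [Nat.add_sub_cancel]
      push_cast
      module

/-- On jets at `0`, multiplication of a curve by `t ^ b` is exactly `vertShift`; this gives the
shift a coordinate-free meaning. -/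
theorem iteratedDeriv_pow_smul {U : Set ℝ} (hU : IsOpen U) (h0 : (0 : ℝ) ∈ U) (b : ℕ) :
    ∀ {f : ℝ → F}, ContDiffOn ℝ ∞ f U → ∀ i, iteratedDeriv i (fun t => t ^ b • f t) 0 =
      (i.descFactorial b : ℝ) • iteratedDeriv (i - b) f 0 := by
  induction b with
  | zero => intro f _ i; simp
  | succ b ih =>
    intro f hf i
    have h1 : (fun t : ℝ => t ^ (b + 1) • f t) = fun t => t ^ b • (t • f t) := by
      funext t; rw [smul_smul, pow_succ]
    rw [h1, ih (f := fun t => t • f t) (contDiffOn_id.smul hf), iteratedDeriv_id_smul hU hf (i - b) 0 h0, zero_smul,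
      zero_add, smul_smul, Nat.descFactorial_succ, Nat.sub_sub, mul_comm (i - b), Nat.cast_mul]

/-- The vertical shifts commute with the derivatives of the changes of natural coordinates. -/
theorem fderiv_iteratedDeriv_vertShift {ψ : E → F} {O : Set E} (hO : IsOpen O)
    (hψ : ContDiffOn ℝ ∞ ψ O) {k : ℕ} (b : ℕ) {y : Fin (k + 1) → E} (hy : y 0 ∈ O)
    (v : Fin (k + 1) → E) :
    fderiv ℝ (fun y : Fin (k + 1) → E => fun i : Fin (k + 1) =>
        iteratedDeriv i (ψ ∘ taylorCurve y) 0) y (vertShift k b v) =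
      vertShift k b (fderiv ℝ (fun y : Fin (k + 1) → E => fun i : Fin (k + 1) =>
        iteratedDeriv i (ψ ∘ taylorCurve y) 0) y v) := by
  let U : Set ((Fin (k + 1) → E) × ℝ) := (fun p => taylorCurve p.1 p.2) ⁻¹' O
  have hU : IsOpen U := hO.preimage contDiff_taylorCurve.continuous
  have hG : ContDiffOn ℝ ∞ (fun p : (Fin (k + 1) → E) × ℝ => ψ (taylorCurve p.1 p.2)) U :=
    hψ.comp contDiff_taylorCurve.contDiffOn fun _ hp => hp
  have hyU : (y, (0 : ℝ)) ∈ U := by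
    change taylorCurve y 0 ∈ O
    rwa [taylorCurve_zero]
  have hlin : ∀ (w : Fin (k + 1) → E) (t : ℝ), HasFDerivAt
      (fun p : (Fin (k + 1) → E) × ℝ => taylorCurve p.1 p.2)
      (fderiv ℝ (fun p : (Fin (k + 1) → E) × ℝ => taylorCurve p.1 p.2) (w, t)) (w, t) :=
    fun w t => (contDiff_taylorCurve.differentiable (by simp) _).hasFDerivAt
  have htay : ∀ (w : Fin (k + 1) → E) (t : ℝ),
      fderiv ℝ (fun p : (Fin (k + 1) → E) × ℝ => taylorCurve p.1 p.2) (y, t) (w, 0) =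
        taylorCurve w t := by
    intro w t
    have hl : HasFDerivAt (fun z : Fin (k + 1) → E => (z, t))
      (ContinuousLinearMap.inl ℝ (Fin (k + 1) → E) ℝ) y := hasFDerivAt_prodMk_left y t
    have h1 := ((hlin y t).comp y hl).fderiv
    let A : (Fin (k + 1) → E) →L[ℝ] E := ∑ j : Fin (k + 1), (t ^ (j : ℕ) / ((j : ℕ)! : ℝ)) •
      (ContinuousLinearMap.proj j : (Fin (k + 1) → E) →L[ℝ] E)
    have h2 : ((fun p : (Fin (k + 1) → E) × ℝ => taylorCurve p.1 p.2) ∘ fun z => (z, t)) = A := by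
      funext z
      simp [A, taylorCurve, sum_apply]
    rw [h2, A.fderiv] at h1
    have h3 := congrArg (fun B => B w) h1
    simpa [A, taylorCurve, sum_apply] using h3.symm
  -- The linearized change of coordinates sends the jet of a variation `w (t)` along `y (t)` to the
  -- jet of `Dψ (y (t)) w (t)`.
  have key : ∀ (w : Fin (k + 1) → E) (i : Fin (k + 1)),
      fderiv ℝ (fun y : Fin (k + 1) → E => fun i : Fin (k + 1) =>
        iteratedDeriv i (ψ ∘ taylorCurve y) 0) y w i =
      iteratedDeriv i (fun t => fderiv ℝ ψ (taylorCurve y t) (taylorCurve w t)) 0 := by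
    intro w i
    have hs : ∀ i : ℕ, HasFDerivAt (fun y : Fin (k + 1) → E => iteratedDeriv i
        (ψ ∘ taylorCurve y) 0) ((fderiv ℝ (fun p : (Fin (k + 1) → E) × ℝ =>
          iteratedDeriv i (fun t => ψ (taylorCurve p.1 t)) p.2) (y, 0)).comp
            (ContinuousLinearMap.inl ℝ (Fin (k + 1) → E) ℝ)) y := by
      intro i
      have h1 := (((contDiffOn_iteratedDeriv_slice hU i hG).contDiffAt
        (hU.mem_nhds hyU)).differentiableAt (by simp)).hasFDerivAt
      have hl : HasFDerivAt (fun z : Fin (k + 1) → E => (z, (0 : ℝ)))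
        (ContinuousLinearMap.inl ℝ (Fin (k + 1) → E) ℝ) y := hasFDerivAt_prodMk_left y 0
      exact h1.comp y hl
    rw [(hasFDerivAt_pi.2 fun i : Fin (k + 1) => hs i).fderiv]
    have h2 := fderiv_iteratedDeriv_slice hU i w hG _ hyU
    refine h2.trans (Filter.EventuallyEq.iteratedDeriv_eq (n := (i : ℕ)) ?_)
    have hc : ContinuousAt (fun s : ℝ => (y, s)) 0 := by fun_prop
    filter_upwards [hc.preimage_mem_nhds (hU.mem_nhds hyU)] with t ht
    have h3 : HasFDerivAt ψ (fderiv ℝ ψ (taylorCurve y t)) (taylorCurve y t) :=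
      ((hψ.contDiffAt (hO.mem_nhds ht)).differentiableAt (by simp)).hasFDerivAt
    have h4 := (HasFDerivAt.comp (y, t) h3 (hlin y t)).fderiv
    have h5 := congrArg (fun B => B (w, (0 : ℝ))) h4
    refine h5.trans ?_
    rw [ContinuousLinearMap.comp_apply, htay]
  let T : Set ℝ := taylorCurve y ⁻¹' O
  have hT : IsOpen T := hO.preimage (contDiff_taylorCurve' y).continuous
  have hT0 : (0 : ℝ) ∈ T := hyU
  have hsm : ContDiffOn ℝ ∞ (fun t => fderiv ℝ ψ (taylorCurve y t) (taylorCurve v t)) T :=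
    ((hψ.fderiv_of_isOpen hO (m := ∞) (by simp)).comp (contDiff_taylorCurve' y).contDiffOn
      fun _ ht => ht).clm_apply (contDiff_taylorCurve' v).contDiffOn
  funext i
  rw [key]
  have hR : vertShift k b (fderiv ℝ (fun y : Fin (k + 1) → E => fun i : Fin (k + 1) =>
        iteratedDeriv i (ψ ∘ taylorCurve y) 0) y v) i = ((i : ℕ).descFactorial b : ℝ) •
      (fderiv ℝ (fun y : Fin (k + 1) → E => fun i : Fin (k + 1) =>
        iteratedDeriv i (ψ ∘ taylorCurve y) 0) y v ⟨(i : ℕ) - b, by omega⟩) := rfl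
  rw [hR, key, ← iteratedDeriv_pow_smul hT hT0 b hsm]
  -- With the derivative seen as a map of base point and vector, `iteratedDeriv_comp_congr` allows
  -- the Taylor curve of the shifted vector to be replaced by `t ^ b • taylorCurve v t`, which has
  -- the same `k`-jet. Linearity in the vector then pulls `t ^ b` out.
  let Ψ : E × E → F := fun p => fderiv ℝ ψ p.1 p.2
  have hΨ : ContDiffAt ℝ ∞ Ψ (y 0, taylorCurve (vertShift k b v) 0) :=
    (((hψ.fderiv_of_isOpen hO (m := ∞) (by simp)).contDiffAt (hO.mem_nhds hy)).comp
      (y 0, taylorCurve (vertShift k b v) 0) contDiffAt_fst).clm_apply contDiffAt_snd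
  have hpair : ∀ (g : ℝ → E), ContDiff ℝ ∞ g → ∀ j : ℕ,
      iteratedDeriv j (fun t => (taylorCurve y t, g t)) 0 =
        (iteratedDeriv j (taylorCurve y) 0, iteratedDeriv j g 0) := by
    intro g hg j
    have hc : ContDiff ℝ ∞ (fun t => (taylorCurve y t, g t)) := (contDiff_taylorCurve' y).prodMk hg
    have hj : ((j : ℕ) : WithTop ℕ∞) ≤ ∞ := by exact_mod_cast le_top
    refine Prod.ext ?_ ?_
    · have := (ContinuousLinearMap.fst ℝ E E).iteratedFDeriv_comp_left
        (hc.contDiffAt (x := 0)) hj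
      rw [iteratedDeriv_eq_iteratedFDeriv, iteratedDeriv_eq_iteratedFDeriv]
      exact (congrArg (fun A => A fun _ => (1 : ℝ)) this).symm
    · have := (ContinuousLinearMap.snd ℝ E E).iteratedFDeriv_comp_left
        (hc.contDiffAt (x := 0)) hj
      rw [iteratedDeriv_eq_iteratedFDeriv, iteratedDeriv_eq_iteratedFDeriv]
      exact (congrArg (fun A => A fun _ => (1 : ℝ)) this).symm
  have hpow : ContDiff ℝ ∞ (fun t : ℝ => t ^ b • taylorCurve v t) :=
    (contDiff_id.pow b).smul (contDiff_taylorCurve' v)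
  have hcongr := iteratedDeriv_comp_congr (ψ := Ψ)
    (f := fun t => (taylorCurve y t, taylorCurve (vertShift k b v) t))
    (g := fun t => (taylorCurve y t, t ^ b • taylorCurve v t)) (k := k)
    (by simpa only [taylorCurve_zero] using hΨ)
    ((contDiff_taylorCurve' y).prodMk (contDiff_taylorCurve' _)).contDiffAt
    ((contDiff_taylorCurve' y).prodMk hpow).contDiffAt (by
      intro j hj
      rw [hpair _ (contDiff_taylorCurve' _), hpair _ hpow, iteratedDeriv_pow_smul hT hT0 b
        (contDiff_taylorCurve' v).contDiffOn]
      have h1 := iteratedDeriv_taylorCurve (vertShift k b v) ⟨j, by omega⟩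
      have h2 := iteratedDeriv_taylorCurve v ⟨j - b, by omega⟩
      simp only at h1 h2
      rw [h1, h2]; rfl) i (Nat.lt_succ_iff.1 i.2)
  refine hcongr.trans ?_
  congr 1
  funext t
  simp [Ψ]

end VerticalShift

/-! ### Natural charts of jet bundles, prolongations and vertical endomorphisms -/

section NaturalCoordinates

variable {E : Type*} [NormedAddCommGroup E] [NormedSpace ℝ E]
  {Q : Type*} [TopologicalSpace Q] [ChartedSpace E Q] [IsManifold 𝓘(ℝ, E) ∞ Q]
  {e : OpenPartialHomeomorph Q E}

/-- The natural chart of `T^r Q` induced by a chart of `Q`, as an open partial homeomorphism. -/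
def jetOpenChart (r : ℕ) (he : e ∈ atlas E Q) :
    OpenPartialHomeomorph (Jet E Q r) (Fin (r + 1) → E) :=
  (jetCore E Q r).openPartialHomeomorph (jetChart r e he) ⟨e, he, rfl⟩

theorem jetOpenChart_mem_atlas (r : ℕ) (he : e ∈ atlas E Q) :
    jetOpenChart r he ∈ atlas (Fin (r + 1) → E) (Jet E Q r) :=
  mem_atlas_jet.2 ⟨e, he, rfl⟩

theorem isOpen_jetSource (r : ℕ) (he : e ∈ atlas E Q) :
    IsOpen {p : Jet E Q r | p.base ∈ e.source} :=
  (jetOpenChart r he).open_source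

theorem contMDiffAt_jetCoord (he : e ∈ atlas E Q) {r : ℕ} {p : Jet E Q r}
    (hp : p.base ∈ e.source) :
    ContMDiffAt 𝓘(ℝ, Fin (r + 1) → E) 𝓘(ℝ, Fin (r + 1) → E) ∞ (jetCoord e) p :=
  contMDiffAt_of_mem_maximalAtlas
    (IsManifold.subset_maximalAtlas (jetOpenChart_mem_atlas r he)) hp

theorem contMDiffAt_jetOfCoord (he : e ∈ atlas E Q) {r : ℕ} {y : Fin (r + 1) → E}
    (hy : y 0 ∈ e.target) :
    ContMDiffAt 𝓘(ℝ, Fin (r + 1) → E) 𝓘(ℝ, Fin (r + 1) → E) ∞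
      (jetOfCoord e : (Fin (r + 1) → E) → Jet E Q r) y :=
  (contMDiffOn_symm_of_mem_maximalAtlas (IsManifold.subset_maximalAtlas
    (jetOpenChart_mem_atlas r he))).contMDiffAt ((jetOpenChart r he).open_target.mem_nhds hy)

theorem jetOfCoord_jetCoord (he : e ∈ atlas E Q) {r : ℕ} {p : Jet E Q r}
    (hp : p.base ∈ e.source) : jetOfCoord e (jetCoord e p) = p :=
  (jetChart r e he).left_inv hp

theorem jetCoord_jetOfCoord_self (he : e ∈ atlas E Q) {r : ℕ} {y : Fin (r + 1) → E}
    (hy : y 0 ∈ e.target) : jetCoord e (jetOfCoord e y : Jet E Q r) = y :=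
  (jetChart r e he).right_inv hy

theorem jetCoord_zero_mem {r : ℕ} {p : Jet E Q r} (hp : p.base ∈ e.source) :
    jetCoord e p 0 ∈ e.target := by
  rw [jetCoord_zero]; exact e.map_source hp

theorem mdifferentiableAt_jetCoord (he : e ∈ atlas E Q) {r : ℕ} {p : Jet E Q r}
    (hp : p.base ∈ e.source) :
    MDifferentiableAt 𝓘(ℝ, Fin (r + 1) → E) 𝓘(ℝ, Fin (r + 1) → E) (jetCoord e) p :=
  (contMDiffAt_jetCoord he hp).mdifferentiableAt (by simp)

theorem vderiv_jetCoord_bijective (he : e ∈ atlas E Q) {r : ℕ} {p : Jet E Q r}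
    (hp : p.base ∈ e.source) :
    Function.Bijective (vderiv 𝓘(ℝ, Fin (r + 1) → E) (jetCoord e) p) :=
  (mdifferentiable_of_mem_atlas (I := 𝓘(ℝ, Fin (r + 1) → E))
    (jetOpenChart_mem_atlas r he)).mfderiv_bijective hp

theorem vderiv_jetProj (he : e ∈ atlas E Q) {r s : ℕ} (h : r ≤ s) {p : Jet E Q s}
    (hp : p.base ∈ e.source) (u : TangentSpace 𝓘(ℝ, Fin (s + 1) → E) p) :
    vderiv 𝓘(ℝ, Fin (r + 1) → E) (jetCoord e) (jetProj h p)
      (mfderiv 𝓘(ℝ, Fin (s + 1) → E) 𝓘(ℝ, Fin (r + 1) → E) (jetProj h) p u) =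
    fun i => vderiv 𝓘(ℝ, Fin (s + 1) → E) (jetCoord e) p u
      (Fin.castLE (Nat.succ_le_succ h) i) := by
  rw [vderiv_comp_mfderiv (mdifferentiableAt_jetCoord he (by rwa [base_jetProj]))
    ((contMDiff_jetProj h).mdifferentiable (by simp) p)]
  let res : (Fin (s + 1) → E) →L[ℝ] (Fin (r + 1) → E) :=
    ContinuousLinearMap.pi fun i => ContinuousLinearMap.proj (Fin.castLE (Nat.succ_le_succ h) i)
  have h1 : (fun p : Jet E Q s => jetCoord e (jetProj h p)) =ᶠ[𝓝 p]
      fun p => res (jetCoord e p) := by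
    filter_upwards [(isOpen_jetSource s he).mem_nhds hp] with q hq
    exact funext fun i => jetCoord_jetProj he h q hq i
  rw [vderiv_congr h1, vderiv_comp res.differentiableAt (mdifferentiableAt_jetCoord he hp),
    res.fderiv]
  rfl

theorem contDiffOn_chart_comp (he : e ∈ atlas E Q) {c : ℝ → Q} {t₀ : ℝ}
    (hc : ∀ᶠ t in 𝓝 t₀, ContMDiffAt 𝓘(ℝ, ℝ) 𝓘(ℝ, E) ∞ c t) (h0 : c t₀ ∈ e.source) :
    ∃ U : Set ℝ, IsOpen U ∧ t₀ ∈ U ∧ ContDiffOn ℝ ∞ (e ∘ c) U ∧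
      ∀ t ∈ U, c t ∈ e.source ∧ ∀ᶠ t' in 𝓝 t, ContMDiffAt 𝓘(ℝ, ℝ) 𝓘(ℝ, E) ∞ c t' := by
  have h1 : ∀ᶠ t in 𝓝 t₀, c t ∈ e.source :=
    hc.self_of_nhds.continuousAt.preimage_mem_nhds (e.open_source.mem_nhds h0)
  obtain ⟨U, hU, hUo, hU0⟩ := eventually_nhds_iff.1 (hc.and h1)
  refine ⟨U, hUo, hU0, fun t ht => ?_, fun t ht => ⟨(hU t ht).2, ?_⟩⟩
  · refine ContDiffAt.contDiffWithinAt ?_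
    rw [← contMDiffAt_iff_contDiffAt]
    exact (contMDiffAt_of_mem_maximalAtlas
      (IsManifold.subset_maximalAtlas he) (hU t ht).2).comp t (hU t ht).1
  · filter_upwards [hUo.mem_nhds ht] with t' ht' using (hU t' ht').1

theorem smoothNearZero_translate {c : ℝ → Q} {t : ℝ}
    (hc : ∀ᶠ t' in 𝓝 t, ContMDiffAt 𝓘(ℝ, ℝ) 𝓘(ℝ, E) ∞ c t') :
    SmoothNearZero E Q (fun s => c (s + t)) := by
  have h1 : Tendsto (fun s : ℝ => s + t) (𝓝 0) (𝓝 t) := by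
    have : ContinuousAt (fun s : ℝ => s + t) 0 := by fun_prop
    simpa [ContinuousAt] using this
  filter_upwards [h1.eventually hc] with s hs
  exact ContMDiffAt.comp s hs
    (contDiff_id.add contDiff_const : ContDiff ℝ ∞ fun s : ℝ => s + t).contMDiff.contMDiffAt

theorem jetCoord_prolong (he : e ∈ atlas E Q) {r : ℕ} {c : ℝ → Q} {t : ℝ}
    (hc : ∀ᶠ t' in 𝓝 t, ContMDiffAt 𝓘(ℝ, ℝ) 𝓘(ℝ, E) ∞ c t') (h0 : c t ∈ e.source)
    (i : Fin (r + 1)) : jetCoord e (prolong E r c t) i = iteratedDeriv i (e ∘ c) t := by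
  rw [prolong, jetOf, dif_pos (smoothNearZero_translate hc), jetCoord_mk he _ (by simpa using h0)]
  have h1 : (e ∘ fun s => c (s + t)) = fun s => (e ∘ c) (s + t) := rfl
  simp only [h1, iteratedDeriv_comp_add_const, zero_add]

theorem base_prolong {r : ℕ} (c : ℝ → Q) (t : ℝ) : (prolong E r c t).base = c t := by
  rw [prolong, base_jetOf, zero_add]

/-- The coordinates of a prolonged curve are the iterated derivatives of its local expression, so
its velocity shifts them by one. -/
theorem vderiv_prolong (he : e ∈ atlas E Q) {r : ℕ} {c : ℝ → Q} {t : ℝ}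
    (hc : ∀ᶠ t' in 𝓝 t, ContMDiffAt 𝓘(ℝ, ℝ) 𝓘(ℝ, E) ∞ c t') (h0 : c t ∈ e.source) :
    vderiv 𝓘(ℝ, Fin (r + 1) → E) (jetCoord e) (prolong E r c t)
      (mfderiv 𝓘(ℝ, ℝ) 𝓘(ℝ, Fin (r + 1) → E) (prolong E r c) t (1 : ℝ)) =
    fun i : Fin (r + 1) => iteratedDeriv ((i : ℕ) + 1) (e ∘ c) t := by
  obtain ⟨U, hU, hU0, hf, hUs⟩ := contDiffOn_chart_comp he hc h0
  let g : ℝ → (Fin (r + 1) → E) := fun t i => iteratedDeriv i (e ∘ c) t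
  have hg : ContDiffOn ℝ ∞ g U := contDiffOn_pi.2 fun i => contDiffOn_iteratedDeriv hU hf i
  have h1 : ∀ t ∈ U, jetCoord e (prolong E r c t) = g t := fun t ht =>
    funext fun i => jetCoord_prolong he (hUs t ht).2 (hUs t ht).1 i
  have hsrc : ∀ t ∈ U, (prolong E r c t).base ∈ e.source := fun t ht => by
    rw [base_prolong]; exact (hUs t ht).1
  have h2 : prolong E r c =ᶠ[𝓝 t] fun t => jetOfCoord e (g t) := by
    filter_upwards [hU.mem_nhds hU0] with s hs
    rw [← h1 s hs, jetOfCoord_jetCoord he (hsrc s hs)]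
  have h3 : MDifferentiableAt 𝓘(ℝ, ℝ) 𝓘(ℝ, Fin (r + 1) → E) (prolong E r c) t := by
    have h4 : ContMDiffAt 𝓘(ℝ, ℝ) 𝓘(ℝ, Fin (r + 1) → E) ∞
        (fun t => (jetOfCoord e (g t) : Jet E Q r)) t := by
      have h5 : g t 0 ∈ e.target := by
        rw [← h1 t hU0]; exact jetCoord_zero_mem (hsrc t hU0)
      exact ContMDiffAt.comp (f := g) t (contMDiffAt_jetOfCoord he h5)
        (contMDiffAt_iff_contDiffAt.2 (hg.contDiffAt (hU.mem_nhds hU0)))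
    exact (h4.congr_of_eventuallyEq h2).mdifferentiableAt (by simp)
  refine (vderiv_comp_mfderiv (mdifferentiableAt_jetCoord he (hsrc t hU0)) h3 _).trans ?_
  have h5 : (fun t => jetCoord e (prolong E r c t)) =ᶠ[𝓝 t] g := by
    filter_upwards [hU.mem_nhds hU0] with s hs using h1 s hs
  have h6 : HasDerivAt g (fun i : Fin (r + 1) => iteratedDeriv ((i : ℕ) + 1) (e ∘ c) t) t :=
    hasDerivAt_pi.2 fun i => hasDerivAt_iteratedDeriv hU hf i hU0
  rw [vderiv_congr h5, vderiv, mfderiv_eq_fderiv]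
  exact h6.deriv

theorem vderiv_jetVelocity (he : e ∈ atlas E Q) {r s : ℕ} (h : r < s) {p : Jet E Q s}
    (hp : p.base ∈ e.source) :
    vderiv 𝓘(ℝ, Fin (r + 1) → E) (jetCoord e) (jetProj h.le p) (jetVelocity h.le p) =
      fun i : Fin (r + 1) => jetCoord e p ⟨(i : ℕ) + 1, by omega⟩ := by
  have h1 := vderiv_prolong (r := r) he p.rep.2 (show p.rep.1 0 ∈ e.source from hp)
  -- `jetVelocity` is a vector at `jetProj h.le p`, which equals the initial point of the lift but
  -- not by definition; a variable `q` allows the base point to be replaced.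
  have h2 : ∀ (q : Jet E Q r) (hq : prolong E r p.rep.1 0 = q) (w : Fin (r + 1) → E),
      vderiv 𝓘(ℝ, Fin (r + 1) → E) (jetCoord e) q w =
        vderiv 𝓘(ℝ, Fin (r + 1) → E) (jetCoord e) (prolong E r p.rep.1 0) w := by
    rintro q rfl w; rfl
  exact (h2 _ (prolong_rep_zero h.le p) _).trans h1

/-- The natural coordinates of a point of `T^r Q × ℝ`. -/
def extCoord (e : OpenPartialHomeomorph Q E) {r : ℕ} (x : Ext E Q r) : JetModel E r :=
  (jetCoord e x.1, x.2)

theorem isOpen_extSource (r : ℕ) (he : e ∈ atlas E Q) :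
    IsOpen {x : Ext E Q r | x.1.base ∈ e.source} :=
  (isOpen_jetSource r he).preimage continuous_fst

theorem extCoord_mem {r : ℕ} {x : Ext E Q r} (hx : x.1.base ∈ e.source) :
    extCoord e x ∈ modelDom e.target r := jetCoord_zero_mem hx

theorem contMDiffAt_extCoord (he : e ∈ atlas E Q) {r : ℕ} {x : Ext E Q r}
    (hx : x.1.base ∈ e.source) :
    ContMDiffAt (IExt E r) 𝓘(ℝ, JetModel E r) ∞ (extCoord e) x :=
  ((contMDiffAt_jetCoord he hx).comp x contMDiffAt_fst).prodMk_space contMDiffAt_snd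

theorem mdifferentiableAt_extCoord (he : e ∈ atlas E Q) {r : ℕ} {x : Ext E Q r}
    (hx : x.1.base ∈ e.source) :
    MDifferentiableAt (IExt E r) 𝓘(ℝ, JetModel E r) (extCoord e) x :=
  (contMDiffAt_extCoord he hx).mdifferentiableAt (by simp)

theorem vderiv_extCoord (he : e ∈ atlas E Q) {r : ℕ} {x : Ext E Q r}
    (hx : x.1.base ∈ e.source) (u : TangentSpace (IExt E r) x) :
    vderiv (IExt E r) (extCoord e) x u =
      (vderiv 𝓘(ℝ, Fin (r + 1) → E) (jetCoord e) x.1 u.1, u.2) := by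
  have h1 : MDifferentiableAt (IExt E r) 𝓘(ℝ, Fin (r + 1) → E)
      (fun x : Ext E Q r => jetCoord e x.1) x :=
    ((contMDiffAt_jetCoord he hx).comp x contMDiffAt_fst).mdifferentiableAt (by simp)
  have h2 : MDifferentiableAt (IExt E r) 𝓘(ℝ, ℝ) (fun x : Ext E Q r => x.2) x :=
    mdifferentiableAt_snd
  refine (vderiv_prodMk h1 h2 u).trans ?_
  have h3 := vderiv_comp_mfderiv (J := IExt E r) (f := (Prod.fst : Ext E Q r → Jet E Q r)) (x := x)
    (mdifferentiableAt_jetCoord he hx) mdifferentiableAt_fst u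
  rw [mfderiv_fst] at h3
  have h4 : vderiv (IExt E r) (fun x : Ext E Q r => x.2) x u = u.2 := by
    unfold vderiv
    exact congrArg (fun A => A u) (mfderiv_snd (I := 𝓘(ℝ, Fin (r + 1) → E)) (I' := 𝓘(ℝ, ℝ)) (x := x))
  exact Prod.ext h3.symm h4

theorem vderiv_extCoord_bijective (he : e ∈ atlas E Q) {r : ℕ} {x : Ext E Q r}
    (hx : x.1.base ∈ e.source) :
    Function.Bijective (vderiv (IExt E r) (extCoord e) x) := by
  obtain ⟨h1, h2⟩ := vderiv_jetCoord_bijective he hx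
  constructor
  · intro u v huv
    rw [vderiv_extCoord he hx, vderiv_extCoord he hx] at huv
    obtain ⟨h3, h4⟩ := Prod.ext_iff.1 huv
    exact Prod.ext (h1 h3) h4
  · rintro ⟨a, b⟩
    obtain ⟨a', rfl⟩ := h2 a
    exact ⟨(a', b), vderiv_extCoord he hx _⟩

/-- The point of `T^r Q × ℝ` with given natural coordinates. -/
def extOfCoord (e : OpenPartialHomeomorph Q E) {r : ℕ} (y : JetModel E r) : Ext E Q r :=
  (jetOfCoord e y.1, y.2)

theorem extOfCoord_extCoord (he : e ∈ atlas E Q) {r : ℕ} {x : Ext E Q r}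
    (hx : x.1.base ∈ e.source) : extOfCoord e (extCoord e x) = x :=
  Prod.ext (jetOfCoord_jetCoord he hx) rfl

theorem extCoord_extOfCoord (he : e ∈ atlas E Q) {r : ℕ} {y : JetModel E r}
    (hy : y ∈ modelDom e.target r) : extCoord e (extOfCoord e y : Ext E Q r) = y :=
  Prod.ext (jetCoord_jetOfCoord_self he hy) rfl

theorem base_extOfCoord {r : ℕ} {y : JetModel E r} (hy : y ∈ modelDom e.target r) :
    (extOfCoord e y : Ext E Q r).1.base ∈ e.source := by
  rw [extOfCoord, base_jetOfCoord]; exact e.map_target hy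

theorem contMDiffAt_extOfCoord (he : e ∈ atlas E Q) {r : ℕ} {y : JetModel E r}
    (hy : y ∈ modelDom e.target r) :
    ContMDiffAt 𝓘(ℝ, JetModel E r) (IExt E r) ∞ (extOfCoord e : JetModel E r → Ext E Q r) y :=
  ((contMDiffAt_jetOfCoord he hy).comp y contDiffAt_fst.contMDiffAt).prodMk
    contDiffAt_snd.contMDiffAt

theorem extCoord_extProj (he : e ∈ atlas E Q) {r s : ℕ} (h : r ≤ s) {x : Ext E Q s}
    (hx : x.1.base ∈ e.source) : extCoord e (extProj h x) = modelProj E h (extCoord e x) :=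
  Prod.ext (funext fun i => jetCoord_jetProj he h x.1 hx i) rfl

theorem base_extProj {r s : ℕ} (h : r ≤ s) (x : Ext E Q s) :
    (extProj h x).1.base = x.1.base := base_jetProj h x.1

theorem contMDiff_extProj {r s : ℕ} (h : r ≤ s) :
    ContMDiff (IExt E s) (IExt E r) ∞ (extProj h : Ext E Q s → Ext E Q r) :=
  (contMDiff_jetProj h).prodMap contMDiff_id

theorem vderiv_extProj (he : e ∈ atlas E Q) {r s : ℕ} (h : r ≤ s) {x : Ext E Q s}
    (hx : x.1.base ∈ e.source) (u : TangentSpace (IExt E s) x) :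
    vderiv (IExt E r) (extCoord e) (extProj h x)
      (mfderiv (IExt E s) (IExt E r) (extProj h) x u) =
    modelProj E h (vderiv (IExt E s) (extCoord e) x u) := by
  rw [vderiv_comp_mfderiv (mdifferentiableAt_extCoord he (by rwa [base_extProj]))
    ((contMDiff_extProj h).mdifferentiable (by simp) x)]
  have h1 : (fun x : Ext E Q s => extCoord e (extProj h x)) =ᶠ[𝓝 x]
      fun x => modelProj E h (extCoord e x) := by
    filter_upwards [(isOpen_extSource s he).mem_nhds hx] with z hz using extCoord_extProj he h hz
  rw [vderiv_congr h1, vderiv_comp (modelProj E h).differentiableAt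
    (mdifferentiableAt_extCoord he hx), (modelProj E h).fderiv]

/-- `vertEndo` is defined through the preferred chart at each point. Commutation of the shifts with
linearized transition maps gives it the same expression in any natural chart, on the whole domain of
that chart. -/
theorem vderiv_vertEndo (he : e ∈ atlas E Q) {k : ℕ} (b : ℕ) {x : Ext E Q k}
    (hx : x.1.base ∈ e.source) (u : TangentSpace (IExt E k) x) :
    vderiv (IExt E k) (extCoord e) x (vertEndo b x u) =
      ((vertShift (E := E) k b).prodMap (0 : ℝ →L[ℝ] ℝ))
        (vderiv (IExt E k) (extCoord e) x u) := by
  rw [vderiv_extCoord he hx, vderiv_extCoord he hx]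
  set e₀ := chartAt E x.1.base with he₀_def
  have he₀ : e₀ ∈ atlas E Q := chart_mem_atlas E _
  have hx₀ : x.1.base ∈ e₀.source := mem_chart_source E _
  set y₀ := jetCoord e₀ x.1 with hy₀
  let g : (Fin (k + 1) → E) → (Fin (k + 1) → E) := fun y i =>
    iteratedDeriv i ((e ∘ e₀.symm) ∘ taylorCurve y) 0
  have hO := isOpen_transition e₀ e
  have hy0 : y₀ 0 ∈ e₀.target ∩ e₀.symm ⁻¹' e.source := by
    refine ⟨jetCoord_zero_mem hx₀, ?_⟩
    rw [hy₀, jetCoord_zero, mem_preimage, e₀.left_inv hx₀]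
    exact hx
  have hg : (fun y => jetCoord e (jetOfCoord e₀ y : Jet E Q k)) =ᶠ[𝓝 y₀] g := by
    filter_upwards [(hO.preimage (continuous_apply 0)).mem_nhds hy0] with y hy
    exact funext fun i => jetCoord_jetOfCoord he₀ he hy.1 hy.2 i
  have h1 : ∀ w : Fin (k + 1) → E,
      vderiv 𝓘(ℝ, Fin (k + 1) → E) (jetCoord e) x.1 w = fderiv ℝ g y₀ w := by
    intro w
    rw [← hg.fderiv_eq, vderiv, (mdifferentiableAt_jetCoord he hx).mfderiv]
    simp only [writtenInExtChartAt, modelWithCornersSelf_coe, range_id, fderivWithin_univ]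
    rfl
  have h2 := fderiv_iteratedDeriv_vertShift hO (contDiffOn_transition he₀ he) b hy0
    (u.1 : Fin (k + 1) → E)
  refine Prod.ext ?_ rfl
  refine (h1 _).trans (h2.trans ?_)
  exact congrArg (vertShift k b) (h1 _).symm

end NaturalCoordinates

/-! ### Coordinate expressions of the Lagrangian derivative, the Cartan form and the Legendre map -/

section LocalForms

variable {E : Type*} [NormedAddCommGroup E] [NormedSpace ℝ E]
  {Q : Type*} [TopologicalSpace Q] [ChartedSpace E Q] [IsManifold 𝓘(ℝ, E) ∞ Q]
  {e : OpenPartialHomeomorph Q E} {k : ℕ} {L : Ext E Q k → ℝ}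

/-- The local expression of a function in natural coordinates. -/
def localLag (e : OpenPartialHomeomorph Q E) (L : Ext E Q k → ℝ) (y : JetModel E k) : ℝ :=
  L (extOfCoord e y)

theorem contDiffOn_localLag (he : e ∈ atlas E Q) (hL : ContMDiff (IExt E k) 𝓘(ℝ, ℝ) ∞ L) :
    ContDiffOn ℝ ∞ (localLag e L) (modelDom e.target k) := fun y hy => by
  refine ContDiffAt.contDiffWithinAt ?_
  rw [← contMDiffAt_iff_contDiffAt]
  exact hL.contMDiffAt.comp y (contMDiffAt_extOfCoord he hy)

theorem localLag_extCoord (he : e ∈ atlas E Q) {x : Ext E Q k} (hx : x.1.base ∈ e.source) :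
    localLag e L (extCoord e x) = L x := by
  rw [localLag, extOfCoord_extCoord he hx]

theorem dFun_eq_of_local (he : e ∈ atlas E Q) {r : ℕ} {f : Ext E Q r → ℝ} {g : JetModel E r → ℝ}
    (hg : ContDiffOn ℝ ∞ g (modelDom e.target r))
    (hfg : ∀ x : Ext E Q r, x.1.base ∈ e.source → f x = g (extCoord e x)) {x : Ext E Q r}
    (hx : x.1.base ∈ e.source) (u : TangentSpace (IExt E r) x) :
    dFun (I := IExt E r) f x u =
      fderiv ℝ g (extCoord e x) (vderiv (IExt E r) (extCoord e) x u) := by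
  have h1 : f =ᶠ[𝓝 x] fun x => g (extCoord e x) := by
    filter_upwards [(isOpen_extSource r he).mem_nhds hx] with z hz using hfg z hz
  have h2 : dFun (I := IExt E r) f x u = vderiv (IExt E r) f x u := rfl
  rw [h2, vderiv_congr h1, vderiv_comp _ (mdifferentiableAt_extCoord he hx)]
  exact (hg.contDiffAt ((isOpen_modelDom e.open_target r).mem_nhds
    (extCoord_mem hx))).differentiableAt (by simp)

/-- The `1`-form `ζ` is the pull-back of `ρ` by the natural coordinates. -/
def HasLocalForm (e : OpenPartialHomeomorph Q E) {r : ℕ} (ζ : OneForm (IExt E r) (Ext E Q r))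
    (ρ : JetModel E r → JetModel E r →L[ℝ] ℝ) : Prop :=
  ∀ x : Ext E Q r, x.1.base ∈ e.source → ∀ u,
    ζ x u = ρ (extCoord e x) (vderiv (IExt E r) (extCoord e) x u)

theorem hasLocalForm_vertDiffLag (he : e ∈ atlas E Q) (hL : ContMDiff (IExt E k) 𝓘(ℝ, ℝ) ∞ L)
    (b : ℕ) : HasLocalForm e (vertDiffLag L b) (modelForm (localLag e L) b 0) := by
  intro x hx u
  have h1 : vertDiffLag L b x u = dFun (I := IExt E k) L x (vertEndo b x u) := rfl
  rw [h1, dFun_eq_of_local he (contDiffOn_localLag he hL)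
    (fun x hx => (localLag_extCoord he hx).symm) hx, vderiv_vertEndo he b hx]
  rfl

theorem vderiv_totalVec (he : e ∈ atlas E Q) {r : ℕ} (h : k ≤ r) {x : Ext E Q (r + 1)}
    (hx : x.1.base ∈ e.source) :
    vderiv (IExt E r) (extCoord e) (extProj (Nat.le_succ r) x) (totalVec L h x) =
      modelTotalVec (localLag e L) h (extCoord e x) := by
  rw [vderiv_extCoord he (by rwa [base_extProj])]
  have h1 := vderiv_jetVelocity he (Nat.lt_succ_self r) hx
  refine Prod.ext (h1.trans (funext fun i => ?_)) ?_
  · have h2 : (modelTotalVec (localLag e L) h (extCoord e x)).1 i =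
        modelCoord E (r + 1) ((i : ℕ) + 1) (extCoord e x) := rfl
    rw [h2, modelCoord_of_lt (by omega)]
    rfl
  · have h2 : (modelTotalVec (localLag e L) h (extCoord e x)).2 =
        localLag e L (modelProj E (h.trans (Nat.le_succ r)) (extCoord e x)) := rfl
    rw [h2, ← extCoord_extProj he _ hx, localLag_extCoord he (by rwa [base_extProj])]
    rfl

theorem dzLag_eq (he : e ∈ atlas E Q) (hL : ContMDiff (IExt E k) 𝓘(ℝ, ℝ) ∞ L)
    {x : Ext E Q k} (hx : x.1.base ∈ e.source) :
    dzLag L x = modelDz (localLag e L) (extCoord e x) := by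
  have h1 : (fun t => L (x.1, t)) = fun t => localLag e L (jetCoord e x.1, t) := by
    funext t
    exact (localLag_extCoord (x := (x.1, t)) he hx).symm
  have h2 : HasFDerivAt (localLag e L) (fderiv ℝ (localLag e L) (jetCoord e x.1, x.2))
      (jetCoord e x.1, x.2) :=
    (((contDiffOn_localLag he hL).contDiffAt ((isOpen_modelDom e.open_target k).mem_nhds
      (extCoord_mem hx))).differentiableAt (by simp)).hasFDerivAt
  have h3 : HasDerivAt (fun t : ℝ => (jetCoord e x.1, t)) ((0 : Fin (k + 1) → E), (1 : ℝ)) x.2 :=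
    (hasDerivAt_const x.2 _).prodMk (hasDerivAt_id x.2)
  rw [dzLag, h1]
  exact (h2.comp_hasDerivAt x.2 h3).deriv

/-- Every ingredient of Cartan's formula is compatible with pull-back by natural coordinates;
together they give the Cartan-formula version of `modelTotal`. -/
theorem hasLocalForm_lagTotalDeriv (he : e ∈ atlas E Q)
    (hL : ContMDiff (IExt E k) 𝓘(ℝ, ℝ) ∞ L) {r : ℕ} (h : k ≤ r)
    {ξ : OneForm (IExt E r) (Ext E Q r)} {ρ : JetModel E r → JetModel E r →L[ℝ] ℝ}
    (hρ : ContDiffOn ℝ ∞ ρ (modelDom e.target r)) (hξ : HasLocalForm e ξ ρ) :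
    HasLocalForm e (lagTotalDeriv L h ξ) (modelTotal (localLag e L) h ρ) := by
  intro x hx u
  have hl := contDiffOn_localLag he hL
  have hpx : (extProj (Nat.le_succ r) x).1.base ∈ e.source := by rwa [base_extProj]
  have h1 : lagTotalDeriv L h ξ x u =
      contrD ξ (extProj (Nat.le_succ r) x) (totalVec L h x)
        (mfderiv (IExt E (r + 1)) (IExt E r) (extProj (Nat.le_succ r)) x u) +
      dFun (I := IExt E (r + 1)) (fun y : Ext E Q (r + 1) =>
        ξ (extProj (Nat.le_succ r) y) (totalVec L h y)) x u -
      dzLag L (extProj (h.trans (Nat.le_succ r)) x) * ξ (extProj (Nat.le_succ r) x)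
        (mfderiv (IExt E (r + 1)) (IExt E r) (extProj (Nat.le_succ r)) x u) := rfl
  have hev : ∀ᶠ x' in 𝓝 (extProj (Nat.le_succ r) x), ∀ u,
      ξ x' u = ρ (extCoord e x') (vderiv (IExt E r) (extCoord e) x' u) := by
    filter_upwards [(isOpen_extSource r he).mem_nhds hpx] with z hz using hξ z hz
  have hρd : DifferentiableAt ℝ ρ (extCoord e (extProj (Nat.le_succ r) x)) :=
    (hρ.contDiffAt ((isOpen_modelDom e.open_target r).mem_nhds
      (extCoord_mem hpx))).differentiableAt (by simp)
  have hg : ContDiffOn ℝ ∞ (fun y => ρ (modelProj E (Nat.le_succ r) y)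
      (modelTotalVec (localLag e L) h y)) (modelDom e.target (r + 1)) :=
    (contDiffOn_comp_modelProj (Nat.le_succ r) hρ).clm_apply (contDiffOn_modelTotalVec hl h)
  have hfg : ∀ z : Ext E Q (r + 1), z.1.base ∈ e.source →
      ξ (extProj (Nat.le_succ r) z) (totalVec L h z) =
        ρ (modelProj E (Nat.le_succ r) (extCoord e z))
          (modelTotalVec (localLag e L) h (extCoord e z)) := fun z hz => by
    rw [hξ _ (by rwa [base_extProj]), vderiv_totalVec he h hz, extCoord_extProj he _ hz]
  rw [h1, contrD_eq_of_pull (contMDiffAt_extCoord he hpx) hρd hev, hξ _ hpx,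
    dFun_eq_of_local he hg hfg hx, dzLag_eq he hL (by rwa [base_extProj]),
    vderiv_totalVec he h hx, vderiv_extProj he _ hx, extCoord_extProj he _ hx,
    extCoord_extProj he _ hx,
    modelTotal_apply e.open_target hl h hρ (extCoord_mem hx)]

theorem hasLocalForm_lagTotalDerivIter (he : e ∈ atlas E Q)
    (hL : ContMDiff (IExt E k) 𝓘(ℝ, ℝ) ∞ L) (b m : ℕ) :
    HasLocalForm e (lagTotalDerivIter L (vertDiffLag L b) m)
      (modelForm (localLag e L) b m) := by
  induction m with
  | zero => exact hasLocalForm_vertDiffLag he hL b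
  | succ m ih =>
    exact hasLocalForm_lagTotalDeriv he hL _
      (contDiffOn_modelForm e.open_target (contDiffOn_localLag he hL) b m) ih

theorem cartanForm_eq (he : e ∈ atlas E Q) (hL : ContMDiff (IExt E k) 𝓘(ℝ, ℝ) ∞ L)
    (hs : k ≤ 2 * k - 1) {x : Ext E Q (2 * k - 1)} (hx : x.1.base ∈ e.source)
    (u : TangentSpace (IExt E (2 * k - 1)) x) :
    cartanForm L x u = ∑ a ∈ Finset.range k,
      (momenta e.open_target (contDiffOn_localLag he hL) hs a).1 (extCoord e x)
        (modelCoord E (2 * k - 1) a (vderiv (IExt E (2 * k - 1)) (extCoord e) x u)) := by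
  have h : ∀ b < k, k + b ≤ 2 * k - 1 := fun b hb => by omega
  rw [← sum_modelForm e.open_target (contDiffOn_localLag he hL) hs h (extCoord_mem hx)]
  have h1 : cartanForm L x u = ∑ b : Fin k, ((-1 : ℝ) ^ (b : ℕ) / (((b : ℕ) + 1)! : ℝ)) *
      lagTotalDerivIter L (vertDiffLag L ((b : ℕ) + 1)) b (extProj (h b b.2) x)
        (mfderiv (IExt E (2 * k - 1)) (IExt E (k + (b : ℕ))) (extProj (h b b.2)) x u) := by
    rw [cartanForm, sum_apply]
    rfl
  rw [h1]
  refine Finset.sum_congr rfl fun b _ => ?_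
  rw [hasLocalForm_lagTotalDerivIter he hL _ _ _ (by rwa [base_extProj]),
    vderiv_extProj he _ hx, extCoord_extProj he _ hx]

/-- The local expression of the Legendre map. -/
def modelLeg {l : JetModel E k → ℝ} {O : Set E} (hO : IsOpen O)
    (hl : ContDiffOn ℝ ∞ l (modelDom O k)) {s : ℕ} (h : k ≤ s) (y : JetModel E s) :
    (Fin (k - 1 + 1) → E) →L[ℝ] ℝ :=
  ∑ i : Fin (k - 1 + 1), ((momenta hO hl h i).1 y).comp
    (ContinuousLinearMap.proj i : (Fin (k - 1 + 1) → E) →L[ℝ] E)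

theorem modelLeg_apply {l : JetModel E k → ℝ} {O : Set E} (hO : IsOpen O)
    (hl : ContDiffOn ℝ ∞ l (modelDom O k)) {s : ℕ} (h : k ≤ s) (y : JetModel E s)
    (v : Fin (k - 1 + 1) → E) :
    modelLeg hO hl h y v = ∑ i : Fin (k - 1 + 1), (momenta hO hl h i).1 y (v i) := by
  rw [modelLeg, sum_apply]
  rfl

theorem contDiffOn_modelLeg {l : JetModel E k → ℝ} {O : Set E} (hO : IsOpen O)
    (hl : ContDiffOn ℝ ∞ l (modelDom O k)) {s : ℕ} (h : k ≤ s) :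
    ContDiffOn ℝ ∞ (modelLeg hO hl h) (modelDom O s) :=
  ContDiffOn.sum fun i _ => ((momenta hO hl h i).2.1).clm_comp contDiffOn_const

/-- The Cartan form involves only `dq_a` with `a < k`, so it factors through the projection to
`T^(k-1) Q`. The factor is unique because the projection is a submersion, hence it is the covector
picked by `Classical.epsilon`. -/
theorem legendreCovector_eq (hk : 1 ≤ k) (he : e ∈ atlas E Q)
    (hL : ContMDiff (IExt E k) 𝓘(ℝ, ℝ) ∞ L) (hs : k ≤ 2 * k - 1) {x : Ext E Q (2 * k - 1)}
    (hx : x.1.base ∈ e.source)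
    (v : TangentSpace 𝓘(ℝ, Fin (k - 1 + 1) → E)
      (jetProj (by omega : k - 1 ≤ 2 * k - 1) x.1)) :
    legendreCovector L x v = modelLeg e.open_target (contDiffOn_localLag he hL) hs (extCoord e x)
      (vderiv 𝓘(ℝ, Fin (k - 1 + 1) → E) (jetCoord e)
        (jetProj (by omega : k - 1 ≤ 2 * k - 1) x.1) v) := by
  have hle : k - 1 ≤ 2 * k - 1 := by omega
  have hpx : (jetProj hle x.1).base ∈ e.source := by rwa [base_jetProj]
  let P : Ext E Q (2 * k - 1) → Jet E Q (k - 1) := fun y => jetProj hle y.1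
  have hP : MDifferentiableAt (IExt E (2 * k - 1)) 𝓘(ℝ, Fin (k - 1 + 1) → E) P x :=
    ((contMDiff_jetProj hle).comp contMDiff_fst).mdifferentiable (by simp) x
  have hd : ∀ u : TangentSpace (IExt E (2 * k - 1)) x,
      vderiv 𝓘(ℝ, Fin (k - 1 + 1) → E) (jetCoord e) (P x)
        (mfderiv (IExt E (2 * k - 1)) 𝓘(ℝ, Fin (k - 1 + 1) → E) P x u) =
      fun i : Fin (k - 1 + 1) => modelCoord E (2 * k - 1) (i : ℕ)
        (vderiv (IExt E (2 * k - 1)) (extCoord e) x u) := by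
    intro u
    have h1 := mfderiv_comp (I := IExt E (2 * k - 1)) (f := fun y : Ext E Q (2 * k - 1) => y.1) x
      ((contMDiff_jetProj hle).mdifferentiable (by simp) x.1) mdifferentiableAt_fst
    have h2 : mfderiv (IExt E (2 * k - 1)) 𝓘(ℝ, Fin (k - 1 + 1) → E) P x u =
        mfderiv 𝓘(ℝ, Fin (2 * k - 1 + 1) → E) 𝓘(ℝ, Fin (k - 1 + 1) → E) (jetProj hle) x.1
          u.1 := by
      have h3 := congrArg (fun A => A u) h1
      rw [mfderiv_fst] at h3
      exact h3
    refine (congrArg _ h2).trans ((vderiv_jetProj he hle hx _).trans ?_)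
    funext i
    rw [vderiv_extCoord he hx, modelCoord_of_lt (by omega)]
    rfl
  have hC : ∀ u : TangentSpace (IExt E (2 * k - 1)) x, cartanForm L x u =
      modelLeg e.open_target (contDiffOn_localLag he hL) hs (extCoord e x)
        (vderiv 𝓘(ℝ, Fin (k - 1 + 1) → E) (jetCoord e) (P x)
          (mfderiv (IExt E (2 * k - 1)) 𝓘(ℝ, Fin (k - 1 + 1) → E) P x u)) := by
    intro u
    rw [cartanForm_eq he hL hs hx, modelLeg_apply, hd, Fin.sum_univ_eq_sum_range (fun a =>
      (momenta e.open_target (contDiffOn_localLag he hL) hs a).1 (extCoord e x)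
        (modelCoord E (2 * k - 1) a (vderiv (IExt E (2 * k - 1)) (extCoord e) x u))) (k - 1 + 1),
      Nat.sub_add_cancel hk]
  -- A preimage is obtained by filling the coordinates above `q_(k-1)` and the `z`-component with
  -- zeros.
  have hsurj : ∀ v : TangentSpace 𝓘(ℝ, Fin (k - 1 + 1) → E) (P x), ∃ u,
      mfderiv (IExt E (2 * k - 1)) 𝓘(ℝ, Fin (k - 1 + 1) → E) P x u = v := by
    intro v
    let w : Fin (k - 1 + 1) → E := vderiv 𝓘(ℝ, Fin (k - 1 + 1) → E) (jetCoord e) (P x) v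
    obtain ⟨u, hu⟩ := (vderiv_extCoord_bijective he hx).2
      (∑ i : Fin (k - 1 + 1), modelInj E (2 * k - 1) i (w i))
    refine ⟨u, (vderiv_jetCoord_bijective he hpx).1 ((hd u).trans (funext fun i => ?_))⟩
    rw [hu, map_sum, Finset.sum_eq_single i]
    · rw [modelCoord_modelInj (by omega), if_pos rfl]
    · intro j _ hj
      rw [modelCoord_modelInj (by omega), if_neg fun h => hj (Fin.ext h.symm)]
    · intro h
      exact absurd (Finset.mem_univ i) h
  have hex : ∃ ξ : TangentSpace 𝓘(ℝ, Fin (k - 1 + 1) → E) (jetProj hle x.1) →L[ℝ] ℝ,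
      ∀ u : TangentSpace (IExt E (2 * k - 1)) x, cartanForm L x u =
        ξ (mfderiv (IExt E (2 * k - 1)) 𝓘(ℝ, Fin (k - 1 + 1) → E)
          (fun y : Ext E Q (2 * k - 1) => jetProj hle y.1) x u) :=
    ⟨(modelLeg e.open_target (contDiffOn_localLag he hL) hs (extCoord e x)).comp
      (vderiv 𝓘(ℝ, Fin (k - 1 + 1) → E) (jetCoord e) (jetProj hle x.1)), hC⟩
  have hspec := Classical.epsilon_spec hex
  obtain ⟨u, rfl⟩ := hsurj v
  exact (hspec u).symm.trans (hC u)

end LocalForms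

/-! ### Contact Hamiltonian equations in a linear model -/

section ContactModel

variable {A B : Type*} [NormedAddCommGroup A] [NormedSpace ℝ A] [NormedAddCommGroup B]
  [NormedSpace ℝ B]

/-- The exterior derivative of the pull-back of the `1`-form `m ↦ ζ - P m ∘ R`. -/
theorem contrD_eq_of_affine {W : Type*} [NormedAddCommGroup W] [NormedSpace ℝ W]
    {V : Type*} [NormedAddCommGroup V] [NormedSpace ℝ V] {H : Type*} [TopologicalSpace H]
    {I : ModelWithCorners ℝ V H} {M : Type*} [TopologicalSpace M] [ChartedSpace H M]
    [I.Boundaryless] [IsManifold I ∞ M] {Φ : M → W} {α : OneForm I M} {x : M}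
    (hΦ : ContMDiffAt I 𝓘(ℝ, W) ∞ Φ x) (ζ : W →L[ℝ] ℝ) (P : W →L[ℝ] (B →L[ℝ] ℝ)) (R : W →L[ℝ] B)
    (h : ∀ᶠ x' in 𝓝 x, ∀ u, α x' u = ζ (vderiv I Φ x' u) - P (Φ x') (R (vderiv I Φ x' u)))
    (u v : TangentSpace I x) :
    contrD α x u v = P (vderiv I Φ x v) (R (vderiv I Φ x u)) -
      P (vderiv I Φ x u) (R (vderiv I Φ x v)) := by
  let D : W →L[ℝ] W →L[ℝ] ℝ := ((ContinuousLinearMap.compL ℝ W B ℝ).flip R).comp P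
  have hD : HasFDerivAt (fun m => ζ - (P m).comp R) (-D) (Φ x) := D.hasFDerivAt.const_sub ζ
  rw [contrD_eq_of_pull hΦ hD.differentiableAt h u v, hD.fderiv]
  exact neg_sub_neg _ _

theorem dFun_eq_of_comp {W : Type*} [NormedAddCommGroup W] [NormedSpace ℝ W]
    {V : Type*} [NormedAddCommGroup V] [NormedSpace ℝ V] {H : Type*} [TopologicalSpace H]
    {I : ModelWithCorners ℝ V H} {M : Type*} [TopologicalSpace M] [ChartedSpace H M]
    {Φ : M → W} {g : M → ℝ} {x : M} (hΦ : MDifferentiableAt I 𝓘(ℝ, W) Φ x)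
    (P : W →L[ℝ] (B →L[ℝ] ℝ)) (S : W →L[ℝ] B) (τ : W →L[ℝ] A) {f : A → ℝ}
    (hf : DifferentiableAt ℝ f (τ (Φ x))) (h : g =ᶠ[𝓝 x] fun x => P (Φ x) (S (Φ x)) - f (τ (Φ x)))
    (u : TangentSpace I x) :
    dFun (I := I) g x u = P (vderiv I Φ x u) (S (Φ x)) + P (Φ x) (S (vderiv I Φ x u)) -
      fderiv ℝ f (τ (Φ x)) (τ (vderiv I Φ x u)) := by
  have h1 := (P.hasFDerivAt (x := Φ x)).clm_apply (S.hasFDerivAt (x := Φ x))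
  have h2 := h1.sub (hf.hasFDerivAt.comp (Φ x) τ.hasFDerivAt)
  have h3 : dFun (I := I) g x u = vderiv I g x u := rfl
  rw [h3, vderiv_congr h, vderiv_comp (g := fun m => P m (S m) - f (τ m)) h2.differentiableAt hΦ]
  refine (congrArg (fun D => D (vderiv I Φ x u)) h2.fderiv).trans ?_
  change P (Φ x) (S (vderiv I Φ x u)) + P (vderiv I Φ x u) (S (Φ x)) - _ = _
  rw [add_comm]
  rfl

/-- The contact Hamiltonian equations of the unified formalism, in coordinates. -/
theorem contactEquations_iff (T S : A →L[ℝ] B) (q : A) (p : B →L[ℝ] ℝ) (H c : ℝ)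
    (D : (A × ℝ) →L[ℝ] ℝ) (X : (A × (B →L[ℝ] ℝ)) × ℝ) (hH : H = p (S q) - c)
    (hsep : ∀ b : B, (∀ r : B →L[ℝ] ℝ, r b = 0) → b = 0) :
    ((∀ δ : (A × (B →L[ℝ] ℝ)) × ℝ, δ.1.2 (T X.1.1) - X.1.2 (T δ.1.1) =
        (δ.1.2 (S q) + p (S δ.1.1) - D (δ.1.1, δ.2)) + D (0, 1) * (δ.2 - p (T δ.1.1))) ∧
      X.2 - p (T X.1.1) = -H) ↔
    (T X.1.1 = S q ∧ (∀ a, X.1.2 (T a) = D (a, 0) + D (0, 1) * p (T a) - p (S a)) ∧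
      X.2 = c) := by
  have hD : ∀ a t, D (a, t) = D (a, 0) + t * D (0, 1) := fun a t => by
    have : ((a, t) : A × ℝ) = (a, 0) + t • (0, 1) := by simp
    rw [this, map_add, map_smul, smul_eq_mul]
  have hD0 : D (0, 0) = 0 := map_zero D
  constructor
  -- Testing on pure momentum variations gives the velocities, by separation of points; testing on
  -- position variations gives `ṗ`. The variation in `z` yields nothing new, since the Reeb term
  -- makes its two sides agree.
  · rintro ⟨h1, h2⟩
    have hT : T X.1.1 = S q := by
      refine sub_eq_zero.1 (hsep _ fun r => ?_)
      have h3 := h1 ((0, r), 0)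
      simp only [map_zero, hD0] at h3
      rw [map_sub]
      linarith
    refine ⟨hT, fun a => ?_, ?_⟩
    · have h3 := h1 ((a, 0), 0)
      simp only [zero_apply] at h3
      linarith
    · rw [hT] at h2
      linarith
  · rintro ⟨hT, h1, h2⟩
    refine ⟨fun δ => ?_, by rw [hT, h2, hH]; ring⟩
    rw [hT, h1, hD δ.1.1 δ.2]
    ring

end ContactModel

/-! ### Natural coordinates on the unified bundle -/

section UnifiedCoordinates

variable {E : Type*} [NormedAddCommGroup E] [NormedSpace ℝ E]
  {Q : Type*} [TopologicalSpace Q] [ChartedSpace E Q] [IsManifold 𝓘(ℝ, E) ∞ Q]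
  {k : ℕ}

instance : TopologicalSpace (Unified E Q k) := inferInstance

instance : ChartedSpace (ModelProd (ModelProd (Fin (2 * k - 1 + 1) → E)
    ((Fin (k - 1 + 1) → E) →L[ℝ] ℝ)) ℝ) (Unified E Q k) := inferInstance

/-- The natural trivialization of the cotangent bundle of `T^r Q`. -/
theorem cotangent_trivializationAt_apply {r : ℕ} {p₀ p : Jet E Q r}
    (hp : p.base ∈ (chartAt E p₀.base).source) (ξ : CotJet E Q r p)
    (v : TangentSpace 𝓘(ℝ, Fin (r + 1) → E) p) :
    (trivializationAt ((Fin (r + 1) → E) →L[ℝ] ℝ) (CotJet E Q r) p₀ ⟨p, ξ⟩).2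
      (vderiv 𝓘(ℝ, Fin (r + 1) → E) (jetCoord (chartAt E p₀.base)) p v) = ξ v := by
  have h1 : vderiv 𝓘(ℝ, Fin (r + 1) → E) (jetCoord (chartAt E p₀.base)) p v =
      (trivializationAt (Fin (r + 1) → E) (TangentSpace 𝓘(ℝ, Fin (r + 1) → E))
        p₀).continuousLinearMapAt ℝ p v := by
    rw [TangentBundle.continuousLinearMapAt_trivializationAt
      (show p ∈ (chartAt (Fin (r + 1) → E) p₀).source from hp)]
    rfl
  rw [h1, hom_trivializationAt_apply]
  have h2 : p ∈ (trivializationAt (Fin (r + 1) → E) (TangentSpace 𝓘(ℝ, Fin (r + 1) → E))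
      p₀).baseSet := by
    rw [TangentBundle.trivializationAt_baseSet]; exact hp
  have h3 := (trivializationAt (Fin (r + 1) → E) (TangentSpace 𝓘(ℝ, Fin (r + 1) → E))
      p₀).symmL_continuousLinearMapAt (R := ℝ) h2 v
  have h4 : (trivializationAt ℝ (Bundle.Trivial (Jet E Q r) ℝ) p₀).continuousLinearMapAt ℝ p =
      ContinuousLinearMap.id ℝ ℝ := Trivial.continuousLinearMapAt_trivialization ℝ _ ℝ p
  simp only [ContinuousLinearMap.inCoordinates, h4, ContinuousLinearMap.comp_apply]
  exact congrArg ξ h3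

variable (E) in
/-- The model space of the unified bundle: points `((q, p), z)`. -/
abbrev UnifiedModel (k : ℕ) : Type _ :=
  ((Fin (2 * k - 1 + 1) → E) × ((Fin (k - 1 + 1) → E) →L[ℝ] ℝ)) × ℝ

/-- The momentum coordinates on the unified bundle, in the natural trivialization at `p₀`. -/
def momentumCoord (p₀ : Jet E Q (2 * k - 1)) (w : Unified E Q k) : (Fin (k - 1 + 1) → E) →L[ℝ] ℝ :=
  (trivializationAt ((Fin (k - 1 + 1) → E) →L[ℝ] ℝ) (UnifiedFib E Q k) p₀ w.1).2

/-- The natural coordinates on the unified bundle around a fibre. -/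
def unifiedCoord (p₀ : Jet E Q (2 * k - 1)) (w : Unified E Q k) : UnifiedModel E k :=
  ((jetCoord (chartAt E p₀.base) w.1.1, momentumCoord p₀ w), w.2)

theorem extChartAt_unified (w₀ : Unified E Q k) :
    ⇑(extChartAt (IUnified E k) w₀) = unifiedCoord w₀.1.1 := by
  funext w
  simp only [extChartAt_prod, FiberBundle.extChartAt, PartialEquiv.prod_coe]
  rfl

theorem mem_chart_source_unified {w₀ w : Unified E Q k}
    (hw : w.1.1.base ∈ (chartAt E w₀.1.1.base).source) :
    w ∈ (extChartAt (IUnified E k) w₀).source := by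
  simp only [extChartAt_prod, FiberBundle.extChartAt]
  refine ⟨⟨?_, ?_, mem_univ _⟩, ?_⟩
  · refine (Bundle.Trivialization.mem_source _).2 ?_
    refine ⟨?_, mem_univ _⟩
    change (jetProj (by omega : k - 1 ≤ 2 * k - 1) w.1.1).base ∈ 
      (chartAt E (jetProj (by omega : k - 1 ≤ 2 * k - 1) w₀.1.1).base).source
    rw [base_jetProj, base_jetProj]
    exact hw
  · rw [extChartAt_source]
    exact hw
  · rw [extChartAt_source]
    exact mem_univ _

/-- The pulled-back trivialization at `p₀` is the cotangent one at the projection of `p₀`. Both jets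
have the same base point in `Q`, so position and momentum coordinates come from the same chart of
`Q`. -/
theorem momentum_eq {p₀ : Jet E Q (2 * k - 1)} {w : Unified E Q k}
    (hw : w.1.1.base ∈ (chartAt E p₀.base).source)
    (v : TangentSpace 𝓘(ℝ, Fin (k - 1 + 1) → E) (projBase w)) :
    momentum w v = momentumCoord p₀ w
      (vderiv 𝓘(ℝ, Fin (k - 1 + 1) → E) (jetCoord (chartAt E p₀.base)) (projBase w) v) := by
  have hk : k - 1 ≤ 2 * k - 1 := by omega
  have hw' : (projBase w).base ∈ (chartAt E (jetProj hk p₀).base).source := by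
    rw [projBase, base_jetProj, base_jetProj]; exact hw
  have h1 := cotangent_trivializationAt_apply hw' (momentum w) v
  rw [base_jetProj] at h1
  exact h1.symm

theorem momentumCoord_eq_iff {p₀ : Jet E Q (2 * k - 1)} {w : Unified E Q k}
    (hw : w.1.1.base ∈ (chartAt E p₀.base).source) {P : (Fin (k - 1 + 1) → E) →L[ℝ] ℝ}
    (h : ∀ v : TangentSpace 𝓘(ℝ, Fin (k - 1 + 1) → E) (projBase w), momentum w v =
      P (vderiv 𝓘(ℝ, Fin (k - 1 + 1) → E) (jetCoord (chartAt E p₀.base)) (projBase w) v)) :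
    momentumCoord p₀ w = P := by
  ext y
  obtain ⟨v, rfl⟩ := (vderiv_jetCoord_bijective (chart_mem_atlas E p₀.base)
    (p := projBase w) (by rw [projBase, base_jetProj]; exact hw)).2 y
  rw [← momentum_eq hw, h]

section Fixed
variable {p₀ : Jet E Q (2 * k - 1)} {w : Unified E Q k}

theorem contMDiffAt_unifiedCoord 
    (hw : w.1.1.base ∈ (chartAt E p₀.base).source) :
    ContMDiffAt (IUnified E k) 𝓘(ℝ, UnifiedModel E k) ∞ (unifiedCoord p₀) w := by
  -- The preferred chart of the bundle depends only on the jet `p₀`, so the zero covector and `z =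
  -- 0` serve as its centre.
  have h := contMDiffAt_extChartAt' (I := IUnified E k) (n := ∞)
    (x := ((⟨p₀, 0⟩, 0) : Unified E Q k)) (x' := w)
    (by rw [← extChartAt_source (IUnified E k)]; exact mem_chart_source_unified hw)
  rwa [extChartAt_unified] at h

theorem mdifferentiableAt_unifiedCoord 
    (hw : w.1.1.base ∈ (chartAt E p₀.base).source) :
    MDifferentiableAt (IUnified E k) 𝓘(ℝ, UnifiedModel E k) (unifiedCoord p₀) w :=
  (contMDiffAt_unifiedCoord hw).mdifferentiableAt (by simp)

theorem vderiv_unifiedCoord_bijective (hw : w.1.1.base ∈ (chartAt E p₀.base).source) :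
    Function.Bijective (vderiv (IUnified E k) (unifiedCoord p₀) w) := by
  have : IsManifold (IUnified E k) 1 (Unified E Q k) := IsManifold.of_le (n := ∞) (by simp)
  have h := isInvertible_mfderiv_extChartAt (I := IUnified E k)
    (x := ((⟨p₀, 0⟩, 0) : Unified E Q k)) (mem_chart_source_unified hw)
  rw [extChartAt_unified] at h
  exact h.bijective

theorem isOpen_unifiedSource {e : OpenPartialHomeomorph Q E} (he : e ∈ atlas E Q) :
    IsOpen {w : Unified E Q k | w.1.1.base ∈ e.source} :=
  (isOpen_jetSource _ he).preimage ((FiberBundle.continuous_proj _ _).comp continuous_fst)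

theorem continuous_unified_proj : Continuous fun w : Unified E Q k => w.1.1 :=
  (FiberBundle.continuous_proj _ _).comp continuous_fst

theorem unifiedSource_mem_nhds (hw : w.1.1.base ∈ (chartAt E p₀.base).source) :
    ∀ᶠ w' : Unified E Q k in 𝓝 w, w'.1.1.base ∈ (chartAt E p₀.base).source :=
  (isOpen_unifiedSource (chart_mem_atlas E p₀.base)).mem_nhds hw

/-- The restriction `(q_0, …, q_s) ↦ (q_0, …, q_r)`. -/
def coordRes (E : Type*) [NormedAddCommGroup E] [NormedSpace ℝ E] {r s : ℕ} (h : r ≤ s) :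
    (Fin (s + 1) → E) →L[ℝ] (Fin (r + 1) → E) :=
  ContinuousLinearMap.pi fun i => ContinuousLinearMap.proj (Fin.castLE (Nat.succ_le_succ h) i)

/-- The shift `(q_0, …, q_s) ↦ (q_1, …, q_(r + 1))`. -/
def coordShift (E : Type*) [NormedAddCommGroup E] [NormedSpace ℝ E] {r s : ℕ} (h : r < s) :
    (Fin (s + 1) → E) →L[ℝ] (Fin (r + 1) → E) :=
  ContinuousLinearMap.pi fun i => ContinuousLinearMap.proj ⟨(i : ℕ) + 1, by omega⟩

theorem contMDiffAt_projBase : ContMDiffAt (IUnified E k) 𝓘(ℝ, Fin (k - 1 + 1) → E) ∞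
    (projBase : Unified E Q k → Jet E Q (k - 1)) w :=
  (contMDiff_jetProj (by omega : k - 1 ≤ 2 * k - 1)).contMDiffAt.comp w
    ((contMDiffAt_proj (UnifiedFib E Q k)).comp w contMDiffAt_fst)

theorem vderiv_clm_unifiedCoord {W : Type*} [NormedAddCommGroup W] [NormedSpace ℝ W]
    (A : UnifiedModel E k →L[ℝ] W) (hw : w.1.1.base ∈ (chartAt E p₀.base).source)
    (u : TangentSpace (IUnified E k) w) :
    vderiv (IUnified E k) (fun w => A (unifiedCoord p₀ w)) w u =
      A (vderiv (IUnified E k) (unifiedCoord p₀) w u) := by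
  rw [vderiv_comp A.differentiableAt (mdifferentiableAt_unifiedCoord hw), A.fderiv]

theorem vderiv_projBase (hw : w.1.1.base ∈ (chartAt E p₀.base).source)
    (u : TangentSpace (IUnified E k) w) :
    vderiv 𝓘(ℝ, Fin (k - 1 + 1) → E) (jetCoord (chartAt E p₀.base)) (projBase w)
      (mfderiv (IUnified E k) 𝓘(ℝ, Fin (k - 1 + 1) → E) projBase w u) =
    coordRes E (by omega : k - 1 ≤ 2 * k - 1)
      (vderiv (IUnified E k) (unifiedCoord p₀) w u).1.1 := by
  have hk : k - 1 ≤ 2 * k - 1 := by omega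
  have he := chart_mem_atlas E p₀.base
  rw [vderiv_comp_mfderiv (mdifferentiableAt_jetCoord he (by rwa [projBase, base_jetProj]))
    (contMDiffAt_projBase.mdifferentiableAt (by simp))]
  let A : UnifiedModel E k →L[ℝ] (Fin (k - 1 + 1) → E) := (coordRes E hk).comp
    ((ContinuousLinearMap.fst ℝ _ _).comp (ContinuousLinearMap.fst ℝ _ _))
  have h1 : (fun w : Unified E Q k => jetCoord (chartAt E p₀.base) (projBase w)) =ᶠ[𝓝 w]
      fun w => A (unifiedCoord p₀ w) := by
    filter_upwards [unifiedSource_mem_nhds hw] with w' hw'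
    exact funext fun i => jetCoord_jetProj he hk w'.1.1 hw' i
  rw [vderiv_congr h1]
  exact vderiv_clm_unifiedCoord A hw u

theorem contMDiffAt_momentumCoord (hw : w.1.1.base ∈ (chartAt E p₀.base).source) :
    ContMDiffAt (IUnified E k) 𝓘(ℝ, (Fin (k - 1 + 1) → E) →L[ℝ] ℝ) ∞ (momentumCoord p₀) w := by
  let A : UnifiedModel E k →L[ℝ] ((Fin (k - 1 + 1) → E) →L[ℝ] ℝ) :=
    (ContinuousLinearMap.snd ℝ _ _).comp (ContinuousLinearMap.fst ℝ _ _)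
  exact ContMDiffAt.comp (g := A) w A.contDiff.contMDiff.contMDiffAt (contMDiffAt_unifiedCoord hw)

theorem mdifferentiableAt_rhoTwo : MDifferentiableAt (IUnified E k) (ICotExt E (k - 1))
    (rhoTwo : Unified E Q k → CotBundle E Q (k - 1) × ℝ) w := by
  have h2 : ContMDiffAt (IUnified E k) ((𝓘(ℝ, Fin (k - 1 + 1) → E)).prod
      𝓘(ℝ, (Fin (k - 1 + 1) → E) →L[ℝ] ℝ)) ∞
      (fun w : Unified E Q k => (⟨projBase w, momentum w⟩ : CotBundle E Q (k - 1))) w :=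
    contMDiffAt_totalSpace.2 ⟨contMDiffAt_projBase,
      contMDiffAt_momentumCoord (p₀ := w.1.1) (mem_chart_source E _)⟩
  exact (h2.prodMk contMDiffAt_snd).mdifferentiableAt (by simp)

/-- In coordinates the form is `dz - p dq`, where `q` stands for the first `k` positions selected by
`coordRes`; being affine in the momentum, it is covered by `contrD_eq_of_affine`. -/
theorem precontactForm_apply (hw : w.1.1.base ∈ (chartAt E p₀.base).source)
    (u : TangentSpace (IUnified E k) w) :
    precontactForm w u = (vderiv (IUnified E k) (unifiedCoord p₀) w u).2 -
      (unifiedCoord p₀ w).1.2 (coordRes E (by omega : k - 1 ≤ 2 * k - 1)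
        (vderiv (IUnified E k) (unifiedCoord p₀) w u).1.1) := by
  have h0 : precontactForm w u =
      vderiv (ICotExt E (k - 1)) (fun y : CotBundle E Q (k - 1) × ℝ => y.2) (rhoTwo w)
        (mfderiv (IUnified E k) (ICotExt E (k - 1)) rhoTwo w u) -
      momentum w (mfderiv (ICotExt E (k - 1)) 𝓘(ℝ, Fin (k - 1 + 1) → E)
          (fun y : CotBundle E Q (k - 1) × ℝ => y.1.1) (rhoTwo w)
        (mfderiv (IUnified E k) (ICotExt E (k - 1)) rhoTwo w u)) := rfl
  have h1 : vderiv (ICotExt E (k - 1)) (fun y : CotBundle E Q (k - 1) × ℝ => y.2) (rhoTwo w)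
      (mfderiv (IUnified E k) (ICotExt E (k - 1)) rhoTwo w u) =
      (vderiv (IUnified E k) (unifiedCoord p₀) w u).2 := by
    refine (vderiv_comp_mfderiv mdifferentiableAt_snd mdifferentiableAt_rhoTwo u).trans ?_
    exact vderiv_clm_unifiedCoord (ContinuousLinearMap.snd ℝ _ _) hw u
  have h3 : MDifferentiableAt (ICotExt E (k - 1)) 𝓘(ℝ, Fin (k - 1 + 1) → E)
      (fun y : CotBundle E Q (k - 1) × ℝ => y.1.1) (rhoTwo w) :=
    ((contMDiffAt_proj (CotJet E Q (k - 1))).comp (rhoTwo w)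
      contMDiffAt_fst).mdifferentiableAt (n := ∞) (by simp)
  have h2 : mfderiv (ICotExt E (k - 1)) 𝓘(ℝ, Fin (k - 1 + 1) → E)
        (fun y : CotBundle E Q (k - 1) × ℝ => y.1.1) (rhoTwo w)
      (mfderiv (IUnified E k) (ICotExt E (k - 1)) rhoTwo w u) =
      mfderiv (IUnified E k) 𝓘(ℝ, Fin (k - 1 + 1) → E) projBase w u :=
    congrArg (fun A => A u) (mfderiv_comp w h3 mdifferentiableAt_rhoTwo).symm
  rw [h0, h1]
  refine congrArg _ ((congrArg _ h2).trans ?_)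
  rw [momentum_eq hw, vderiv_projBase hw]
  rfl

theorem contrD_precontactForm (hw : w.1.1.base ∈ (chartAt E p₀.base).source)
    (u v : TangentSpace (IUnified E k) w) :
    contrD precontactForm w u v =
      (vderiv (IUnified E k) (unifiedCoord p₀) w v).1.2
        (coordRes E (by omega : k - 1 ≤ 2 * k - 1)
          (vderiv (IUnified E k) (unifiedCoord p₀) w u).1.1) -
      (vderiv (IUnified E k) (unifiedCoord p₀) w u).1.2
        (coordRes E (by omega : k - 1 ≤ 2 * k - 1)
          (vderiv (IUnified E k) (unifiedCoord p₀) w v).1.1) := by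
  let R : UnifiedModel E k →L[ℝ] (Fin (k - 1 + 1) → E) :=
    (coordRes E (by omega : k - 1 ≤ 2 * k - 1)).comp
      ((ContinuousLinearMap.fst ℝ _ _).comp (ContinuousLinearMap.fst ℝ _ _))
  let P : UnifiedModel E k →L[ℝ] ((Fin (k - 1 + 1) → E) →L[ℝ] ℝ) :=
    (ContinuousLinearMap.snd ℝ _ _).comp (ContinuousLinearMap.fst ℝ _ _)
  refine contrD_eq_of_affine (contMDiffAt_unifiedCoord hw) (ContinuousLinearMap.snd ℝ _ _) P R
    ?_ u v
  filter_upwards [unifiedSource_mem_nhds hw] with w' hw' u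
  exact precontactForm_apply hw' u

theorem coupling_eq (hk : 1 ≤ k) (hw : w.1.1.base ∈ (chartAt E p₀.base).source) :
    coupling w = (unifiedCoord p₀ w).1.2
      (coordShift E (by omega : k - 1 < 2 * k - 1) (unifiedCoord p₀ w).1.1) := by
  refine (momentum_eq hw _).trans ?_
  exact congrArg _ (vderiv_jetVelocity (chart_mem_atlas E p₀.base) (by omega) hw)

theorem vderiv_reebVec (hw : w.1.1.base ∈ (chartAt E p₀.base).source) :
    vderiv (IUnified E k) (unifiedCoord p₀) w (reebVec w) = ((0, 0), 1) := by
  have h1 : MDifferentiableAt 𝓘(ℝ, ℝ) (IUnified E k)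
      (fun t : ℝ => ((w.1, t) : Unified E Q k)) w.2 :=
    (contMDiffAt_const.prodMk contMDiffAt_id).mdifferentiableAt (n := ∞) (by simp)
  refine (vderiv_comp_mfderiv (f := fun t : ℝ => ((w.1, t) : Unified E Q k))
    (mdifferentiableAt_unifiedCoord hw) h1 _).trans ?_
  rw [vderiv, mfderiv_eq_fderiv]
  exact ((hasDerivAt_const w.2 (unifiedCoord p₀ w).1).prodMk (hasDerivAt_id w.2)).deriv

variable {L : Ext E Q k → ℝ}

theorem hamiltonian_eq (hk : 1 ≤ k) (hw : w.1.1.base ∈ (chartAt E p₀.base).source) :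
    hamiltonian L w = (unifiedCoord p₀ w).1.2
      (coordShift E (by omega : k - 1 < 2 * k - 1) (unifiedCoord p₀ w).1.1) -
      localLag (chartAt E p₀.base) L (modelProj E (by omega : k ≤ 2 * k - 1)
        ((unifiedCoord p₀ w).1.1, (unifiedCoord p₀ w).2)) := by
  have he := chart_mem_atlas E p₀.base
  have hks : k ≤ 2 * k - 1 := by omega
  have h1 := extCoord_extProj he hks (x := rhoOne w) hw
  have h2 := localLag_extCoord (L := L) he (x := extProj hks (rhoOne w))
    (by rw [base_extProj]; exact hw)
  rw [h1] at h2
  rw [hamiltonian, coupling_eq hk hw, ← h2]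
  rfl

theorem dFun_hamiltonian (hk : 1 ≤ k) (hL : ContMDiff (IExt E k) 𝓘(ℝ, ℝ) ∞ L)
    (hw : w.1.1.base ∈ (chartAt E p₀.base).source) (u : TangentSpace (IUnified E k) w) :
    dFun (I := IUnified E k) (hamiltonian L) w u =
      (vderiv (IUnified E k) (unifiedCoord p₀) w u).1.2
        (coordShift E (by omega : k - 1 < 2 * k - 1) (unifiedCoord p₀ w).1.1) +
      (unifiedCoord p₀ w).1.2 (coordShift E (by omega : k - 1 < 2 * k - 1)
        (vderiv (IUnified E k) (unifiedCoord p₀) w u).1.1) -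
      fderiv ℝ (localLag (chartAt E p₀.base) L) (modelProj E (by omega : k ≤ 2 * k - 1)
          ((unifiedCoord p₀ w).1.1, (unifiedCoord p₀ w).2))
        (modelProj E (by omega : k ≤ 2 * k - 1)
          ((vderiv (IUnified E k) (unifiedCoord p₀) w u).1.1,
            (vderiv (IUnified E k) (unifiedCoord p₀) w u).2)) := by
  let π₁ : UnifiedModel E k →L[ℝ] (Fin (2 * k - 1 + 1) → E) :=
    (ContinuousLinearMap.fst ℝ _ _).comp (ContinuousLinearMap.fst ℝ _ _)
  let P : UnifiedModel E k →L[ℝ] ((Fin (k - 1 + 1) → E) →L[ℝ] ℝ) :=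
    (ContinuousLinearMap.snd ℝ _ _).comp (ContinuousLinearMap.fst ℝ _ _)
  let τ : UnifiedModel E k →L[ℝ] JetModel E k := (modelProj E (by omega : k ≤ 2 * k - 1)).comp
    (π₁.prod (ContinuousLinearMap.snd ℝ _ _))
  refine dFun_eq_of_comp (mdifferentiableAt_unifiedCoord hw) P
    ((coordShift E (by omega : k - 1 < 2 * k - 1)).comp π₁) τ ?_ ?_ u
  · have he := chart_mem_atlas E p₀.base
    exact ((contDiffOn_localLag he hL).contDiffAt
      ((isOpen_modelDom (chartAt E p₀.base).open_target k).mem_nhds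
        (show τ (unifiedCoord p₀ w) ∈ modelDom (chartAt E p₀.base).target k from
          jetCoord_zero_mem hw))).differentiableAt (by simp)
  · filter_upwards [unifiedSource_mem_nhds hw] with w' hw'
    exact hamiltonian_eq hk hw'

end Fixed

end UnifiedCoordinates

/-! ### The unified equations on the graph of the Legendre map -/

section Equations

variable {E : Type*} [NormedAddCommGroup E] [NormedSpace ℝ E]
  {Q : Type*} [TopologicalSpace Q] [ChartedSpace E Q] [IsManifold 𝓘(ℝ, E) ∞ Q]
  {k : ℕ} {L : Ext E Q k → ℝ} {p₀ : Jet E Q (2 * k - 1)}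

theorem solvesAt_iff_unifiedCoord (hk : 1 ≤ k) (hL : ContMDiff (IExt E k) 𝓘(ℝ, ℝ) ∞ L)
    {w : Unified E Q k} (hw : w.1.1.base ∈ (chartAt E p₀.base).source)
    {q : Fin (2 * k - 1 + 1) → E} {p : (Fin (k - 1 + 1) → E) →L[ℝ] ℝ} {z : ℝ}
    (hm : unifiedCoord p₀ w = ((q, p), z)) (hks : k ≤ 2 * k - 1)
    (X : TangentSpace (IUnified E k) w) {ξ : UnifiedModel E k}
    (hξ : vderiv (IUnified E k) (unifiedCoord p₀) w X = ξ) :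
    SolvesAt L w X ↔
      (coordRes E (by omega : k - 1 ≤ 2 * k - 1) ξ.1.1 =
          coordShift E (by omega : k - 1 < 2 * k - 1) q ∧
        (∀ a, ξ.1.2 (coordRes E (by omega : k - 1 ≤ 2 * k - 1) a) =
          fderiv ℝ (localLag (chartAt E p₀.base) L) (modelProj E hks (q, z))
            (modelProj E hks (a, 0)) +
          modelDz (localLag (chartAt E p₀.base) L) (modelProj E hks (q, z)) *
            p (coordRes E (by omega : k - 1 ≤ 2 * k - 1) a) -
          p (coordShift E (by omega : k - 1 < 2 * k - 1) a)) ∧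
        ξ.2 = localLag (chartAt E p₀.base) L (modelProj E hks (q, z))) := by
  let D : JetModel E (2 * k - 1) →L[ℝ] ℝ := (fderiv ℝ (localLag (chartAt E p₀.base) L)
    (modelProj E hks (q, z))).comp (modelProj E hks)
  have hH : hamiltonian L w = _ := hamiltonian_eq hk hw
  have hbij := vderiv_unifiedCoord_bijective hw
  have key := contactEquations_iff (coordRes E (by omega : k - 1 ≤ 2 * k - 1))
    (coordShift E (by omega : k - 1 < 2 * k - 1)) q p (hamiltonian L w)
    (localLag (chartAt E p₀.base) L (modelProj E hks (q, z))) D ξ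
    (by rw [hH, hm]) (fun b hb => SeparatingDual.eq_zero_of_forall_dual_eq_zero (R := ℝ) hb)
  refine Iff.trans ?_ key
  unfold SolvesAt
  -- The coupling does not depend on `z`, so `R (H) = - ∂L/∂z`.
  have hR : dFun (I := IUnified E k) (hamiltonian L) w (reebVec w) = - D (0, 1) := by
    rw [dFun_hamiltonian hk hL hw, vderiv_reebVec hw, hm]
    simp only [zero_apply, map_zero, add_zero, zero_sub]
    rfl
  refine and_congr ?_ ?_
  · rw [hR, ContinuousLinearMap.ext_iff]
    have h1 : ∀ v : TangentSpace (IUnified E k) w, (contrD precontactForm w X v =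
        (dFun (I := IUnified E k) (hamiltonian L) w - (-D (0, 1)) • precontactForm w) v) ↔
        (vderiv (IUnified E k) (unifiedCoord p₀) w v).1.2
          (coordRes E (by omega : k - 1 ≤ 2 * k - 1) ξ.1.1) -
        ξ.1.2 (coordRes E (by omega : k - 1 ≤ 2 * k - 1)
          (vderiv (IUnified E k) (unifiedCoord p₀) w v).1.1) =
        ((vderiv (IUnified E k) (unifiedCoord p₀) w v).1.2
          (coordShift E (by omega : k - 1 < 2 * k - 1) q) +
          p (coordShift E (by omega : k - 1 < 2 * k - 1)
            (vderiv (IUnified E k) (unifiedCoord p₀) w v).1.1) -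
          D ((vderiv (IUnified E k) (unifiedCoord p₀) w v).1.1,
            (vderiv (IUnified E k) (unifiedCoord p₀) w v).2)) +
        D (0, 1) * ((vderiv (IUnified E k) (unifiedCoord p₀) w v).2 -
          p (coordRes E (by omega : k - 1 ≤ 2 * k - 1)
            (vderiv (IUnified E k) (unifiedCoord p₀) w v).1.1)) := by
      intro v
      have h2 : (dFun (I := IUnified E k) (hamiltonian L) w -
          (-D (0, 1)) • precontactForm w) v = dFun (I := IUnified E k) (hamiltonian L) w v -
          (-D (0, 1)) * precontactForm w v := rfl
      rw [h2, contrD_precontactForm hw, dFun_hamiltonian hk hL hw, precontactForm_apply hw, hξ, hm,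
        neg_mul, sub_neg_eq_add]
      rfl
    -- The covector equation is tested on all tangent vectors; the coordinate derivative is
    -- bijective, so this is the same as testing on all vectors of the model.
    constructor
    · intro h δ
      obtain ⟨v, rfl⟩ := hbij.2 δ
      exact (h1 v).1 (h v)
    · intro h v
      exact (h1 v).2 (h _)
  · rw [precontactForm_apply hw, hξ, hm]

theorem unifiedCoord_graphMap (hk : 1 ≤ k) (hL : ContMDiff (IExt E k) 𝓘(ℝ, ℝ) ∞ L)
    (hks : k ≤ 2 * k - 1) {x : Ext E Q (2 * k - 1)}
    (hx : x.1.base ∈ (chartAt E p₀.base).source) :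
    unifiedCoord p₀ (graphMap L x) =
      (((extCoord (chartAt E p₀.base) x).1, modelLeg (chartAt E p₀.base).open_target
        (contDiffOn_localLag (chart_mem_atlas E p₀.base) hL) hks (extCoord (chartAt E p₀.base) x)),
        (extCoord (chartAt E p₀.base) x).2) := by
  have h1 : momentumCoord p₀ (graphMap L x) = _ :=
    momentumCoord_eq_iff (w := graphMap L x) hx fun v =>
      legendreCovector_eq hk (chart_mem_atlas E p₀.base) hL hks hx v
  exact Prod.ext (Prod.ext rfl h1) rfl

theorem contMDiff_graphMap (hk : 1 ≤ k) (hL : ContMDiff (IExt E k) 𝓘(ℝ, ℝ) ∞ L) :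
    ContMDiff (IExt E (2 * k - 1)) (IUnified E k) ∞ (graphMap L) := by
  intro x
  have hks : k ≤ 2 * k - 1 := by omega
  have he := chart_mem_atlas E x.1.base
  have hx : x.1.base ∈ (chartAt E x.1.base).source := mem_chart_source E _
  have h1 : ContMDiffAt (IExt E (2 * k - 1)) 𝓘(ℝ, (Fin (k - 1 + 1) → E) →L[ℝ] ℝ) ∞
      (fun x' : Ext E Q (2 * k - 1) => momentumCoord x.1 (graphMap L x')) x := by
    have h2 : ContMDiffAt (IExt E (2 * k - 1)) 𝓘(ℝ, (Fin (k - 1 + 1) → E) →L[ℝ] ℝ) ∞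
        (fun x' : Ext E Q (2 * k - 1) => modelLeg (chartAt E x.1.base).open_target
          (contDiffOn_localLag he hL) hks (extCoord (chartAt E x.1.base) x')) x :=
      ContMDiffAt.comp (g := modelLeg (chartAt E x.1.base).open_target
        (contDiffOn_localLag he hL) hks) x (((contDiffOn_modelLeg _ _ hks).contDiffAt
        ((isOpen_modelDom (chartAt E x.1.base).open_target _).mem_nhds
          (extCoord_mem hx))).contMDiffAt) (contMDiffAt_extCoord he hx)
    refine h2.congr_of_eventuallyEq ?_
    filter_upwards [(isOpen_extSource _ he).mem_nhds hx] with x' hx'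
    exact congrArg (fun m : UnifiedModel E k => m.1.2)
      (unifiedCoord_graphMap (p₀ := x.1) hk hL hks hx')
  have h3 : ContMDiffAt (IExt E (2 * k - 1)) ((𝓘(ℝ, Fin (2 * k - 1 + 1) → E)).prod
      𝓘(ℝ, (Fin (k - 1 + 1) → E) →L[ℝ] ℝ)) ∞
      (fun x : Ext E Q (2 * k - 1) => (graphMap L x).1) x :=
    contMDiffAt_totalSpace.2 ⟨contMDiffAt_fst, h1⟩
  exact h3.prodMk contMDiffAt_snd

theorem vderiv_unifiedCoord_graphMap (hk : 1 ≤ k) (hL : ContMDiff (IExt E k) 𝓘(ℝ, ℝ) ∞ L)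
    (hks : k ≤ 2 * k - 1) {x : Ext E Q (2 * k - 1)}
    (hx : x.1.base ∈ (chartAt E p₀.base).source) (v : TangentSpace (IExt E (2 * k - 1)) x)
    {u : JetModel E (2 * k - 1)}
    (hu : vderiv (IExt E (2 * k - 1)) (extCoord (chartAt E p₀.base)) x v = u) :
    vderiv (IUnified E k) (unifiedCoord p₀) (graphMap L x)
      (mfderiv (IExt E (2 * k - 1)) (IUnified E k) (graphMap L) x v) =
    ((u.1, fderiv ℝ (modelLeg (chartAt E p₀.base).open_target
      (contDiffOn_localLag (chart_mem_atlas E p₀.base) hL) hks)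
        (extCoord (chartAt E p₀.base) x) u), u.2) := by
  have he := chart_mem_atlas E p₀.base
  set y := extCoord (chartAt E p₀.base) x with hy
  set l := modelLeg (chartAt E p₀.base).open_target (contDiffOn_localLag he hL) hks with hl
  refine (vderiv_comp_mfderiv (mdifferentiableAt_unifiedCoord (w := graphMap L x) hx)
    ((contMDiff_graphMap hk hL).mdifferentiable (by simp) x) v).trans ?_
  have h1 : (fun x : Ext E Q (2 * k - 1) => unifiedCoord p₀ (graphMap L x)) =ᶠ[𝓝 x]
      fun x => (((extCoord (chartAt E p₀.base) x).1, l (extCoord (chartAt E p₀.base) x)),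
        (extCoord (chartAt E p₀.base) x).2) := by
    filter_upwards [(isOpen_extSource _ he).mem_nhds hx] with x' hx'
    exact unifiedCoord_graphMap hk hL hks hx'
  have h2 : HasFDerivAt l (fderiv ℝ l y) y :=
    (((contDiffOn_modelLeg _ _ hks).contDiffAt
        ((isOpen_modelDom (chartAt E p₀.base).open_target _).mem_nhds
          (extCoord_mem hx))).differentiableAt (by simp)).hasFDerivAt
  have h3 := (hasFDerivAt_fst (𝕜 := ℝ) (p := y)).prodMk h2 |>.prodMk
    (hasFDerivAt_snd (𝕜 := ℝ) (p := y))
  rw [vderiv_congr h1, vderiv_comp (g := fun y => ((y.1, l y), y.2)) h3.differentiableAt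
    (mdifferentiableAt_extCoord he hx), hu]
  exact congrArg (fun D => D u) h3.fderiv

theorem modelProj_modelInj {s : ℕ} (h : k ≤ s) {a : ℕ} (ha : a < s + 1) (v : E) :
    modelProj E h (modelInj E s a v) = modelInj E k a v := by
  refine model_ext (fun j hj => ?_) (by rw [modelProj_snd, modelInj_snd, modelInj_snd])
  rw [modelCoord_modelProj h hj, modelCoord_modelInj ha]
  rcases lt_or_ge a (k + 1) with hak | hak
  · rw [modelCoord_modelInj hak]
  · rw [modelInj_of_le hak, if_neg (by omega)]
    simp

theorem fderiv_modelLeg_apply {l : JetModel E k → ℝ} {O : Set E} (hO : IsOpen O)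
    (hl : ContDiffOn ℝ ∞ l (modelDom O k)) {s : ℕ} (h : k ≤ s) {y : JetModel E s}
    (hy : y ∈ modelDom O s) (u : JetModel E s) (v : Fin (k - 1 + 1) → E) :
    fderiv ℝ (modelLeg hO hl h) y u v =
      ∑ i : Fin (k - 1 + 1), fderiv ℝ (momenta hO hl h i).1 y u (v i) := by
  have h1 : HasFDerivAt (modelLeg hO hl h) (fderiv ℝ (modelLeg hO hl h) y) y :=
    (((contDiffOn_modelLeg _ _ h).contDiffAt
      ((isOpen_modelDom hO _).mem_nhds hy)).differentiableAt (by simp)).hasFDerivAt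
  have h2 := h1.clm_apply (hasFDerivAt_const v y)
  have h3 : HasFDerivAt (fun y => modelLeg hO hl h y v)
      (∑ i : Fin (k - 1 + 1), (ContinuousLinearMap.apply ℝ ℝ (v i)).comp
        (fderiv ℝ (momenta hO hl h i).1 y)) y := by
    have h4 : (fun y => modelLeg hO hl h y v) = fun y => ∑ i : Fin (k - 1 + 1),
        ContinuousLinearMap.apply ℝ ℝ (v i) ((momenta hO hl h i).1 y) :=
      funext fun y => modelLeg_apply hO hl h y v
    rw [h4]
    exact HasFDerivAt.fun_sum fun i _ => (ContinuousLinearMap.apply ℝ ℝ (v i)).hasFDerivAt.comp y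
      (coeff_differentiableAt hO (momenta hO hl h i) hy).hasFDerivAt
  have h5 := congrArg (fun D => D u) (h2.unique h3)
  simpa using h5

/-- Used with `c = 0` for `coordRes` and `c = 1` for `coordShift`, to extract the component along
one axis. The vanishing of `A` from `k` on covers the indices outside the sum. -/
theorem sum_modelInj {s : ℕ} (hk : 1 ≤ k) {a : ℕ} (ha : a < s + 1) (c : ℕ)
    (A : ℕ → E →L[ℝ] ℝ) (hA : ∀ i, k ≤ i → A i = 0) (v : E) :
    ∑ i : Fin (k - 1 + 1), A i (modelCoord E s ((i : ℕ) + c) (modelInj E s a v)) =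
      if c ≤ a then A (a - c) v else 0 := by
  rw [Fin.sum_univ_eq_sum_range (fun i => A i (modelCoord E s (i + c) (modelInj E s a v))),
    Nat.sub_add_cancel hk]
  split_ifs with hc
  · rw [Finset.sum_eq_single (a - c)]
    · rw [modelCoord_modelInj ha, if_pos (by omega)]
    · intro j _ hj
      rw [modelCoord_modelInj ha, if_neg (by omega), map_zero]
    · intro h
      rw [hA _ (by simpa using h), zero_apply]
  · refine Finset.sum_eq_zero fun j _ => ?_
    rw [modelCoord_modelInj ha, if_neg (by omega), map_zero]

/-- The momentum part of the Hamiltonian equations on the graph of the Legendre map. -/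
theorem momentumEquation_iff (hk : 1 ≤ k) {l : JetModel E k → ℝ} {O : Set E} (hO : IsOpen O)
    (hl : ContDiffOn ℝ ∞ l (modelDom O k)) (h : k ≤ 2 * k - 1) {y : JetModel E (2 * k - 1)}
    (hy : y ∈ modelDom O (2 * k - 1)) (u : JetModel E (2 * k - 1)) :
    (∀ a, fderiv ℝ (modelLeg hO hl h) y u (coordRes E (by omega : k - 1 ≤ 2 * k - 1) a) =
      fderiv ℝ l (modelProj E h y) (modelProj E h (a, 0)) + modelDz l (modelProj E h y) *
        modelLeg hO hl h y (coordRes E (by omega : k - 1 ≤ 2 * k - 1) a) -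
      modelLeg hO hl h y (coordShift E (by omega : k - 1 < 2 * k - 1) a)) ↔
    ∀ a < k, fderiv ℝ (momenta hO hl h a).1 y u = (lagGrad hO hl h a).1 y +
      modelDz l (modelProj E h y) • (momenta hO hl h a).1 y -
        (seqShift (momenta hO hl h) a).1 y := by
  have hM0 : ∀ i, k ≤ i → momenta hO hl h i = 0 := fun i hi => momenta_eq_zero hO hl h hi
  have hM : ∀ i, k ≤ i → (momenta hO hl h i).1 y = 0 := fun i hi => by rw [hM0 i hi]; rfl
  have hDM : ∀ i, k ≤ i → fderiv ℝ (momenta hO hl h i).1 y u = 0 := fun i hi => by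
    rw [hM0 i hi]
    have : ((0 : CoeffModule O (E →L[ℝ] ℝ) (2 * k - 1)).1 : JetModel E (2 * k - 1) → E →L[ℝ] ℝ) =
      fun _ => 0 := rfl
    rw [this]
    simp
  let lhs : (Fin (2 * k - 1 + 1) → E) →L[ℝ] ℝ := (fderiv ℝ (modelLeg hO hl h) y u).comp
    (coordRes E (by omega : k - 1 ≤ 2 * k - 1))
  let rhs : (Fin (2 * k - 1 + 1) → E) →L[ℝ] ℝ :=
    ((fderiv ℝ l (modelProj E h y)).comp (modelProj E h)).comp (ContinuousLinearMap.inl ℝ _ _) +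
      modelDz l (modelProj E h y) • (modelLeg hO hl h y).comp
        (coordRes E (by omega : k - 1 ≤ 2 * k - 1)) -
      (modelLeg hO hl h y).comp (coordShift E (by omega : k - 1 < 2 * k - 1))
  have hsingle : ∀ j (hj : j < 2 * k - 1 + 1) (v : E),
      ((Pi.single ⟨j, hj⟩ v, 0) : JetModel E (2 * k - 1)) = modelInj E (2 * k - 1) j v :=
    fun j hj v => (modelInj_of_lt hj v).symm
  have hres : ∀ (a : Fin (2 * k - 1 + 1) → E) (i : Fin (k - 1 + 1)),
      coordRes E (by omega : k - 1 ≤ 2 * k - 1) a i =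
        modelCoord E (2 * k - 1) ((i : ℕ) + 0) (a, 0) := fun a i =>
    (modelCoord_of_lt (by omega) (a, 0)).symm
  have hshift : ∀ (a : Fin (2 * k - 1 + 1) → E) (i : Fin (k - 1 + 1)),
      coordShift E (by omega : k - 1 < 2 * k - 1) a i =
        modelCoord E (2 * k - 1) ((i : ℕ) + 1) (a, 0) := fun a i =>
    (modelCoord_of_lt (by omega) (a, 0)).symm
  have hl1 : ∀ j (hj : j < 2 * k - 1 + 1) (v : E), lhs (Pi.single ⟨j, hj⟩ v) =
      fderiv ℝ (momenta hO hl h j).1 y u v := by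
    intro j hj v
    have h1 : lhs (Pi.single ⟨j, hj⟩ v) = fderiv ℝ (modelLeg hO hl h) y u
      (coordRes E (by omega : k - 1 ≤ 2 * k - 1) (Pi.single ⟨j, hj⟩ v)) := rfl
    rw [h1, fderiv_modelLeg_apply hO hl h hy]
    simp only [hres, hsingle]
    rw [sum_modelInj hk hj 0 (fun i => fderiv ℝ (momenta hO hl h i).1 y u) hDM, if_pos (Nat.zero_le _),
      Nat.sub_zero]
  have hr1 : ∀ j (hj : j < 2 * k - 1 + 1) (v : E), rhs (Pi.single ⟨j, hj⟩ v) =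
      ((lagGrad hO hl h j).1 y + modelDz l (modelProj E h y) • (momenta hO hl h j).1 y -
        (seqShift (momenta hO hl h) j).1 y) v := by
    intro j hj v
    have h1 : modelLeg hO hl h y (coordRes E (by omega : k - 1 ≤ 2 * k - 1)
        (Pi.single ⟨j, hj⟩ v)) = (momenta hO hl h j).1 y v := by
      rw [modelLeg_apply]
      simp only [hres, hsingle]
      rw [sum_modelInj hk hj 0 (fun i => (momenta hO hl h i).1 y) hM, if_pos (Nat.zero_le _),
        Nat.sub_zero]
    have h2 : modelLeg hO hl h y (coordShift E (by omega : k - 1 < 2 * k - 1)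
        (Pi.single ⟨j, hj⟩ v)) = (seqShift (momenta hO hl h) j).1 y v := by
      rw [modelLeg_apply]
      simp only [hshift, hsingle]
      rw [sum_modelInj hk hj 1 (fun i => (momenta hO hl h i).1 y) hM]
      rcases j with _ | j
      · rfl
      · rw [if_pos (by omega)]; rfl
    have h3 : fderiv ℝ l (modelProj E h y) (modelProj E h (Pi.single ⟨j, hj⟩ v, 0)) =
        (lagGrad hO hl h j).1 y v := by
      rw [hsingle, modelProj_modelInj h hj, lagGrad_apply hO hl h j hy]
      rfl
    have h4 : rhs (Pi.single ⟨j, hj⟩ v) =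
        fderiv ℝ l (modelProj E h y) (modelProj E h (Pi.single ⟨j, hj⟩ v, 0)) +
        modelDz l (modelProj E h y) * modelLeg hO hl h y
          (coordRes E (by omega : k - 1 ≤ 2 * k - 1) (Pi.single ⟨j, hj⟩ v)) -
        modelLeg hO hl h y (coordShift E (by omega : k - 1 < 2 * k - 1)
          (Pi.single ⟨j, hj⟩ v)) := rfl
    rw [h4, h1, h2, h3]
    rfl
  -- The components `j ≥ k` carry no condition: for `j = k` this is `∂L/∂q_k = p^(k-1)`, true on the
  -- graph, and for `j > k` every term is zero.
  have htop : ∀ j, k ≤ j → (lagGrad hO hl h j).1 y +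
      modelDz l (modelProj E h y) • (momenta hO hl h j).1 y -
        (seqShift (momenta hO hl h) j).1 y = 0 := by
    intro j hj
    obtain ⟨i, rfl⟩ : ∃ i, j = i + 1 := ⟨j - 1, by omega⟩
    rw [hM _ hj, seqShift_succ, smul_zero, add_zero]
    rcases hj.lt_or_eq with hj' | hj'
    · rw [lagGrad_eq_zero hO hl h hj', hM i (by omega)]
      exact sub_zero _
    · rw [← hj', ← momenta_top hO hl h hk, show k - 1 = i by omega, sub_self]
  constructor
  · intro H a ha
    ext v
    rw [← hl1 a (by omega), ← hr1 a (by omega)]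
    exact H _
  · intro H
    have : lhs = rhs := by
      refine ContinuousLinearMap.coe_injective (LinearMap.pi_ext fun i v => ?_)
      refine (hl1 i i.2 v).trans (Eq.trans ?_ (hr1 i i.2 v).symm)
      rcases lt_or_ge (i : ℕ) k with hi | hi
      · rw [H i hi]
      · rw [hDM i hi, htop i hi]
    exact fun a => congrArg (fun D => D a) this

/-- A vector tangent to the graph of the Legendre map solves the unified equations if and only if
it is the lift of the Herglotz–Euler–Lagrange vector. -/
theorem solvesAt_graphMap_iff (hk : 1 ≤ k) (hL : ContMDiff (IExt E k) 𝓘(ℝ, ℝ) ∞ L)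
    (hks : k ≤ 2 * k - 1)
    (hreg : ∀ y ∈ modelDom (chartAt E p₀.base).target k,
      (lagHess (localLag (chartAt E p₀.base) L) y).IsInvertible) {x : Ext E Q (2 * k - 1)}
    (hx : x.1.base ∈ (chartAt E p₀.base).source) (v : TangentSpace (IExt E (2 * k - 1)) x) :
    SolvesAt L (graphMap L x) (mfderiv (IExt E (2 * k - 1)) (IUnified E k) (graphMap L) x v) ↔
      vderiv (IExt E (2 * k - 1)) (extCoord (chartAt E p₀.base)) x v =
        modelSolution (chartAt E p₀.base).open_target
          (contDiffOn_localLag (chart_mem_atlas E p₀.base) hL) hks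
          (extCoord (chartAt E p₀.base) x) := by
  have hl := contDiffOn_localLag (chart_mem_atlas E p₀.base) hL
  have hy : extCoord (chartAt E p₀.base) x ∈ modelDom (chartAt E p₀.base).target (2 * k - 1) :=
    extCoord_mem hx
  rw [← modelSolution_iff hk (chartAt E p₀.base).open_target hl hreg hks (by omega) hy,
    solvesAt_iff_unifiedCoord hk hL (w := graphMap L x) hx
      (unifiedCoord_graphMap hk hL hks hx) hks _ (vderiv_unifiedCoord_graphMap hk hL hks hx v rfl)]
  refine and_congr ?_ (and_congr (momentumEquation_iff hk _ hl hks hy _) Iff.rfl)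
  set u := vderiv (IExt E (2 * k - 1)) (extCoord (chartAt E p₀.base)) x v
  set y := extCoord (chartAt E p₀.base) x
  constructor
  · intro H j hj
    rw [modelCoord_of_lt (by omega), modelCoord_of_lt (by omega)]
    exact congrFun H ⟨j, by omega⟩
  · intro H
    funext i
    have := H i (by omega)
    rw [modelCoord_of_lt (by omega), modelCoord_of_lt (by omega)] at this
    exact this

end Equations

/-! ### From the nonsingular Hessian matrix to an invertible operator -/

section Regularity

variable {n : ℕ} {Q : Type*} [TopologicalSpace Q] [ChartedSpace (EuclideanSpace ℝ (Fin n)) Q]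
  [IsManifold 𝓘(ℝ, EuclideanSpace ℝ (Fin n)) ∞ Q] {k : ℕ}
  {L : Ext (EuclideanSpace ℝ (Fin n)) Q k → ℝ}

theorem IsRegularLagrangian.isInvertible_lagHess (hreg : IsRegularLagrangian L)
    (hL : ContMDiff (IExt (EuclideanSpace ℝ (Fin n)) k) 𝓘(ℝ, ℝ) ∞ L)
    {e : OpenPartialHomeomorph Q (EuclideanSpace ℝ (Fin n))}
    (he : e ∈ atlas (EuclideanSpace ℝ (Fin n)) Q) {y : JetModel (EuclideanSpace ℝ (Fin n)) k}
    (hy : y ∈ modelDom e.target k) : (lagHess (localLag e L) y).IsInvertible := by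
  have hdet := hreg e he (extOfCoord e y) (base_extOfCoord hy)
  have hl := contDiffOn_localLag he hL
  let b := (EuclideanSpace.basisFun (Fin n) ℝ).toBasis
  have hb : ∀ i, b i = EuclideanSpace.single i 1 := fun i => by simp [b]
  have hent : ∀ i j, hessian L e (extOfCoord e y) i j =
      lagHess (localLag e L) y (b j) (b i) := by
    intro i j
    have hxy : (jetCoord e (extOfCoord e y : Ext (EuclideanSpace ℝ (Fin n)) Q k).1,
        (extOfCoord e y : Ext (EuclideanSpace ℝ (Fin n)) Q k).2) = y :=
      extCoord_extOfCoord he hy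
    have h1 : hessian L e (extOfCoord e y) i j = fderiv ℝ (fun y => fderiv ℝ (localLag e L) y
        (Pi.single (Fin.last k) (EuclideanSpace.single i 1), 0))
        (jetCoord e (extOfCoord e y : Ext (EuclideanSpace ℝ (Fin n)) Q k).1,
          (extOfCoord e y : Ext (EuclideanSpace ℝ (Fin n)) Q k).2)
        (Pi.single (Fin.last k) (EuclideanSpace.single j 1), 0) := rfl
    have h2 : ∀ v : EuclideanSpace ℝ (Fin n), ((Pi.single (Fin.last k) v, 0) :
        JetModel (EuclideanSpace ℝ (Fin n)) k) = modelInj _ k k v :=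
      fun v => (modelInj_of_lt (Nat.lt_succ_self k) v).symm
    rw [h1, hxy, h2, h2, hb, hb]
    have h3 : DifferentiableAt ℝ (partialLag (localLag e L) k) y :=
      ((contDiffOn_partialLag e.open_target hl k).contDiffAt
        ((isOpen_modelDom e.open_target k).mem_nhds hy)).differentiableAt (by simp)
    have h4 := h3.hasFDerivAt.clm_apply
      (hasFDerivAt_const (EuclideanSpace.single i (1 : ℝ) : EuclideanSpace ℝ (Fin n)) y)
    have h5 := congrArg (fun D => D (modelInj _ k k (EuclideanSpace.single j 1))) h4.fderiv
    refine h5.trans ?_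
    simp [lagHess]
  -- A kernel vector of the operator gives, through its components, a kernel vector of the matrix.
  -- In finite dimension injectivity suffices, as `E` and its dual have the same dimension.
  have hinj : Function.Injective (lagHess (localLag e L) y) := by
    refine (injective_iff_map_eq_zero _).2 fun v hv => ?_
    by_contra hne
    refine hdet (Matrix.exists_mulVec_eq_zero_iff.1 ⟨b.repr v, ?_, ?_⟩)
    · intro h
      exact hne (b.repr.map_eq_zero_iff.1 (Finsupp.ext fun i => congrFun h i))
    · funext i
      have h1 : lagHess (localLag e L) y (∑ j, b.repr v j • b j) (b i) = 0 := by
        rw [b.sum_repr, hv]; rfl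
      rw [map_sum, sum_apply] at h1
      rw [Matrix.mulVec, Pi.zero_apply, ← h1]
      refine Finset.sum_congr rfl fun j _ => ?_
      rw [map_smul, smul_apply, smul_eq_mul, mul_comm]
      exact congrArg _ (hent i j)
  have hfin : Module.finrank ℝ (EuclideanSpace ℝ (Fin n)) =
      Module.finrank ℝ (EuclideanSpace ℝ (Fin n) →L[ℝ] ℝ) :=
    ((InnerProductSpace.toDual ℝ (EuclideanSpace ℝ (Fin n))).toLinearEquiv).finrank_eq
  have : FiniteDimensional ℝ (EuclideanSpace ℝ (Fin n) →L[ℝ] ℝ) :=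
    (InnerProductSpace.toDual ℝ
      (EuclideanSpace ℝ (Fin n))).toLinearEquiv.finiteDimensional
  exact ⟨(LinearEquiv.ofInjectiveOfFinrankEq _ hinj hfin).toContinuousLinearEquiv,
    ContinuousLinearMap.ext fun v => rfl⟩

end Regularity

/-! ### Existence, uniqueness, smoothness and holonomy -/

section Dynamics

variable {E : Type*} [NormedAddCommGroup E] [NormedSpace ℝ E]
  {Q : Type*} [TopologicalSpace Q] [ChartedSpace E Q] [IsManifold 𝓘(ℝ, E) ∞ Q]
  {k : ℕ} {L : Ext E Q k → ℝ}

theorem exists_graphMap_eq {w : Unified E Q k} (hw : w ∈ graphLegendre L) :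
    ∃ x, graphMap L x = w := by
  obtain ⟨⟨p, ξ⟩, z⟩ := w
  refine ⟨(p, z), ?_⟩
  have h1 : (⟨jetProj (by omega : k - 1 ≤ 2 * k - 1) p, ξ⟩ : CotBundle E Q (k - 1)) =
      ⟨jetProj (by omega : k - 1 ≤ 2 * k - 1) p, legendreCovector L (p, z)⟩ :=
    congrArg Prod.fst hw
  have h2 : (ξ : CotJet E Q (k - 1) (jetProj (by omega : k - 1 ≤ 2 * k - 1) p)) =
      legendreCovector L (p, z) :=
    (TotalSpace.mk_inj (E := CotJet E Q (k - 1))).1 h1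
  exact congrArg (fun ξ : UnifiedFib E Q k p => ((⟨p, ξ⟩, z) : Unified E Q k)) h2.symm

/-- Regularity of a Lagrangian in natural coordinates. -/
def IsLocallyRegular (L : Ext E Q k → ℝ) : Prop :=
  ∀ e ∈ atlas E Q, ∀ y ∈ modelDom e.target k, (lagHess (localLag e L) y).IsInvertible

theorem existsUnique_solvesAt (hk : 1 ≤ k) (hL : ContMDiff (IExt E k) 𝓘(ℝ, ℝ) ∞ L)
    (hreg : IsLocallyRegular L) (x : Ext E Q (2 * k - 1)) :
    ∃! v : TangentSpace (IExt E (2 * k - 1)) x, SolvesAt L (graphMap L x)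
      (mfderiv (IExt E (2 * k - 1)) (IUnified E k) (graphMap L) x v) := by
  have hx : x.1.base ∈ (chartAt E x.1.base).source := mem_chart_source E _
  have he := chart_mem_atlas E x.1.base
  have hks : k ≤ 2 * k - 1 := by omega
  obtain ⟨v, hv⟩ := (vderiv_extCoord_bijective he hx).2
    (modelSolution (chartAt E x.1.base).open_target (contDiffOn_localLag he hL) hks
      (extCoord (chartAt E x.1.base) x))
  refine ⟨v, (solvesAt_graphMap_iff (p₀ := x.1) hk hL hks (hreg _ he) hx v).2 hv, fun v' hv' => ?_⟩
  exact (vderiv_extCoord_bijective he hx).1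
    (((solvesAt_graphMap_iff (p₀ := x.1) hk hL hks (hreg _ he) hx v').1 hv').trans hv.symm)

variable {X : FieldAlong L} {U : ∀ x : Ext E Q (2 * k - 1), TangentSpace (IExt E (2 * k - 1)) x}

theorem vderiv_unifiedCoord_solution (hk : 1 ≤ k) (hL : ContMDiff (IExt E k) 𝓘(ℝ, ℝ) ∞ L)
    (hreg : IsLocallyRegular L) (hks : k ≤ 2 * k - 1)
    (hU : ∀ x, X ⟨graphMap L x, graphMap_mem L x⟩ =
      mfderiv (IExt E (2 * k - 1)) (IUnified E k) (graphMap L) x (U x))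
    (hX : ∀ w : graphLegendre L, SolvesAt L w (X w)) {p₀ : Jet E Q (2 * k - 1)}
    {x : Ext E Q (2 * k - 1)} (hx : x.1.base ∈ (chartAt E p₀.base).source)
    {u : JetModel E (2 * k - 1)} (hu : modelSolution (chartAt E p₀.base).open_target
      (contDiffOn_localLag (chart_mem_atlas E p₀.base) hL) hks
        (extCoord (chartAt E p₀.base) x) = u) :
    vderiv (IUnified E k) (unifiedCoord p₀) (graphMap L x)
      (X ⟨graphMap L x, graphMap_mem L x⟩) =
    ((u.1, fderiv ℝ (modelLeg (chartAt E p₀.base).open_target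
      (contDiffOn_localLag (chart_mem_atlas E p₀.base) hL) hks)
        (extCoord (chartAt E p₀.base) x) u), u.2) := by
  have h1 := hX ⟨graphMap L x, graphMap_mem L x⟩
  rw [hU] at h1
  have h2 := (solvesAt_graphMap_iff hk hL hks (hreg _ (chart_mem_atlas E p₀.base)) hx _).1 h1
  rw [hU]
  exact vderiv_unifiedCoord_graphMap hk hL hks hx _ (h2.trans hu)

theorem tangent_trivializationAt_apply {V : Type*} [NormedAddCommGroup V] [NormedSpace ℝ V]
    {H : Type*} [TopologicalSpace H] {I : ModelWithCorners ℝ V H} {M : Type*} [TopologicalSpace M]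
    [ChartedSpace H M] [IsManifold I 1 M] {x₀ x : M} (hx : x ∈ (extChartAt I x₀).source)
    (v : TangentSpace I x) :
    (trivializationAt V (TangentSpace I) x₀ ⟨x, v⟩).2 = vderiv I (extChartAt I x₀) x v := by
  rw [extChartAt_source] at hx
  have h := congrArg (fun A => A v) (TangentBundle.continuousLinearMapAt_trivializationAt hx)
  refine Eq.trans ?_ h
  have hb : x ∈ (trivializationAt V (TangentSpace I) x₀).baseSet := by
    rwa [TangentBundle.trivializationAt_baseSet]
  simp only [Trivialization.continuousLinearMapAt_apply]
  rw [Trivialization.coe_linearMapAt_of_mem _ hb]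

/-- Pointwise uniqueness gives smoothness: in each natural chart the field must agree with the
smooth `modelSolution`, lifted by the derivative of the Legendre map. -/
theorem isSmoothAlong_of_solution [CompleteSpace E] (hk : 1 ≤ k)
    (hL : ContMDiff (IExt E k) 𝓘(ℝ, ℝ) ∞ L) (hreg : IsLocallyRegular L)
    (hU : ∀ x, X ⟨graphMap L x, graphMap_mem L x⟩ =
      mfderiv (IExt E (2 * k - 1)) (IUnified E k) (graphMap L) x (U x))
    (hX : ∀ w : graphLegendre L, SolvesAt L w (X w)) : IsSmoothAlong X := by
  intro x
  have : IsManifold (IUnified E k) 1 (Unified E Q k) := IsManifold.of_le (n := ∞) (by simp)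
  have hks : k ≤ 2 * k - 1 := by omega
  have he := chart_mem_atlas E x.1.base
  have hx : x.1.base ∈ (chartAt E x.1.base).source := mem_chart_source E _
  have hl := contDiffOn_localLag he hL
  have hy := (isOpen_modelDom (chartAt E x.1.base).open_target _).mem_nhds (extCoord_mem hx)
  refine contMDiffAt_totalSpace.2 ⟨contMDiff_graphMap hk hL x, ?_⟩
  let g : JetModel E (2 * k - 1) → JetModel E (2 * k - 1) :=
    modelSolution (chartAt E x.1.base).open_target hl hks
  have hg : ContDiffAt ℝ ∞ g (extCoord (chartAt E x.1.base) x) :=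
    (contDiffOn_modelSolution _ hl (hreg _ he) hks).contDiffAt hy
  have hleg : ContDiffAt ℝ ∞ (fderiv ℝ (modelLeg (chartAt E x.1.base).open_target hl hks))
      (extCoord (chartAt E x.1.base) x) :=
    (contDiffOn_fderiv (chartAt E x.1.base).open_target (contDiffOn_modelLeg _ hl hks)).contDiffAt
      hy
  have hG : ContDiffAt ℝ ∞ (fun y => (((g y).1, fderiv ℝ (modelLeg
      (chartAt E x.1.base).open_target hl hks) y (g y)), (g y).2))
      (extCoord (chartAt E x.1.base) x) :=
    (hg.fst.prodMk (hleg.clm_apply hg)).prodMk hg.snd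
  refine (hG.contMDiffAt.comp x (contMDiffAt_extCoord he hx)).congr_of_eventuallyEq ?_
  filter_upwards [(isOpen_extSource _ he).mem_nhds hx] with x' hx'
  rw [tangent_trivializationAt_apply
    (mem_chart_source_unified (w₀ := graphMap L x) (w := graphMap L x') hx'), extChartAt_unified]
  exact vderiv_unifiedCoord_solution hk hL hreg hks hU hX (p₀ := x.1) hx' rfl

theorem eq_iteratedDeriv_of_hasDerivAt {U : Set ℝ} (hU : IsOpen U) {m : ℕ} {q : ℕ → ℝ → E}
    (h : ∀ j < m, ∀ t ∈ U, HasDerivAt (q j) (q (j + 1) t) t) {j : ℕ} (hj : j ≤ m) :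
    ∀ t ∈ U, q j t = iteratedDeriv j (q 0) t := by
  induction j with
  | zero => intro t _; simp
  | succ j ih =>
    intro t ht
    rw [iteratedDeriv_succ, ← (h j hj t ht).deriv]
    refine Filter.EventuallyEq.deriv_eq ?_
    filter_upwards [hU.mem_nhds ht] with s hs using ih (by omega) s hs

/-- In coordinates every integral curve satisfies `q̇_j = q_(j+1)` for `j < 2k - 1`, hence `q_j` is
the `j`-th derivative of `q_0`. These are the coordinates of the lift of the base curve. -/
theorem isHolonomicAlong_of_solution (hk : 1 ≤ k)
    (hL : ContMDiff (IExt E k) 𝓘(ℝ, ℝ) ∞ L) (hreg : IsLocallyRegular L)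
    (hU : ∀ x, X ⟨graphMap L x, graphMap_mem L x⟩ =
      mfderiv (IExt E (2 * k - 1)) (IUnified E k) (graphMap L) x (U x))
    (hX : ∀ w : graphLegendre L, SolvesAt L w (X w)) : IsHolonomicAlong X := by
  intro σ J hJ ⟨hσ, hint⟩
  have hks : k ≤ 2 * k - 1 := by omega
  let p : ℝ → Jet E Q (2 * k - 1) := fun t => (rhoOne (σ t)).1
  have hp : ContinuousOn p J := continuous_unified_proj.comp_continuousOn hσ.continuousOn
  have key : ∀ t ∈ J, ∃ V ⊆ J, IsOpen V ∧ t ∈ V ∧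
      (∀ s ∈ V, (p s).base ∈ (chartAt E (p t).base).source) ∧
      ∀ j < 2 * k - 1, ∀ s ∈ V, HasDerivAt
        (fun s => modelCoord E (2 * k - 1) j (jetCoord (chartAt E (p t).base) (p s), 0))
        (modelCoord E (2 * k - 1) (j + 1) (jetCoord (chartAt E (p t).base) (p s), 0)) s := by
    intro t ht
    have he := chart_mem_atlas E (p t).base
    set e := chartAt E (p t).base with he_def
    -- The chart is fixed at time `t`, and the differential equations hold on the whole open set of
    -- times where the curve stays in its domain; iterating derivatives at `t` requires a
    -- neighbourhood.
    refine ⟨J ∩ p ⁻¹' {p | p.base ∈ e.source}, inter_subset_left,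
      hp.isOpen_inter_preimage hJ (isOpen_jetSource _ he), ⟨ht, mem_chart_source E _⟩,
      fun s hs => hs.2, fun j hj s hs => ?_⟩
    obtain ⟨hw, hv⟩ := hint s hs.1
    obtain ⟨x, hx⟩ := exists_graphMap_eq hw
    have hxp : x.1 = p s := by
      change (rhoOne (graphMap L x)).1 = _
      rw [hx]
    have hxs : x.1.base ∈ e.source := by rw [hxp]; exact hs.2
    have hσs : MDifferentiableAt 𝓘(ℝ, ℝ) (IUnified E k) σ s :=
      (hσ.contMDiffAt (hJ.mem_nhds hs.1)).mdifferentiableAt (by simp)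
    let A : UnifiedModel E k →L[ℝ] E := (modelCoord E (2 * k - 1) j).comp
      ((ContinuousLinearMap.inl ℝ _ _).comp
        ((ContinuousLinearMap.fst ℝ _ _).comp (ContinuousLinearMap.fst ℝ _ _)))
    -- The type of `X` depends on the point, so `σ s` is replaced by `graphMap L x` through a
    -- variable `w`.
    have hXx : ∀ (w : Unified E Q k) (hw : w ∈ graphLegendre L), graphMap L x = w →
        vderiv (IUnified E k) (unifiedCoord (p t)) w (X ⟨w, hw⟩) =
          vderiv (IUnified E k) (unifiedCoord (p t)) (graphMap L x)
            (X ⟨graphMap L x, graphMap_mem L x⟩) := by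
      rintro w hw rfl; rfl
    have hAx : ∀ w' : Unified E Q k, A (unifiedCoord (p t) w') =
      modelCoord E (2 * k - 1) j (jetCoord e w'.1.1, 0) := fun _ => rfl
    have hwd : (σ s).1.1.base ∈ e.source := hs.2
    have h1 : MDifferentiableAt 𝓘(ℝ, ℝ) 𝓘(ℝ, UnifiedModel E k)
        (fun s => unifiedCoord (p t) (σ s)) s :=
      MDifferentiableAt.comp (g := unifiedCoord (p t)) s (mdifferentiableAt_unifiedCoord hwd) hσs
    have h2 : DifferentiableAt ℝ (fun s => unifiedCoord (p t) (σ s)) s :=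
      mdifferentiableAt_iff_differentiableAt.1 h1
    have h3 := (A.hasFDerivAt (x := unifiedCoord (p t) (σ s))).comp_hasDerivAt s h2.hasDerivAt
    have h4 : deriv (fun s => unifiedCoord (p t) (σ s)) s =
        vderiv (IUnified E k) (unifiedCoord (p t)) (σ s) (X ⟨σ s, hw⟩) := by
      rw [← hv]
      refine Eq.trans ?_
        (vderiv_comp_mfderiv (mdifferentiableAt_unifiedCoord hwd) hσs (1 : ℝ)).symm
      rw [vderiv, mfderiv_eq_fderiv]
      rfl
    have h5 : ∀ u : JetModel E (2 * k - 1), modelCoord E (2 * k - 1) j (u.1, 0) =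
        modelCoord E (2 * k - 1) j u := fun u => by
      rw [modelCoord_of_lt (by omega), modelCoord_of_lt (by omega)]
    rw [h4, hXx _ hw hx, vderiv_unifiedCoord_solution hk hL hreg hks hU hX hxs rfl] at h3
    refine h3.congr_deriv ?_
    refine (h5 _).trans ?_
    rw [modelCoord_modelSolution _ _ _ _ hj, modelCoord_of_lt (by omega),
      modelCoord_of_lt (by omega), ← hxp]
    rfl
  have hbase : ContMDiffOn 𝓘(ℝ, ℝ) 𝓘(ℝ, E) ∞ (fun t => (p t).base) J := by
    intro t ht
    refine ContMDiffAt.contMDiffWithinAt ?_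
    obtain ⟨V, -, hV, htV, hVs, -⟩ := key t ht
    have he := chart_mem_atlas E (p t).base
    set e := chartAt E (p t).base with he_def
    have ht0 : (p t).base ∈ e.source := mem_chart_source E _
    have h1 : ContMDiffAt 𝓘(ℝ, ℝ) 𝓘(ℝ, E) ∞ (fun s => jetCoord e (p s) 0) t := by
      let A : UnifiedModel E k →L[ℝ] E := (ContinuousLinearMap.proj 0).comp
        ((ContinuousLinearMap.fst ℝ _ _).comp (ContinuousLinearMap.fst ℝ _ _))
      have h2 : ContMDiffAt (IUnified E k) 𝓘(ℝ, E) ∞ (fun w => A (unifiedCoord (p t) w)) (σ t) :=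
        ContMDiffAt.comp (g := A) (σ t) A.contDiff.contMDiff.contMDiffAt
          (contMDiffAt_unifiedCoord ht0)
      exact h2.comp t (hσ.contMDiffAt (hJ.mem_nhds ht))
    have h2 : ContMDiffAt 𝓘(ℝ, E) 𝓘(ℝ, E) ∞ e.symm (jetCoord e (p t) 0) :=
      (contMDiffOn_symm_of_mem_maximalAtlas (IsManifold.subset_maximalAtlas he)).contMDiffAt
        (e.open_target.mem_nhds (jetCoord_zero_mem ht0))
    refine (h2.comp t h1).congr_of_eventuallyEq ?_
    filter_upwards [hV.mem_nhds htV] with s hs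
    rw [Function.comp_apply, jetCoord_zero, e.left_inv (hVs s hs)]
  refine ⟨hbase, fun t ht => ?_⟩
  obtain ⟨V, -, hV, htV, hVs, hd⟩ := key t ht
  have he := chart_mem_atlas E (p t).base
  have ht0 : (p t).base ∈ (chartAt E (p t).base).source := mem_chart_source E _
  have hc : ∀ᶠ t' in 𝓝 t, ContMDiffAt 𝓘(ℝ, ℝ) 𝓘(ℝ, E) ∞ (fun s => (p s).base) t' := by
    filter_upwards [hJ.mem_nhds ht] with s hs using hbase.contMDiffAt (hJ.mem_nhds hs)
  change p t = prolong E (2 * k - 1) (fun s => (p s).base) t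
  rw [← jetOfCoord_jetCoord he ht0, ← jetOfCoord_jetCoord he
    (p := prolong E (2 * k - 1) (fun s => (p s).base) t) (by rw [base_prolong]; exact ht0)]
  refine congrArg _ (funext fun i => ?_)
  rw [jetCoord_prolong he hc ht0]
  have h1 := eq_iteratedDeriv_of_hasDerivAt hV hd (Nat.lt_succ_iff.1 i.2) t htV
  rw [modelCoord_of_lt i.2] at h1
  refine h1.trans (Filter.EventuallyEq.iteratedDeriv_eq _ (Eventually.of_forall fun s => ?_))
  exact (modelCoord_of_lt (Nat.succ_pos _) _).trans (jetCoord_zero _ _)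

/-- Existence, uniqueness and holonomy of the dynamics of a regular Lagrangian. -/
theorem exists_dynamics [CompleteSpace E] (hk : 1 ≤ k)
    (hL : ContMDiff (IExt E k) 𝓘(ℝ, ℝ) ∞ L) (hreg : IsLocallyRegular L) :
    ∃ X : FieldAlong L,
      (IsSmoothAlong X ∧ (∀ w : graphLegendre L, SolvesAt L w (X w)) ∧ IsTangentAlong X) ∧
      IsHolonomicAlong X ∧
      ∀ Y : FieldAlong L, (IsSmoothAlong Y ∧ (∀ w : graphLegendre L, SolvesAt L w (Y w)) ∧
        IsTangentAlong Y) → Y = X := by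
  choose U hU hUniq using existsUnique_solvesAt hk hL hreg
  -- The vector belongs to the point `graphMap L (rhoOne w)`, equal to `w` on the graph; the
  -- ascription to the model space bridges the two tangent spaces.
  let X : FieldAlong L := fun w =>
    (mfderiv (IExt E (2 * k - 1)) (IUnified E k) (graphMap L) (rhoOne (w : Unified E Q k))
      (U (rhoOne (w : Unified E Q k))) : UnifiedModel E k)
  have hXU : ∀ x, X ⟨graphMap L x, graphMap_mem L x⟩ =
      mfderiv (IExt E (2 * k - 1)) (IUnified E k) (graphMap L) x (U x) := fun x => rfl
  have hX : ∀ w : graphLegendre L, SolvesAt L w (X w) := by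
    rintro ⟨w, hw⟩
    obtain ⟨x, rfl⟩ := exists_graphMap_eq hw
    exact hU x
  refine ⟨X, ⟨isSmoothAlong_of_solution hk hL hreg hXU hX, hX, fun x => ⟨U x, hXU x⟩⟩,
    isHolonomicAlong_of_solution hk hL hreg hXU hX, fun Y hY => ?_⟩
  funext w
  obtain ⟨w, hw⟩ := w
  obtain ⟨x, rfl⟩ := exists_graphMap_eq hw
  -- Tangency puts any competitor in the range of the derivative of `graphMap`, where the equations
  -- at the point have only one solution.
  obtain ⟨v, hv⟩ := hY.2.2 x
  have h1 := hY.2.1 ⟨graphMap L x, graphMap_mem L x⟩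
  rw [hv] at h1
  exact hv.trans (congrArg _ (hUniq x v h1))

end Dynamics

end

end HOContact

theorem mainTheorem7 (n k : ℕ) (hk : 1 ≤ k) (Q : Type*) [TopologicalSpace Q] [T2Space Q]
    [SecondCountableTopology Q] [ChartedSpace (EuclideanSpace ℝ (Fin n)) Q]
    [IsManifold 𝓘(ℝ, EuclideanSpace ℝ (Fin n)) ∞ Q]
    (L : HOContact.Ext (EuclideanSpace ℝ (Fin n)) Q k → ℝ)
    (hL : ContMDiff (HOContact.IExt (EuclideanSpace ℝ (Fin n)) k) 𝓘(ℝ, ℝ) ∞ L)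
    (hreg : HOContact.IsRegularLagrangian L) :
    ∃ X : HOContact.FieldAlong L,
      (HOContact.IsSmoothAlong X ∧ (∀ w : HOContact.graphLegendre L, HOContact.SolvesAt L w (X w)) ∧
        HOContact.IsTangentAlong X) ∧
      HOContact.IsHolonomicAlong X ∧
      ∀ Y : HOContact.FieldAlong L,
        (HOContact.IsSmoothAlong Y ∧ (∀ w : HOContact.graphLegendre L, HOContact.SolvesAt L w (Y w)) ∧
          HOContact.IsTangentAlong Y) → Y = X := by
  exact HOContact.exists_dynamics hk hL fun e he y hy => hreg.isInvertible_lagHess hL he hy
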